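/- **Setting.** A multi-objective graph consists of a finite node set $V$, a set $E\subseteq V\times V$ of directed edges, and a vector $w_e\in\mathbb R_{\ge 0}^W$, $W\ge 1$, for each $e\in E$. Fix a start node $s$ from which every node can be reached and $K\ge 1$ coefficient vectors $\lambda_1,\dots,\lambda_K\in\mathbb R_{>0}^W$. Paths may repeat nodes; the objective vector of a path is the sum of the vectors of its edges, and its cost with respect to $\lambda_i$ is the inner product of this vector with $\lambda_i$. A path to $v$ means a path from $s$ to $v$; a vector $a$ dominates $b\neq a$ if $a\le b$ coordinatewise; a path to $v$ is a Pareto path if no path to $v$ dominates it. A node is an $l$-node if at most $l$ different Pareto paths lead to it. $L$ is the least integer $l$ such that the fraction of the nodes that are $l$-nodes is at least $1-\log|V|/|V|$ (it is assumed to exist). $N_L$ is the maximum, over all $L$-nodes $v$ and all Pareto paths $p$ to $v$, of the number of paths to $v$ that $p$ does not dominate. **The algorithm IDAQ.** It computes by one run of Dijkstra's algorithm with a Fibonacci heap a $\lambda_1$-cheapest path $p^*_v$ to each node $v$. It keeps for each $v$ the list $Q_v$ of discovered paths to $v$, each of which is either in the queue or has been popped, and a Fibonacci heap with the queued paths of non-null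 priority. In iteration $i$ a queued path to $v$ has priority equal to its $\lambda_i$-cost if it is cheaper than all popped paths to $v$ and cheapest (the earliest pushed one, in case of ties) among the queued paths to $v$; otherwise its priority is null. At the beginning the path consisting of $s$ is pushed, and $i=1$. While the heap is non-empty, a path of minimal priority is popped and *developed*: each of its extensions $p$ by one edge, to a node $u$ say, is *scanned*, i.e. it is dropped if $p^*_u$ dominates it, and otherwise pushed if it is relevant. If $|Q_u|<K/W$, then $p$ is relevant if no path in $Q_u$ dominates it, and then the paths in $Q_u$ that $p$ dominates are removed; otherwise $p$ is relevant if for some $j$ it is strictly $\lambda_j$-cheaper than the best path in $Q_u$ for $\lambda_j$, and then the array of the best paths for $\lambda_1,\dots,\lambda_K$ is updated and the paths in $Q_u$ that are not in this array are removed. When the heap is empty, $i$ is increased and the queue is *adapted*, i.e. all priorities are recomputed and the heap is rebuilt; after iteration $K$ the procedure *Build-Sets* returns, for each $i$ and $v$, a $\lambda_i$-cheapest popped path to $v$. The running time is the total number of elementary operations (arithmetic and comparisons of real numbers, pointer and array operations) of all these parts: initialization, developing, scanning, adapting and Build-Sets. **Theorem.** Let $F$ be a function with $F(n)=o(\log n)$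 and let $c>0$. There are $C$ and $n_0$ such that the following holds for each instance as above with $|V|\ge n_0$. Assume that $$W\le c,\qquad \text{all in- and out-degrees are}\ \le c\log|V|,\qquad K\le c\sqrt{|V|},$$ $$N_L\le c\,L,\qquad N_L\le K/W,\qquad L\le c\,F(|V|).$$ Then IDAQ terminates, and its running time $T$ satisfies $$T\le C\left(|E|\,F(|V|)^2+|V|^{3/2}F(|V|)\right).$$ If moreover $\log|V|\le c\,K$ (for example if $K$ is of exact order $\sqrt{|V|}$), then $$T\le C\left(|E|\,L^2+K\,|V|\,L\right).$$ -/

import Mathlib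

open Filter Asymptotics

/-! ### Counting elementary steps

`Timed α` is a value together with the number of elementary steps spent on computing it.  An
elementary step is one operation of a RAM with real-number registers: an arithmetic operation or a
comparison on two reals, following or redirecting a constant number of pointers, or reading or
writing an array cell.  Every loop below spends at least one step per pass. -/

structure Timed (α : Type) where
  ret : α
  time : ℕ

namespace Timed

instance : Monad Timed where
  pure a := ⟨a, 0⟩
  bind x f := ⟨(f x.ret).ret, x.time + (f x.ret).time⟩

/-- Spend `k` elementary steps. -/
def tick (k : ℕ) : Timed Unit := ⟨(), k⟩

end Timed

/-! ### Fibonacci heaps -/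

/-- A list of heap-ordered trees in first-child / next-sibling form.  `cons x m c s` is the list
whose first tree has root `x` (with mark `m`) and whose root has the list of children `c`; the
remaining trees of the list are `s`. -/
inductive FibForest (α : Type) : Type where
  | nil : FibForest α
  | cons (x : α) (marked : Bool) (children siblings : FibForest α) : FibForest α

namespace FibForest

variable {α : Type}

/-- Number of trees in the list (not of nodes).  The number of children of a node, its degree, is
stored with the node. -/
def length : FibForest α → ℕ
  | nil => 0
  | cons _ _ _ s => s.length + 1

/-- Concatenation; one step on circular doubly linked lists. -/
def append : FibForest α → FibForest α → FibForest α
  | nil, t => t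
  | cons x m c s, t => cons x m c (s.append t)

/-- `detach x f`, for a list `f` of siblings below a common parent: cut off the subtree of `x`, and
then perform the cascading cuts inside `f`: a node that loses a child is marked if it is unmarked,
and is cut off as well if it is marked.  The result is `none` if `x` does not occur in `f`, and
otherwise consists of what is left of `f`, the trees that were cut off, and whether one of them was
itself a member of the list `f` (so that the parent of `f` has lost a child).  The node `x` is
reached by a pointer and the cascade follows parent pointers, so that each cut is one step. -/
def detach [DecidableEq α] (x : α) :
    FibForest α → Option (FibForest α × FibForest α × Bool)
  | nil => none
  | cons y m c s =>
    if y = x then some (s, cons y false c nil, true)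
    else
      match detach x c with
      | some (c', t, lost) =>
        if lost then
          if m then some (s, cons y false c' t, true)
          else some (cons y true c' s, t, false)
        else some (cons y m c' s, t, false)
      | none =>
        match detach x s with
        | some (s', t, lost) => some (cons y m c s', t, lost)
        | none => none

/-- Cut `x` off inside a root list; nothing happens if `x` is a root, and roots are neither marked
nor cut.  The result is the remaining root list and the list of the trees that were cut off. -/
def detachRoots [DecidableEq α] (x : α) : FibForest α → FibForest α × FibForest α
  | nil => (nil, nil)
  | cons y m c s =>
    if y = x then (cons y m c s, nil)
    else
      match detach x c with
      | some (c', t, _) => (cons y m c' s, t)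
      | none => (cons y m c (detachRoots x s).1, (detachRoots x s).2)

/-- Make `x` a root, with cascading cuts: one step, and one for each cut. -/
def cut [DecidableEq α] (x : α) (f : FibForest α) : Timed (FibForest α) :=
  ⟨(detachRoots x f).2.append (detachRoots x f).1, 1 + (detachRoots x f).2.length⟩

/-- Remove the root `x`; the result is the list of its children and the list of the other trees. -/
def removeRoot [DecidableEq α] (x : α) : FibForest α → FibForest α × FibForest α
  | nil => (nil, nil)
  | cons y m c s =>
    if y = x then (c, s) else ((removeRoot x s).1, cons y m c (removeRoot x s).2)

/-- Link two trees, each given by its root and the children of the root: the root with the larger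
key becomes an unmarked child of the other. -/
noncomputable def link (key : α → ℝ) (t u : α × FibForest α) : α × FibForest α :=
  if key u.1 < key t.1 then (u.1, cons t.1 false t.2 u.2) else (t.1, cons u.1 false u.2 t.2)

/-- `place key d t slots` puts the tree `t` into cell `d` of the array `slots`; if this cell is
occupied, the two trees are linked and the result is put into the next cell, and so on.  One step
for each cell that is visited; cell `d` itself is reached by indexing. -/
noncomputable def place (key : α → ℝ) :
    ℕ → α × FibForest α → List (Option (α × FibForest α)) →
      Timed (List (Option (α × FibForest α)))
  | 0, t, [] => ⟨[some t], 1⟩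
  | 0, t, none :: r => ⟨some t :: r, 1⟩
  | 0, t, some u :: r => ⟨none :: (place key 0 (link key t u) r).ret,
      1 + (place key 0 (link key t u) r).time⟩
  | d + 1, t, [] => ⟨none :: (place key d t []).ret, (place key d t []).time⟩
  | d + 1, t, o :: r => ⟨o :: (place key d t r).ret, (place key d t r).time⟩
termination_by d _ r => d + r.length

/-- Link trees of equal degree until all degrees are different; cell `d` of the resulting array
holds the tree whose root has degree `d`. -/
noncomputable def consolidate (key : α → ℝ) :
    FibForest α → Timed (List (Option (α × FibForest α)))
  | nil => pure []
  | cons x _ c s => do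
    Timed.tick 1
    let slots ← consolidate key s
    place key c.length (x, c) slots

/-- The trees in an array, as a root list. -/
def ofSlots : List (Option (α × FibForest α)) → FibForest α
  | [] => nil
  | none :: r => ofSlots r
  | some (x, c) :: r => cons x false c (ofSlots r)

/-- A root with minimal key. -/
noncomputable def minRoot (key : α → ℝ) : FibForest α → Option α
  | nil => none
  | cons x _ _ s =>
    match minRoot key s with
    | none => some x
    | some y => if key y < key x then some y else some x

end FibForest

/-- A Fibonacci heap: a root list, a pointer to a root with minimal key, and the keys. -/
structure FibHeap (α : Type) where
  roots : FibForest α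
  min : Option α
  key : α → ℝ

namespace FibHeap

variable {α : Type}

def empty : FibHeap α := ⟨FibForest.nil, none, fun _ => 0⟩

/-- Insert a new item `x` with key `k`: a new tree with one node. -/
noncomputable def insert [DecidableEq α] (x : α) (k : ℝ) (h : FibHeap α) : Timed (FibHeap α) := do
  Timed.tick 1
  pure
    { roots := FibForest.cons x false FibForest.nil h.roots
      min :=
        match h.min with
        | none => some x
        | some y => if k < h.key y then some x else some y
      key := Function.update h.key x k }

/-- Lower the key of the item `x` to `k`, cutting `x` off from its parent. -/
noncomputable def decreaseKey [DecidableEq α] (x : α) (k : ℝ) (h : FibHeap α) :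
    Timed (FibHeap α) := do
  Timed.tick 1
  let f ← h.roots.cut x
  pure
    { roots := f
      min :=
        match h.min with
        | none => some x
        | some y => if k < h.key y then some x else some y
      key := Function.update h.key x k }

/-- Remove the item `x`, which has to be a root: its children become roots, the root list is
consolidated, and the array of trees is searched for the new minimum. -/
noncomputable def deleteRoot [DecidableEq α] (x : α) (h : FibHeap α) : Timed (FibHeap α) := do
  let cs := h.roots.removeRoot x
  Timed.tick (1 + cs.1.length)
  let slots ← (cs.1.append cs.2).consolidate h.key
  Timed.tick (1 + slots.length)
  pure
    { roots := FibForest.ofSlots slots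
      min := (FibForest.ofSlots slots).minRoot h.key
      key := h.key }

/-- Remove an arbitrary item `x`. -/
noncomputable def delete [DecidableEq α] (x : α) (h : FibHeap α) : Timed (FibHeap α) := do
  let f ← h.roots.cut x
  deleteRoot x { h with roots := f }

/-- Remove an item with minimal key; `none` if the heap is empty. -/
noncomputable def extractMin [DecidableEq α] (h : FibHeap α) :
    Timed (Option (α × FibHeap α)) := do
  Timed.tick 1
  match h.min with
  | none => pure none
  | some x => do
    let h' ← h.deleteRoot x
    pure (some (x, h'))

end FibHeap

/-! ### Multi-objective graphs, paths, costs -/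

/-- A multi-objective graph with the nodes `Fin n`, a set of directed edges, and `W` non-negative
objective values on each edge. -/
structure MOG (n W : ℕ) where
  edges : Finset (Fin n × Fin n)
  weight : Fin n × Fin n → Fin W → ℝ
  weight_nonneg : ∀ e ∈ edges, ∀ j, 0 ≤ weight e j

/-- A path is the list of its nodes in reverse order: the head of the list is the last node of the
path.  Appending a node to a path is one pointer operation, and initial segments are shared. -/
abbrev NodePath (n : ℕ) := List (Fin n)

/-- `Dominates a b`: the objective vector `a` Pareto dominates `b`. -/
def Dominates {W : ℕ} (a b : Fin W → ℝ) : Prop := (∀ j, a j ≤ b j) ∧ ∃ j, a j < b j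

namespace MOG

variable {n W : ℕ} (G : MOG n W)

/-- `p` is a path that starts in `s`; nodes may be repeated. -/
def IsPathFrom (s : Fin n) : NodePath n → Prop
  | [] => False
  | [v] => v = s
  | v :: u :: p => (u, v) ∈ G.edges ∧ IsPathFrom s (u :: p)

/-- The set of the paths from `s` to `v`. -/
def paths (s v : Fin n) : Set (NodePath n) := {p | G.IsPathFrom s p ∧ p.head? = some v}

/-- The objective vector of a path: the sum of the vectors of its edges. -/
def vec : NodePath n → Fin W → ℝ
  | v :: u :: p => vec (u :: p) + G.weight (u, v)
  | _ => 0

/-- The nodes to which there is an edge from `v`. -/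
def neighbors (v : Fin n) : List (Fin n) :=
  (List.finRange n).filter fun u => (v, u) ∈ G.edges

def outDegree (v : Fin n) : ℕ := (G.edges.filter fun e => e.1 = v).card

def inDegree (v : Fin n) : ℕ := (G.edges.filter fun e => e.2 = v).card

/-- The set of the Pareto non-dominated paths from `s` to `v`. -/
def paretoPaths (s v : Fin n) : Set (NodePath n) :=
  {p | p ∈ G.paths s v ∧ ∀ q ∈ G.paths s v, ¬ Dominates (G.vec q) (G.vec p)}

/-- `v` is an `l`-node: at most `l` different Pareto paths lead to `v`. -/
def IsLNode (s : Fin n) (l : ℕ) (v : Fin n) : Prop := (G.paretoPaths s v).encard ≤ l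

/-- The fraction of the nodes that are `l`-nodes. -/
noncomputable def alpha (s : Fin n) (l : ℕ) : ℝ := ({v | G.IsLNode s l v}.ncard : ℝ) / n

/-- The maximal number of paths to an `l`-node that are not dominated by a single Pareto path to
that node. -/
noncomputable def maxNonDominated (s : Fin n) (l : ℕ) : ℕ∞ :=
  ⨆ v : Fin n, ⨆ _ : G.IsLNode s l v, ⨆ p ∈ G.paretoPaths s v,
    {q | q ∈ G.paths s v ∧ ¬ Dominates (G.vec p) (G.vec q)}.encard

end MOG

/-- An instance of the multi-objective weighted shortest path problem: a multi-objective graph, a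
start node from which every node can be reached, and `K` positive coefficient vectors. -/
structure MOWSP (n W K : ℕ) extends MOG n W where
  source : Fin n
  coeff : Fin K → Fin W → ℝ
  coeff_pos : ∀ i j, 0 < coeff i j
  reachable : ∀ v, (toMOG.paths source v).Nonempty
  W_pos : 0 < W
  K_pos : 0 < K

namespace MOWSP

variable {n W K : ℕ} (I : MOWSP n W K)

/-- The cost of a path with respect to the `i`th coefficient vector.  The objective vector of a path
is stored with the path, so that this takes `W` steps. -/
noncomputable def cost (i : Fin K) (p : NodePath n) : ℝ := ∑ j, I.coeff i j * I.vec p j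

/-- The index of the first coefficient vector. -/
def first : Fin K := ⟨0, I.K_pos⟩

/-- The first element of a list of paths that has minimal cost with respect to the `i`th coefficient
vector, found by going through the list with a strict comparison. -/
noncomputable def firstMin (i : Fin K) (l : List (NodePath n)) : Option (NodePath n) :=
  l.foldl (fun o p =>
    match o with
    | none => some p
    | some b => if I.cost i p < I.cost i b then some p else some b) none

/-! ### The Pareto sample: one run of the Dijkstra algorithm with the first coefficient vector -/

/-- `path v` is the best path to `v` that has been found, `settled v` tells whether `v` has been
extracted from the heap; the heap holds the other nodes to which a path has been found. -/
structure DijkstraState (n : ℕ) where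
  heap : FibHeap (Fin n)
  path : Fin n → Option (NodePath n)
  settled : Fin n → Bool

/-- Relax the edge from the last node of `p` to `v`.  The costs of `p` and of the edge are known, so
that the cost of the extended path takes one addition. -/
noncomputable def relax (p : NodePath n) (d : DijkstraState n) (v : Fin n) :
    Timed (DijkstraState n) := do
  Timed.tick 1
  match d.path v with
  | none => do
    let h ← d.heap.insert v (I.cost I.first (v :: p))
    pure { d with heap := h, path := Function.update d.path v (some (v :: p)) }
  | some q =>
    if d.settled v = false ∧ I.cost I.first (v :: p) < I.cost I.first q then do
      let h ← d.heap.decreaseKey v (I.cost I.first (v :: p))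
      pure { d with heap := h, path := Function.update d.path v (some (v :: p)) }
    else pure d

/-- Extract a node with minimal tentative cost, store the objective vector of its path, and relax
its outgoing edges. -/
noncomputable def dijkstraStep (d : DijkstraState n) : Timed (DijkstraState n) := do
  let r ← d.heap.extractMin
  match r with
  | none => pure d
  | some (u, h) => do
    Timed.tick W
    (I.neighbors u).foldlM (I.relax ((d.path u).getD []))
      { d with heap := h, settled := Function.update d.settled u true }

/-- The Pareto sample: a path to each node.  The costs of all edges are computed at the beginning,
and each of `n` rounds settles one node. -/
noncomputable def paretoSample : Timed (Fin n → NodePath n) := do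
  Timed.tick (n + I.edges.card * W)
  let h ← FibHeap.empty.insert I.source 0
  let d ← (List.range n).foldlM (fun d _ => I.dijkstraStep d)
    { heap := h
      path := Function.update (fun _ => none) I.source (some [I.source])
      settled := fun _ => false }
  pure fun v => (d.path v).getD []

/-! ### The state of the IDAQ algorithm -/

/-- A discovered path.  It is in the list of optimal paths if `popped` is true, and otherwise in the
adaptive queue; `prio` is its priority, where `none` stands for null. -/
structure Entry (n : ℕ) where
  path : NodePath n
  popped : Bool
  prio : Option ℝ

/-- `found v` lists the discovered paths that end in `v`, in the order in which they were pushed;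
the length of this list is stored.  `best v` is the array of the best discovered paths to `v` for
all coefficient vectors, or `none` as long as it has not been needed.  The priority heap holds the
paths in the adaptive queue with non-null priority.  An entry is reached from the corresponding heap
item by a pointer, and vice versa. -/
structure State (n K : ℕ) where
  iteration : Fin K
  found : Fin n → List (Entry n)
  best : Fin n → Option (Fin K → Option (NodePath n))
  heap : FibHeap (NodePath n)

/-! ### The relevance check -/

/-- Remove the entries that fail `keep` from a list of entries, and from the priority heap. -/
noncomputable def prune (keep : NodePath n → Bool) :
    List (Entry n) → FibHeap (NodePath n) → Timed (List (Entry n) × FibHeap (NodePath n))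
  | [], h => pure ([], h)
  | e :: l, h => do
    Timed.tick 1
    let r ← prune keep l h
    if keep e.path then pure (e :: r.1, r.2)
    else if e.prio.isSome then do
      let h' ← r.2.delete e.path
      pure (r.1, h')
    else pure r

/-- Does the cost of `p` improve on the `i`th entry of an array of best paths? -/
def Improves (b : Fin K → Option (NodePath n)) (p : NodePath n) (i : Fin K) : Prop :=
  match b i with
  | none => True
  | some q => I.cost i p < I.cost i q

open Classical in
/-- Enter `p` into an array of best paths wherever it is an improvement. -/
noncomputable def improve (b : Fin K → Option (NodePath n)) (p : NodePath n) :
    Fin K → Option (NodePath n) :=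
  fun i => if I.Improves b p i then some p else b i

open Classical in
/-- The relevance check for a path `p` that ends in `v`.  If fewer than `K / W` paths to `v` are
known, then `p` is relevant if it is not dominated by one of them, and the known paths that `p`
dominates are removed; otherwise `p` is relevant if it improves on the best known path for one of
the coefficient vectors, and the known paths which then are no longer best for any coefficient
vector are removed.  The array of best paths is computed when it is first needed, and is updated
from then on for each relevant path. -/
noncomputable def isRelevant (v : Fin n) (p : NodePath n) (st : State n K) :
    Timed (Bool × State n K) := do
  let Q := st.found v
  Timed.tick 1
  if (Q.length : ℝ) < (K : ℝ) / W then do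
    Timed.tick (Q.length * W)
    if ∃ e ∈ Q, Dominates (I.vec e.path) (I.vec p) then pure (false, st)
    else do
      Timed.tick (Q.length * W)
      let r ← prune (fun q => decide (¬ Dominates (I.vec p) (I.vec q))) Q st.heap
      match st.best v with
      | none => pure (true, { st with found := Function.update st.found v r.1, heap := r.2 })
      | some b => do
        Timed.tick (K * W + K)
        pure (true,
          { st with
            found := Function.update st.found v r.1
            best := Function.update st.best v (some (I.improve b p))
            heap := r.2 })
  else do
    let b : Fin K → Option (NodePath n) ←
      match st.best v with
      | some b => pure b
      | none => do
        Timed.tick (Q.length * (K * W + K))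
        pure fun i => I.firstMin i (Q.map Entry.path)
    Timed.tick (K * W + K)
    if ∃ i, I.Improves b p i then do
      Timed.tick (Q.length + K)
      let r ← prune (fun q => decide (∃ i, I.improve b p i = some q)) Q st.heap
      pure (true,
        { st with
          found := Function.update st.found v r.1
          best := Function.update st.best v (some (I.improve b p))
          heap := r.2 })
    else pure (false, { st with best := Function.update st.best v (some b) })

/-! ### The adaptive queue -/

/-- Set the priorities of a list of entries to null, and remove them from the priority heap. -/
noncomputable def nullify :
    List (Entry n) → FibHeap (NodePath n) → Timed (List (Entry n) × FibHeap (NodePath n))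
  | [], h => pure ([], h)
  | e :: l, h => do
    Timed.tick 1
    let r ← nullify l h
    if e.prio.isSome then do
      let h' ← r.2.delete e.path
      pure ({ e with prio := none } :: r.1, h')
    else pure (e :: r.1, r.2)

open Classical in
/-- Push a path `p` that ends in `v`.  Its priority is null if some path to `v` that is in the queue
or was popped is at most as expensive with respect to the current coefficient vector. -/
noncomputable def push (v : Fin n) (p : NodePath n) (st : State n K) : Timed (State n K) := do
  let Q := st.found v
  Timed.tick (1 + W + Q.length * (W + 1))
  if ∃ e ∈ Q, I.cost st.iteration e.path ≤ I.cost st.iteration p then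
    pure { st with found := Function.update st.found v (Q ++ [⟨p, false, none⟩]) }
  else do
    let r ← nullify Q st.heap
    let h ← r.2.insert p (I.cost st.iteration p)
    pure
      { st with
        found := Function.update st.found v
          (r.1 ++ [⟨p, false, some (I.cost st.iteration p)⟩])
        heap := h }

open Classical in
/-- The path among the entries `Q` for a single node that has non-null priority with respect to the
`i`th coefficient vector, if there is one: the first one in the queue with minimal cost among those
in the queue, provided that each popped one is more expensive. -/
noncomputable def candidate (i : Fin K) (Q : List (Entry n)) : Option (NodePath n) :=
  match I.firstMin i ((Q.filter fun e => !e.popped).map Entry.path) with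
  | none => none
  | some p =>
    if ∀ e ∈ Q, e.popped = true → I.cost i p < I.cost i e.path then some p else none

/-- Recompute the priorities of the paths to `v` for the `i`th coefficient vector. -/
noncomputable def adaptNode (i : Fin K) (st : State n K) (v : Fin n) : Timed (State n K) := do
  let Q := st.found v
  Timed.tick (1 + Q.length * (W + 1))
  match I.candidate i Q with
  | none =>
    pure { st with found := Function.update st.found v (Q.map fun e => { e with prio := none }) }
  | some p => do
    let h ← st.heap.insert p (I.cost i p)
    pure
      { st with
        found := Function.update st.found v (Q.map fun e =>
          { e with prio := if e.path = p then some (I.cost i p) else none })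
        heap := h }

/-- Adapt the queue to the `i`th coefficient vector: start with a new priority heap and recompute
all priorities. -/
noncomputable def adapt (i : Fin K) (st : State n K) : Timed (State n K) := do
  Timed.tick 1
  (List.finRange n).foldlM (I.adaptNode i) { st with iteration := i, heap := FibHeap.empty }

/-! ### Building the sets of optimal paths -/

/-- For each coefficient vector and each node `v`, the first cheapest one among the popped paths
to `v`. -/
noncomputable def buildSets (st : State n K) : Timed (Fin K → Fin n → Option (NodePath n)) := do
  Timed.tick (∑ _i : Fin K, (1 + ∑ v : Fin n, (1 + (st.found v).length * (W + 1))))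
  pure fun i v => I.firstMin i (((st.found v).filter fun e => e.popped).map Entry.path)

/-! ### The IDAQ algorithm -/

open Classical in
/-- Scan the path that extends `p` by the node `u`. -/
noncomputable def scan (sample : Fin n → NodePath n) (p : NodePath n) (st : State n K) (u : Fin n) :
    Timed (State n K) := do
  Timed.tick (1 + 2 * W)
  if Dominates (I.vec (sample u)) (I.vec (u :: p)) then pure st
  else do
    let r ← I.isRelevant u (u :: p) st
    if r.1 then I.push u (u :: p) r.2 else pure r.2

/-- Move a path `p` that ends in `v` from the queue to the list of optimal paths. -/
def markPopped (v : Fin n) (p : NodePath n) (st : State n K) : State n K :=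
  { st with
    found := Function.update st.found v ((st.found v).map fun e =>
      if e.path = p then { e with popped := true, prio := none } else e) }

/-- One pass of the main loop.  If the priority heap is empty, then the next iteration starts, or
the result is returned if this was the last one.  Otherwise a path with minimal priority is popped
and developed: all its extensions by one edge are scanned. -/
noncomputable def step (sample : Fin n → NodePath n) (st : State n K) :
    Timed (State n K ⊕ (Fin K → Fin n → Option (NodePath n))) := do
  Timed.tick 1
  let r ← st.heap.extractMin
  match r with
  | none =>
    if h : st.iteration.val + 1 < K then do
      let st' ← I.adapt ⟨st.iteration.val + 1, h⟩ st
      pure (Sum.inl st')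
    else do
      let out ← I.buildSets st
      pure (Sum.inr out)
  | some ([], h) => pure (Sum.inl { st with heap := h })
  | some (v :: p, h) => do
    Timed.tick 1
    let st' ← (I.neighbors v).foldlM (I.scan sample (v :: p))
      (markPopped v (v :: p) { st with heap := h })
    pure (Sum.inl st')

/-- At most `fuel` passes of the main loop; the result is `none` if these are not enough. -/
noncomputable def loop (sample : Fin n → NodePath n) :
    ℕ → State n K → Timed (Option (Fin K → Fin n → Option (NodePath n)))
  | 0, _ => pure none
  | fuel + 1, st => do
    let r ← I.step sample st
    match r with
    | Sum.inl st' => loop sample fuel st'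
    | Sum.inr out => pure (some out)

/-- IDAQ with at most `fuel` passes of the main loop. -/
noncomputable def idaq (fuel : ℕ) : Timed (Option (Fin K → Fin n → Option (NodePath n))) := do
  let sample ← I.paretoSample
  Timed.tick n
  let st ← I.push I.source [I.source]
    { iteration := I.first, found := fun _ => [], best := fun _ => none, heap := FibHeap.empty }
  I.loop sample fuel st

/-- IDAQ terminates on the instance `I`, after exactly `t` elementary steps. -/
def IDAQRunsIn (t : ℕ) : Prop := ∃ fuel out, I.idaq fuel = ⟨some out, t⟩

end MOWSP

/-! The proof is an amortized analysis that rests on counting how many paths to a node can be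
popped, scanned or stored. Write `N` for the value of `maxNonDominated`, and call a node good if it
is an `L`-node and bad otherwise.

Good nodes. The sample path to a node is cheapest for a strictly positive coefficient vector, hence
a Pareto path (`paretoSample_spec`). So at most `N` paths to a good node survive the comparison with
the sample (`sparse_lNodes`). Because `N ≤ K / W`, the relevance check at a good node always takes
its first branch, and no array of best paths is ever built there.

Bad nodes. There are at most `log n` of them (`card_compl_lNodes_le`). At any node at most one path
is popped per iteration: a popped path is a cheapest known one, and whatever is scanned later in
that iteration extends a path that is at least as expensive, hence is not strictly cheaper, as
weights are non-negative. So at most `K` paths to each node are popped. A scanned path extends a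
popped path to an in-neighbour, so at most `1 + Δ * K` paths to a node are scanned; pruning leaves
at most `K + 1` stored.

Accounting. `RunInv` records the sets of popped and of scanned paths. It is preserved by
`RunInv.pop`, `scan_undominated` and `adapt_runInv`, each with a time bound that is amortized
against the heap potential and against a reserve for building the arrays of best paths. A pass that
does not end the run either pops a path that was never popped before or starts a new iteration, so
`loop_spec` gives termination and a telescoped bound at once; `idaq_time` inserts the counts.

Heaps. With the potential of three units per root and six per mark, every operation has logarithmic
amortized time, since degrees are logarithmic by Fibonacci growth. The priority heap holds at most
one path per node, because a path with a priority is the first minimum of all known paths to its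
node. That pruning respects first minima is the content of `firstMin_filter_append`; it also keeps
the arrays of best paths correct.

Asymptotics (`total_le`). Good nodes contribute terms of order `n * L ^ 2` (at most the order of `E
* L ^ 2`, as there are at least `n - 1` edges), `n * L * log n` and `K * n * L`. Bad nodes
contribute at most the order of `K ^ 2 * (log n) ^ 3`, which is of order `K * n` because `(log n) ^
3 ≤ √n` and `K ≤ c * √n`. The middle term is finally absorbed by `log n ≤ √n`, or by `log n ≤ c *
K`. -/

/-! ### Structure of Fibonacci forests -/

namespace FibForest

variable {α : Type}

/-- All items of a forest. -/
def items : FibForest α → List α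
  | nil => []
  | cons x _ c s => x :: (c.items ++ s.items)

/-- The roots of a forest. -/
def rootItems : FibForest α → List α
  | nil => []
  | cons x _ _ s => x :: s.rootItems

/-- The number of marked nodes. -/
def marks : FibForest α → ℕ
  | nil => 0
  | cons _ m c s => (if m then 1 else 0) + c.marks + s.marks

/-- The degree invariant of a list of siblings below a common parent: a node with `k` older siblings
has at least `k` children, or `k - 1` if it is marked. -/
def Graded : FibForest α → Prop
  | nil => True
  | cons _ m c s => s.length ≤ c.length + (if m then 1 else 0) ∧ c.Graded ∧ s.Graded

/-- The degree invariant of a root list. -/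
def RootsGraded : FibForest α → Prop
  | nil => True
  | cons _ _ c s => c.Graded ∧ s.RootsGraded

/-- Each node has a key that is at most the keys of its descendants. -/
def HeapOrdered (key : α → ℝ) : FibForest α → Prop
  | nil => True
  | cons x _ c s => (∀ y ∈ c.items, key x ≤ key y) ∧ c.HeapOrdered key ∧ s.HeapOrdered key

theorem Graded.rootsGraded {f : FibForest α} (h : f.Graded) : f.RootsGraded := by
  induction f with
  | nil => trivial
  | cons x m c s _ ihs => exact ⟨h.2.1, ihs h.2.2⟩

@[simp] theorem items_append (f g : FibForest α) : (f.append g).items = f.items ++ g.items := by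
  induction f with
  | nil => rfl
  | cons x m c s _ ih => simp [append, items, ih]

@[simp] theorem rootItems_append (f g : FibForest α) :
    (f.append g).rootItems = f.rootItems ++ g.rootItems := by
  induction f with
  | nil => rfl
  | cons x m c s _ ih => simp [append, rootItems, ih]

@[simp] theorem length_append (f g : FibForest α) :
    (f.append g).length = f.length + g.length := by
  induction f with
  | nil => simp [append, length]
  | cons x m c s _ ih => simp only [append, length, ih]; omega

@[simp] theorem marks_append (f g : FibForest α) : (f.append g).marks = f.marks + g.marks := by
  induction f with
  | nil => simp [append, marks]
  | cons x m c s _ ih => simp only [append, marks, ih]; omega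

theorem RootsGraded.append {f g : FibForest α} (hf : f.RootsGraded) (hg : g.RootsGraded) :
    (f.append g).RootsGraded := by
  induction f with
  | nil => exact hg
  | cons x m c s _ ih => exact ⟨hf.1, ih hf.2⟩

theorem HeapOrdered.append {key : α → ℝ} {f g : FibForest α} (hf : f.HeapOrdered key)
    (hg : g.HeapOrdered key) : (f.append g).HeapOrdered key := by
  induction f with
  | nil => exact hg
  | cons x m c s _ ih => exact ⟨hf.1, hf.2.1, ih hf.2.2⟩

theorem rootItems_subset (f : FibForest α) : ∀ x ∈ f.rootItems, x ∈ f.items := by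
  induction f with
  | nil => simp [rootItems]
  | cons y m c s _ ih =>
    intro x hx
    simp only [rootItems, items, List.mem_cons, List.mem_append] at hx ⊢
    rcases hx with h | h
    · exact Or.inl h
    · exact Or.inr (Or.inr (ih x h))

theorem HeapOrdered.congr {key key' : α → ℝ} {f : FibForest α} (hf : f.HeapOrdered key)
    (h : ∀ x ∈ f.items, key' x = key x) : f.HeapOrdered key' := by
  induction f with
  | nil => trivial
  | cons y m c s ihc ihs =>
    simp only [items, List.mem_cons, List.mem_append] at h
    refine ⟨fun z hz => ?_, ihc hf.2.1 fun x hx => h x (by simp [hx]),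
      ihs hf.2.2 fun x hx => h x (by simp [hx])⟩
    rw [h y (by simp), h z (by simp [hz])]
    exact hf.1 z hz

/-- A smaller key can only conflict with ancestors, and a root has none. Distinctness of the items
excludes a second occurrence of `x` below some other root. -/
theorem HeapOrdered.update_root [DecidableEq α] {key : α → ℝ} {f : FibForest α}
    (hf : f.HeapOrdered key) (hn : f.items.Nodup) {x : α} (hx : x ∈ f.rootItems) {k : ℝ}
    (hk : k ≤ key x) : f.HeapOrdered (Function.update key x k) := by
  induction f with
  | nil => trivial
  | cons y m c s ihc ihs =>
    simp only [items, List.nodup_cons, List.nodup_append, List.mem_append, not_or] at hn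
    obtain ⟨⟨hyc, hys⟩, hc, hs, hcs⟩ := hn
    simp only [rootItems, List.mem_cons] at hx
    by_cases hxy : x = y
    · subst hxy
      refine ⟨fun z hz => ?_, hf.2.1.congr fun z hz => ?_, hf.2.2.congr fun z hz => ?_⟩
      · have : z ≠ x := fun h => hyc (h ▸ hz)
        rw [Function.update_self, Function.update_of_ne this]
        exact hk.trans (hf.1 z hz)
      · exact Function.update_of_ne (ne_of_mem_of_not_mem hz hyc) _ _
      · exact Function.update_of_ne (ne_of_mem_of_not_mem hz hys) _ _
    · have hxs := hx.resolve_left hxy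
      have hxc : ∀ z ∈ c.items, z ≠ x := fun z hz h =>
        hcs z hz x (s.rootItems_subset x hxs) h
      refine ⟨fun z hz => ?_, hf.2.1.congr fun z hz => Function.update_of_ne (hxc z hz) _ _,
        ihs hf.2.2 hs hxs⟩
      rw [Function.update_of_ne (Ne.symm hxy), Function.update_of_ne (hxc z hz)]
      exact hf.1 z hz

theorem HeapOrdered.exists_root_le {key : α → ℝ} {f : FibForest α} (hf : f.HeapOrdered key) :
    ∀ y ∈ f.items, ∃ x ∈ f.rootItems, key x ≤ key y := by
  induction f with
  | nil => simp [items]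
  | cons x m c s _ ihs =>
    intro y hy
    simp only [items, List.mem_cons, List.mem_append] at hy
    rcases hy with rfl | hy | hy
    · exact ⟨y, by simp [rootItems], le_rfl⟩
    · exact ⟨x, by simp [rootItems], hf.1 y hy⟩
    · obtain ⟨z, hz, hzy⟩ := ihs hf.2.2 y hy
      exact ⟨z, by simp [rootItems, hz], hzy⟩

/-- A graded list of `d` siblings has at least `fib (d + 2) - 1` nodes. -/
theorem Graded.fib_le {f : FibForest α} (h : f.Graded) :
    Nat.fib (f.length + 2) ≤ f.items.length + 1 := by
  induction f with
  | nil => simp [length, items]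
  | cons x m c s ihc ihs =>
    obtain ⟨h1, h2, h3⟩ := h
    have hc := ihc h2
    have hs := ihs h3
    simp only [length, items, List.length_cons, List.length_append]
    have h4 : Nat.fib (s.length + 1 + 2) = Nat.fib (s.length + 1) + Nat.fib (s.length + 2) :=
      Nat.fib_add_two
    -- A mark costs the newest sibling at most one of its `s.length` guaranteed children, so its
    -- subtree supplies the term of the Fibonacci recursion with the smaller index; the older
    -- siblings supply the other term.
    have h5 : Nat.fib (s.length + 1) ≤ Nat.fib (c.length + 2) := by
      apply Nat.fib_mono
      split_ifs at h1 <;> omega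
    omega

/-- Two steps of the recursion at least double a Fibonacci number. This rate suffices for
logarithmic degrees and keeps the golden ratio out of the proof. -/
theorem two_pow_le_fib (k : ℕ) : 2 ^ k ≤ Nat.fib (2 * k + 2) := by
  induction k with
  | zero => simp
  | succ k ih =>
    have h1 : Nat.fib (2 * (k + 1) + 2) = Nat.fib (2 * k + 2) + Nat.fib (2 * k + 3) :=
      Nat.fib_add_two
    have h2 : Nat.fib (2 * k + 2) ≤ Nat.fib (2 * k + 3) := Nat.fib_mono (by omega)
    rw [pow_succ]
    omega

theorem le_log_of_fib_le {d m : ℕ} (h : Nat.fib (d + 2) ≤ m) : d ≤ 2 * Nat.log 2 m + 1 := by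
  have h1 : 2 ^ (d / 2) ≤ m :=
    (two_pow_le_fib (d / 2)).trans ((Nat.fib_mono (by omega)).trans h)
  have h2 := Nat.le_log_of_pow_le (by norm_num) h1
  omega

/-! ### Cutting -/

section cut

variable [DecidableEq α] {x : α}

theorem detach_eq_none {f : FibForest α} (h : detach x f = none) : x ∉ f.items := by
  induction f with
  | nil => simp [items]
  | cons y m c s ihc ihs =>
    rw [detach] at h
    by_cases hy : y = x
    · simp [hy] at h
    rw [if_neg hy] at h
    split at h
    · split_ifs at h
    · rename_i hc
      split at h
      · cases h
      · rename_i hs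
        simp only [items, List.mem_cons, List.mem_append, not_or]
        exact ⟨fun h => hy h.symm, ihc hc, ihs hs⟩

/-- What a successful cut achieves. -/
structure DetachSpec (x : α) (f f' t : FibForest α) (lost : Bool) : Prop where
  perm : (f'.items ++ t.items).Perm f.items
  root : x ∈ t.rootItems
  length : f'.length + (if lost then 1 else 0) = f.length
  potential : 4 * t.length + 6 * f'.marks + 6 * t.marks ≤
    6 * f.marks + if lost then 4 else 10
  graded : f.Graded → f'.Graded ∧ t.RootsGraded
  ordered : ∀ key, f.HeapOrdered key → f'.HeapOrdered key ∧ t.HeapOrdered key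

/-- Each tree that is cut off is charged 4 units: one step and three units of root potential. A
cascading cut turns a marked node into an unmarked root, which releases 6 units and pays for itself.
While the cascade is running only the 4 units of the first cut are outstanding; when it stops at an
unmarked node, the new mark adds 6. The degree invariant survives because removing a sibling only
weakens the demand on the younger ones. -/
theorem detach_spec {f f' t : FibForest α} {lost : Bool} (h : detach x f = some (f', t, lost)) :
    DetachSpec x f f' t lost := by
  induction f generalizing f' t lost with
  | nil => cases h
  | cons y m c s ihc ihs =>
    rw [detach] at h
    by_cases hy : y = x
    · rw [if_pos hy] at h
      cases h
      subst hy
      refine ⟨?_, by simp [rootItems], by simp [length], ?_, fun h => ⟨h.2.2, h.2.1, trivial⟩,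
        fun key h => ⟨h.2.2, h.1, h.2.1, trivial⟩⟩
      · simp only [items, List.append_nil]
        exact List.perm_append_comm
      · simp only [length, marks]
        split_ifs <;> simp at * <;> omega
    · rw [if_neg hy] at h
      split at h
      · rename_i c' t' lost' hc
        obtain ⟨hp, hr, hl, hm, hg, ho⟩ := ihc hc
        have hsub : ∀ z ∈ c'.items, z ∈ c.items := fun z hz => hp.subset (by simp [hz])
        cases lost' with
        | true =>
          simp only [if_true] at h hl hm
          split_ifs at h with hmk
          · cases h
            subst hmk
            refine ⟨?_, ?_, by simp [length], ?_, fun h => ⟨h.2.2, (hg h.2.1).1, (hg h.2.1).2⟩,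
              fun key h => ⟨h.2.2, fun z hz => h.1 z (hsub z hz), (ho key h.2.1).1,
                (ho key h.2.1).2⟩⟩
            · simp only [items]
              refine List.perm_append_comm.trans ?_
              simpa using hp.append_right s.items
            · simp [rootItems, hr]
            · simp only [length, marks, if_true]
              simp
              omega
          · cases h
            refine ⟨?_, hr, by simp [length], ?_, fun h => ⟨⟨?_, (hg h.2.1).1, h.2.2⟩, (hg h.2.1).2⟩,
              fun key h => ⟨⟨fun z hz => h.1 z (hsub z hz), (ho key h.2.1).1, h.2.2⟩,
                (ho key h.2.1).2⟩⟩
            · simp only [items, List.cons_append, List.append_assoc]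
              refine List.Perm.cons _ ?_
              refine (List.Perm.append_left _ List.perm_append_comm).trans ?_
              simpa using hp.append_right s.items
            · simp only [marks, hmk, if_true]
              simp
              omega
            -- The lost child is made up for by the new mark in the degree inequality.
            · have := h.1
              simp only [hmk, if_true] at this ⊢
              simp at this
              omega
        | false =>
          simp only [Bool.false_eq_true, if_false] at h hl hm
          cases h
          refine ⟨?_, hr, by simp [length], ?_, fun h => ⟨⟨?_, (hg h.2.1).1, h.2.2⟩, (hg h.2.1).2⟩,
              fun key h => ⟨⟨fun z hz => h.1 z (hsub z hz), (ho key h.2.1).1, h.2.2⟩,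
                (ho key h.2.1).2⟩⟩
          · simp only [items, List.cons_append, List.append_assoc]
            refine List.Perm.cons _ ?_
            refine (List.Perm.append_left _ List.perm_append_comm).trans ?_
            simpa using hp.append_right s.items
          · simp only [marks]
            simp
            omega
          · have := h.1
            omega
      · split at h
        · rename_i s' t' lost' hs
          cases h
          obtain ⟨hp, hr, hl, hm, hg, ho⟩ := ihs hs
          refine ⟨?_, hr, ?_, ?_, fun h => ⟨⟨?_, h.2.1, (hg h.2.2).1⟩, (hg h.2.2).2⟩,
            fun key h => ⟨⟨h.1, h.2.1, (ho key h.2.2).1⟩, (ho key h.2.2).2⟩⟩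
          · simp only [items, List.cons_append, List.append_assoc]
            exact List.Perm.cons _ (hp.append_left _)
          · simp only [length]
            omega
          · simp only [marks]
            omega
          · have := h.1
            omega
        · cases h

/-- What a cut in a root list achieves. -/
structure CutSpec (x : α) (f f' : FibForest α) : Prop where
  perm : f'.items.Perm f.items
  root : x ∈ f'.rootItems
  roots : ∀ z ∈ f.rootItems, z ∈ f'.rootItems
  graded : f.RootsGraded → f'.RootsGraded
  ordered : ∀ key, f.HeapOrdered key → f'.HeapOrdered key

/-- A root has no degree requirement relative to its siblings, so losing a child there needs neither
a mark nor a cut, and the cascade stops. -/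
theorem detachRoots_spec {f : FibForest α} (hx : x ∈ f.items) :
    CutSpec x f ((detachRoots x f).2.append (detachRoots x f).1) ∧
      (detachRoots x f).1.length = f.length ∧
      4 * (detachRoots x f).2.length + 6 * (detachRoots x f).1.marks
        + 6 * (detachRoots x f).2.marks ≤ 6 * f.marks + 10 := by
  induction f with
  | nil => simp [items] at hx
  | cons y m c s _ ihs =>
    rw [detachRoots]
    split_ifs with hy
    · refine ⟨⟨by simp [append], ?_, fun _ h => h, fun h => h, fun _ h => h⟩, rfl, by simp [length, marks]⟩
      simp [append, rootItems, hy]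
    · split
      · rename_i c' t lost hc
        obtain ⟨hp, hr, hl, hm, hg, ho⟩ := detach_spec hc
        have hsub : ∀ z ∈ c'.items, z ∈ c.items := fun z hz => hp.subset (by simp [hz])
        refine ⟨⟨?_, by simp [hr], fun z hz => ?_, fun h => (hg h.1).2.append ⟨(hg h.1).1, h.2⟩, fun key h =>
          (ho key h.2.1).2.append ⟨fun z hz => h.1 z (hsub z hz), (ho key h.2.1).1, h.2.2⟩⟩,
          rfl, ?_⟩
        · simp only [items_append, items]
          refine List.perm_middle.trans (List.Perm.cons _ ?_)
          rw [← List.append_assoc]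
          exact (List.perm_append_comm.trans hp).append_right _
        · simp only [rootItems_append, List.mem_append]
          exact Or.inr hz
        · simp only [marks]
          split_ifs at hm <;> omega
      · rename_i hc
        have hxs : x ∈ s.items := by
          simp only [items, List.mem_cons, List.mem_append] at hx
          exact (hx.resolve_left fun h => hy h.symm).resolve_left (detach_eq_none hc)
        obtain ⟨⟨hp, hr, hs, hg, ho⟩, hl, hm⟩ := ihs hxs
        refine ⟨⟨?_, ?_, fun z hz => ?_, fun h => ?_, fun key h => ?_⟩, by simp [length, hl], ?_⟩
        · simp only [items_append, items] at hp ⊢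
          refine List.perm_middle.trans (List.Perm.cons _ ?_)
          rw [← List.append_assoc]
          refine (List.Perm.append_right _ List.perm_append_comm).trans ?_
          rw [List.append_assoc]
          exact hp.append_left _
        · simp only [rootItems_append, List.mem_append, rootItems, List.mem_cons] at hr ⊢
          tauto
        · have := hs z
          simp only [rootItems_append, List.mem_append, rootItems, List.mem_cons] at this hz ⊢
          tauto
        · have h2 := hg h.2
          clear hg ihs hs
          generalize (detachRoots x s).2 = t at *
          revert h2
          clear hp hr ho hl hm
          induction t with
          | nil => exact fun h2 => ⟨h.1, h2⟩
          | cons z mz cz sz _ ih => exact fun h2 => ⟨h2.1, ih h2.2⟩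
        · have h2 := ho key h.2.2
          generalize (detachRoots x s).2 = t at *
          revert h2
          clear hp hr ho hl hm hg ihs hs
          induction t with
          | nil => exact fun h2 => ⟨h.1, h.2.1, h2⟩
          | cons z mz cz sz _ ih => exact fun h2 => ⟨h2.1, h2.2.1, ih h2.2.2⟩
        · simp only [marks]
          omega

/-- The coefficient 4 of the detached trees splits into one step and three units of potential for
each; the constant is the 10 units of a stopped cascade plus the initial step. -/
theorem cut_spec {f : FibForest α} (hx : x ∈ f.items) :
    CutSpec x f (f.cut x).ret ∧
      (f.cut x).time + 3 * (f.cut x).ret.length + 6 * (f.cut x).ret.marks ≤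
        3 * f.length + 6 * f.marks + 11 := by
  obtain ⟨h1, h2, h3⟩ := detachRoots_spec hx
  refine ⟨h1, ?_⟩
  simp only [cut, length_append, marks_append, h2]
  omega

/-- Removing a root. -/
theorem removeRoot_spec {f : FibForest α} (hx : x ∈ f.rootItems) :
    ((removeRoot x f).1.append (removeRoot x f).2).items.Perm (f.items.erase x) ∧
      (removeRoot x f).2.length + 1 = f.length ∧
      (removeRoot x f).1.marks + (removeRoot x f).2.marks ≤ f.marks ∧
      (f.RootsGraded → (removeRoot x f).1.Graded ∧ (removeRoot x f).2.RootsGraded) ∧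
      (removeRoot x f).1.items.length + 1 ≤ f.items.length ∧
      (∀ key, f.HeapOrdered key →
        ((removeRoot x f).1.append (removeRoot x f).2).HeapOrdered key) := by
  induction f with
  | nil => simp [rootItems] at hx
  | cons y m c s _ ihs =>
    rw [removeRoot]
    split_ifs with hy
    · subst hy
      refine ⟨by simp [items], rfl, by simp only [marks]; omega,
        fun h => ⟨h.1, h.2⟩, by simp only [items, List.length_cons, List.length_append]; omega,
        fun key h => h.2.1.append h.2.2⟩
    · have hxs : x ∈ s.rootItems := by
        simp only [rootItems, List.mem_cons] at hx
        exact hx.resolve_left fun h => hy h.symm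
      obtain ⟨hp, hl, hm, hg, hi, ho⟩ := ihs hxs
      refine ⟨?_, by simp [length, hl], by simp only [marks]; omega,
        fun h => ⟨(hg h.2).1, h.1, (hg h.2).2⟩,
        by simp only [items, List.length_cons, List.length_append]; omega, fun key h => ?_⟩
      · simp only [items_append, items] at hp ⊢
        have hxi := s.rootItems_subset x hxs
        have h1 : (x :: ((removeRoot x s).1.items ++ (removeRoot x s).2.items)).Perm s.items :=
          (List.Perm.cons _ hp).trans (List.perm_cons_erase hxi).symm
        refine (List.Perm.trans ?_ (List.Perm.erase x
          (List.Perm.cons y (List.Perm.append_left c.items h1))))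
        refine List.perm_middle.trans ?_
        have h2 : (y :: (c.items ++ x :: ((removeRoot x s).1.items ++ (removeRoot x s).2.items))).Perm
            (x :: y :: (c.items ++ ((removeRoot x s).1.items ++ (removeRoot x s).2.items))) :=
          (List.Perm.cons _ List.perm_middle).trans (List.Perm.swap _ _ _)
        refine List.Perm.trans ?_ (h2.erase x).symm
        simp only [List.erase_cons_head]
        refine List.Perm.cons _ ?_
        rw [← List.append_assoc, ← List.append_assoc]
        exact List.perm_append_comm.append_right _
      · have h2 := ho key h.2.2
        generalize (removeRoot x s).1 = t at *
        revert h2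
        clear hp hl hm hg hi ho ihs
        induction t with
        | nil => exact fun h2 => ⟨h.1, h.2.1, h2⟩
        | cons z mz cz sz _ ih => exact fun h2 => ⟨h2.1, h2.2.1, ih h2.2.2⟩

end cut

end FibForest

/-! ### Consolidation -/

namespace FibForest

variable {α : Type} {key : α → ℝ}

/-- Cell `j` of the array holds a tree of degree `d + j`, and the last cell is occupied. -/
def SlotsOK (key : α → ℝ) : ℕ → List (Option (α × FibForest α)) → Prop
  | _, [] => True
  | d, none :: r => r ≠ [] ∧ SlotsOK key (d + 1) r
  | d, some (x, c) :: r =>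
    (c.length = d ∧ c.Graded ∧ (∀ y ∈ c.items, key x ≤ key y) ∧ c.HeapOrdered key) ∧
      SlotsOK key (d + 1) r

theorem SlotsOK.rootsGraded {d : ℕ} {l : List (Option (α × FibForest α))}
    (h : SlotsOK key d l) : (ofSlots l).RootsGraded := by
  induction l generalizing d with
  | nil => trivial
  | cons o r ih =>
    match o with
    | none => exact ih h.2
    | some (x, c) => exact ⟨h.1.2.1, ih h.2⟩

theorem SlotsOK.heapOrdered {d : ℕ} {l : List (Option (α × FibForest α))}
    (h : SlotsOK key d l) : (ofSlots l).HeapOrdered key := by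
  induction l generalizing d with
  | nil => trivial
  | cons o r ih =>
    match o with
    | none => exact ih h.2
    | some (x, c) => exact ⟨h.1.2.2.1, h.1.2.2.2, ih h.2⟩

/-- The last cell is occupied, so the length of the array is dictated by the degree of an actual
tree, whose size alone gives the bound. -/
theorem SlotsOK.fib_le {d : ℕ} {l : List (Option (α × FibForest α))}
    (h : SlotsOK key d l) (hl : l ≠ []) :
    Nat.fib (d + l.length + 1) ≤ (ofSlots l).items.length := by
  induction l generalizing d with
  | nil => exact absurd rfl hl
  | cons o r ih =>
    have e : d + (r.length + 1) + 1 = d + 1 + r.length + 1 := by omega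
    match o with
    | none =>
      have := ih h.2 h.1
      rw [List.length_cons, e]
      exact this
    | some (x, c) =>
      rw [List.length_cons, e]
      rcases eq_or_ne r [] with rfl | hr
      · have h1 := h.1.2.1.fib_le
        rw [h.1.1] at h1
        simpa [ofSlots, items] using h1
      · have := ih h.2 hr
        simp only [ofSlots, items, List.length_cons, List.length_append]
        omega

theorem length_ofSlots_le (l : List (Option (α × FibForest α))) :
    (ofSlots l).length ≤ l.length := by
  induction l with
  | nil => simp [ofSlots, length]
  | cons o r ih =>
    match o with
    | none => simp only [ofSlots, List.length_cons]; omega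
    | some (x, c) => simp only [ofSlots, List.length_cons, length]; omega

theorem SlotsOK.slots_length_le {l : List (Option (α × FibForest α))}
    (h : SlotsOK key 0 l) {m : ℕ} (hm : (ofSlots l).items.length ≤ m) :
    l.length ≤ 2 * Nat.log 2 m + 2 := by
  rcases eq_or_ne l [] with rfl | hl
  · simp
  · have h1 := h.fib_le hl
    have h2 : l.length - 1 + 2 = 0 + l.length + 1 := by
      have := List.length_pos_iff.2 hl
      omega
    rw [← h2] at h1
    have := le_log_of_fib_le (h1.trans hm)
    omega

/-- A tree that may be put into cell `d`. -/
def TreeOK (key : α → ℝ) (d : ℕ) (t : α × FibForest α) : Prop :=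
  t.2.length = d ∧ t.2.Graded ∧ (∀ y ∈ t.2.items, key t.1 ≤ key y) ∧ t.2.HeapOrdered key

/-- Equality of the degrees matters: the new child has `d` children and is placed in front of `d`
older siblings, which is exactly what the degree invariant asks of an unmarked node. -/
theorem link_spec {d : ℕ} {t u : α × FibForest α} (ht : TreeOK key d t) (hu : TreeOK key d u) :
    TreeOK key (d + 1) (link key t u) ∧
      ((link key t u).1 :: (link key t u).2.items).Perm
        ((t.1 :: t.2.items) ++ (u.1 :: u.2.items)) ∧
      (link key t u).2.marks = t.2.marks + u.2.marks := by
  obtain ⟨t1, t2, t3, t4⟩ := ht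
  obtain ⟨u1, u2, u3, u4⟩ := hu
  unfold link
  split_ifs with h
  · refine ⟨⟨by simp [length, u1], ⟨by omega, t2, u2⟩, ?_, ⟨t3, t4, u4⟩⟩, ?_, by simp [marks]⟩
    · intro y hy
      simp only [items, List.mem_cons, List.mem_append] at hy
      rcases hy with rfl | hy | hy
      · exact h.le
      · exact h.le.trans (t3 y hy)
      · exact u3 y hy
    · simp only [items]
      refine List.Perm.trans ?_ List.perm_middle.symm
      exact List.Perm.cons _ (by simp)
  · push Not at h
    refine ⟨⟨by simp [length, t1], ⟨by omega, u2, t2⟩, ?_, ⟨u3, u4, t4⟩⟩, ?_,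
      by simp [marks]; omega⟩
    · intro y hy
      simp only [items, List.mem_cons, List.mem_append] at hy
      rcases hy with rfl | hy | hy
      · exact h
      · exact h.trans (u3 y hy)
      · exact t3 y hy
    · simp only [items, List.cons_append]
      refine List.Perm.cons _ ?_
      refine List.Perm.trans ?_ List.perm_middle.symm
      exact List.Perm.cons _ List.perm_append_comm

/-- Each link takes one step and removes one tree, so time plus number of trees is conserved up to
the inserted tree and the final placement. The first cell of `l` holds degree `b`, which varies as
the recursion walks along the array. -/
theorem place_spec (d b : ℕ) (t : α × FibForest α) (l : List (Option (α × FibForest α)))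
    (ht : TreeOK key (b + d) t) (hl : SlotsOK key b l) :
    (place key d t l).ret ≠ [] ∧ SlotsOK key b (place key d t l).ret ∧
      (ofSlots (place key d t l).ret).items.Perm ((t.1 :: t.2.items) ++ (ofSlots l).items) ∧
      (ofSlots (place key d t l).ret).marks = t.2.marks + (ofSlots l).marks ∧
      (place key d t l).time + (ofSlots (place key d t l).ret).length = (ofSlots l).length + 2 := by
  induction l generalizing d b t with
  | nil =>
    induction d generalizing b with
    | zero =>
      obtain ⟨x, c⟩ := t
      simp only [place]
      exact ⟨by simp, ⟨by simpa [TreeOK] using ht, trivial⟩, by simp [ofSlots, items],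
        by simp [ofSlots, marks], by simp [ofSlots, length]⟩
    | succ d ih =>
      obtain ⟨h1, h2, h3, h4, h5⟩ := ih (b + 1) (by rwa [add_assoc, add_comm 1 d]) trivial
      simp only [place]
      exact ⟨by simp, ⟨h1, h2⟩, by simpa [ofSlots] using h3, by simpa [ofSlots] using h4,
        by simpa [ofSlots] using h5⟩
  | cons o r ih =>
    cases d with
    | zero =>
      match o with
      | none =>
        obtain ⟨x, c⟩ := t
        simp only [place]
        exact ⟨by simp, ⟨by simpa [TreeOK] using ht, hl.2⟩, by simp [ofSlots, items],
          by simp [ofSlots, marks], by simp [ofSlots, length]; omega⟩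
      | some u =>
        obtain ⟨k1, k2, k3⟩ := link_spec (t := t) (u := u) (by simpa using ht) hl.1
        obtain ⟨h1, h2, h3, h4, h5⟩ := ih 0 (b + 1) (link key t u) (by simpa using k1) hl.2
        simp only [place]
        refine ⟨by simp, ⟨h1, h2⟩, ?_, ?_, ?_⟩
        · simp only [ofSlots, items]
          refine h3.trans ?_
          simpa using k2.append_right (ofSlots r).items
        · simp only [ofSlots, marks] at *
          simp
          omega
        · simp only [ofSlots, length] at *
          omega
    | succ d =>
      have ht' : TreeOK key (b + 1 + d) t := by rwa [add_assoc, add_comm 1 d]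
      match o with
      | none =>
        obtain ⟨h1, h2, h3, h4, h5⟩ := ih d (b + 1) t ht' hl.2
        simp only [place]
        exact ⟨by simp, ⟨h1, h2⟩, h3, h4, h5⟩
      | some (y, c) =>
        obtain ⟨h1, h2, h3, h4, h5⟩ := ih d (b + 1) t ht' hl.2
        simp only [place]
        refine ⟨by simp, ⟨hl.1, h2⟩, ?_, ?_, ?_⟩
        · simp only [ofSlots, items]
          refine (List.Perm.cons _ (List.Perm.append_left _ h3)).trans ?_
          simp only [List.cons_append]
          refine List.Perm.trans (List.Perm.cons _ List.perm_middle) ?_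
          refine (List.Perm.swap _ _ _).trans (List.Perm.cons _ ?_)
          refine List.Perm.trans ?_ List.perm_middle.symm
          refine List.Perm.cons _ ?_
          rw [← List.append_assoc, ← List.append_assoc]
          exact List.perm_append_comm.append_right _
        · simp only [ofSlots, marks] at *
          omega
        · simp only [ofSlots, length] at *
          omega

/-- Every old root accounts for three units: one for visiting it and two from `place_spec`. This is
why the potential weighs a root by 3. -/
theorem consolidate_spec {f : FibForest α} (hg : f.RootsGraded) (ho : f.HeapOrdered key) :
    SlotsOK key 0 (f.consolidate key).ret ∧
      (ofSlots (f.consolidate key).ret).items.Perm f.items ∧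
      (ofSlots (f.consolidate key).ret).marks ≤ f.marks ∧
      (f.consolidate key).time + (ofSlots (f.consolidate key).ret).length = 3 * f.length := by
  induction f with
  | nil => exact ⟨trivial, by rfl, by rfl, by rfl⟩
  | cons x m c s _ ih =>
    obtain ⟨h1, h2, h3, h4⟩ := ih hg.2 ho.2.2
    obtain ⟨k0, k1, k2, k3, k4⟩ := place_spec c.length 0 (x, c) (s.consolidate key).ret
      ⟨by simp, hg.1, ho.1, ho.2.1⟩ h1
    have hr : ((cons x m c s).consolidate key).ret =
      (place key c.length (x, c) (s.consolidate key).ret).ret := rfl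
    have ht : ((cons x m c s).consolidate key).time = 1 + ((s.consolidate key).time +
      (place key c.length (x, c) (s.consolidate key).ret).time) := rfl
    rw [hr, ht]
    refine ⟨k1, ?_, ?_, ?_⟩
    · refine k2.trans ?_
      simp only [items, List.cons_append]
      exact List.Perm.cons _ (h2.append_left _)
    · simp only [marks] at *
      omega
    · simp only [length] at *
      omega

theorem minRoot_spec (key : α → ℝ) (f : FibForest α) :
    match f.minRoot key with
    | none => f = nil
    | some x => x ∈ f.rootItems ∧ ∀ y ∈ f.rootItems, key x ≤ key y := by
  induction f with
  | nil => simp [minRoot]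
  | cons x m c s _ ih =>
    simp only [minRoot]
    cases h : s.minRoot key with
    | none =>
      rw [h] at ih
      simp only at ih
      subst ih
      simp [rootItems]
    | some y =>
      rw [h] at ih
      simp only at ih ⊢
      by_cases hxy : key y < key x
      · simp only [hxy, if_true, rootItems, List.mem_cons, forall_eq_or_imp]
        exact ⟨Or.inr ih.1, hxy.le, ih.2⟩
      · simp only [hxy, if_false, rootItems, List.mem_cons, forall_eq_or_imp]
        push Not at hxy
        exact ⟨Or.inl trivial, le_rfl, fun z hz => hxy.trans (ih.2 z hz)⟩

end FibForest

/-! ### Amortized analysis of Fibonacci heaps -/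

namespace FibHeap

open FibForest

variable {α : Type}

/-- The items of a heap. -/
def items (h : FibHeap α) : List α := h.roots.items

/-- The amortized potential. -/
def potential (h : FibHeap α) : ℕ := 3 * h.roots.length + 6 * h.roots.marks

/-- The invariant that does not concern the pointer to the minimum. -/
structure Ordered (h : FibHeap α) : Prop where
  nodup : h.items.Nodup
  graded : h.roots.RootsGraded
  ordered : h.roots.HeapOrdered h.key

/-- The invariant of Fibonacci heaps. -/
structure Valid (h : FibHeap α) : Prop extends Ordered h where
  min_none : h.min = none → h.items = []
  min_some : ∀ x, h.min = some x → x ∈ h.roots.rootItems ∧ ∀ y ∈ h.items, h.key x ≤ h.key y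

/-- A bound for the amortized time of all heap operations on heaps with at most `m` items. -/
def opCost (m : ℕ) : ℕ := 20 * Nat.log 2 m + 40

theorem valid_empty : (empty : FibHeap α).Valid :=
  { nodup := List.nodup_nil, graded := trivial, ordered := trivial
    min_none := fun _ => rfl, min_some := fun _ h => by cases h }

@[simp] theorem items_empty : (empty : FibHeap α).items = [] := rfl

@[simp] theorem potential_empty : (empty : FibHeap α).potential = 0 := rfl

variable [DecidableEq α]

theorem insert_spec {h : FibHeap α} (hv : h.Valid) {x : α} (hx : x ∉ h.items) (k : ℝ) :
    (h.insert x k).ret.Valid ∧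
      (∀ y, y ∈ (h.insert x k).ret.items ↔ y = x ∨ y ∈ h.items) ∧
      (h.insert x k).ret.key = Function.update h.key x k ∧
      (h.insert x k).time + (h.insert x k).ret.potential ≤ h.potential + 4 := by
  have hr : (h.insert x k).ret = ⟨FibForest.cons x false FibForest.nil h.roots,
      (match h.min with
        | none => some x
        | some y => if k < h.key y then some x else some y), Function.update h.key x k⟩ := rfl
  have ht : (h.insert x k).time = 1 := rfl
  have hne : ∀ y ∈ h.items, y ≠ x := fun y hy => ne_of_mem_of_not_mem hy hx
  rw [hr, ht]
  refine ⟨⟨⟨?_, ⟨trivial, hv.graded⟩, ?_, trivial, ?_⟩, ?_, ?_⟩, ?_, rfl, ?_⟩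
  · simpa [items, FibForest.items] using ⟨hx, hv.nodup⟩
  · simp [FibForest.items]
  · exact hv.ordered.congr fun z hz => Function.update_of_ne (hne z hz) _ _
  · cases h.min with
    | none => simp
    | some y => simp only; split_ifs <;> simp
  · intro z hz
    simp only [items, FibForest.items, rootItems, List.nil_append, List.mem_cons,
      forall_eq_or_imp, Function.update_self]
    have hup : ∀ y ∈ h.roots.items, Function.update h.key x k y = h.key y := fun y hy =>
      Function.update_of_ne (hne y hy) _ _
    cases hm : h.min with
    | none =>
      rw [hm] at hz
      cases hz
      have hnil : h.roots.items = [] := hv.min_none hm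
      simp [hnil]
    | some y =>
      rw [hm] at hz
      obtain ⟨h1, h2⟩ := hv.min_some y hm
      simp only at hz
      split_ifs at hz with hk
      · cases hz
        refine ⟨Or.inl rfl, by simp, fun w hw => ?_⟩
        rw [hup w hw, Function.update_self]
        exact hk.le.trans (h2 w hw)
      · obtain rfl := Option.some.inj hz
        push Not at hk
        rw [hup y (rootItems_subset _ _ h1)]
        refine ⟨Or.inr h1, hk, fun w hw => ?_⟩
        rw [hup w hw]
        exact h2 w hw
  · intro y
    simp [items, FibForest.items]
  · simp only [potential, FibForest.length, marks]
    simp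
    omega

theorem decreaseKey_spec {h : FibHeap α} (hv : h.Valid) {x : α} (hx : x ∈ h.items) {k : ℝ}
    (hk : k ≤ h.key x) :
    (h.decreaseKey x k).ret.Valid ∧
      (∀ y, y ∈ (h.decreaseKey x k).ret.items ↔ y ∈ h.items) ∧
      (h.decreaseKey x k).ret.key = Function.update h.key x k ∧
      (h.decreaseKey x k).time + (h.decreaseKey x k).ret.potential ≤ h.potential + 12 := by
  have hr : (h.decreaseKey x k).ret = ⟨(h.roots.cut x).ret,
      (match h.min with
        | none => some x
        | some y => if k < h.key y then some x else some y), Function.update h.key x k⟩ := rfl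
  have ht : (h.decreaseKey x k).time = 1 + ((h.roots.cut x).time + 0) := rfl
  obtain ⟨⟨hp, hroot, hrs, hg, ho⟩, htime⟩ := cut_spec (f := h.roots) hx
  have hn : (h.roots.cut x).ret.items.Nodup := hp.nodup_iff.2 hv.nodup
  have hord := (ho _ hv.ordered).update_root hn hroot hk
  have hmem : ∀ y, y ∈ (h.roots.cut x).ret.items ↔ y ∈ h.roots.items := fun y => hp.mem_iff
  rw [hr, ht]
  have hle : ∀ y, Function.update h.key x k y ≤ h.key y := by
    intro y
    by_cases hy : y = x
    · subst hy; simpa using hk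
    · rw [Function.update_of_ne hy]
  refine ⟨⟨⟨hn, hg hv.graded, hord⟩, ?_, ?_⟩, hmem, rfl, ?_⟩
  · cases h.min with
    | none => simp
    | some y => simp only; split_ifs <;> simp
  · intro z hz
    simp only [items] at hz ⊢
    cases hm : h.min with
    | none =>
      have hnil := hv.min_none hm
      rw [hnil] at hx
      simp at hx
    | some y =>
      rw [hm] at hz
      obtain ⟨h1, h2⟩ := hv.min_some y hm
      simp only at hz
      split_ifs at hz with hk'
      · cases hz
        refine ⟨hroot, fun w hw => ?_⟩
        rw [Function.update_self]
        by_cases hw' : w = x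
        · rw [hw', Function.update_self]
        · rw [Function.update_of_ne hw']
          exact hk'.le.trans (h2 w ((hmem w).1 hw))
      · obtain rfl := Option.some.inj hz
        push Not at hk'
        refine ⟨hrs _ h1, fun w hw => (hle y).trans ?_⟩
        by_cases hw' : w = x
        · rwa [hw', Function.update_self]
        · rw [Function.update_of_ne hw']
          exact h2 w ((hmem w).1 hw)
  · simp only [potential]
    omega

/-- The potential of the old roots pays for consolidating them. What remains is governed by the
number of children of `x` and the length of the new array, both logarithmic. The pointer to the
minimum is recomputed, so its correctness beforehand is not required; this lets `delete` call it
after a bare cut. -/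
theorem deleteRoot_spec {h : FibHeap α} (hv : h.Ordered) {x : α} (hx : x ∈ h.roots.rootItems)
    {m : ℕ} (hm : h.items.length ≤ m) :
    (h.deleteRoot x).ret.Valid ∧
      (∀ y, y ∈ (h.deleteRoot x).ret.items ↔ y ∈ h.items ∧ y ≠ x) ∧
      (h.deleteRoot x).ret.key = h.key ∧
      (h.deleteRoot x).time + (h.deleteRoot x).ret.potential ≤ h.potential +
        (20 * Nat.log 2 m + 20) := by
  obtain ⟨hp, hl, hmk, hg, hi, ho⟩ := removeRoot_spec hx
  obtain ⟨g1, g2⟩ := hg hv.graded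
  obtain ⟨c1, c2, c3, c4⟩ := consolidate_spec (g1.rootsGraded.append g2) (ho _ hv.ordered)
  set cs := h.roots.removeRoot x with hcs
  set sl := (cs.1.append cs.2).consolidate h.key with hsl
  have hr : (h.deleteRoot x).ret =
    ⟨ofSlots sl.ret, (ofSlots sl.ret).minRoot h.key, h.key⟩ := rfl
  have ht : (h.deleteRoot x).time = (1 + cs.1.length) + (sl.time + ((1 + sl.ret.length) + 0)) := rfl
  have hperm : (ofSlots sl.ret).items.Perm (h.roots.items.erase x) := c2.trans hp
  have hn : (ofSlots sl.ret).items.Nodup := hperm.nodup_iff.2 (hv.nodup.erase x)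
  rw [hr, ht]
  refine ⟨⟨⟨hn, c1.rootsGraded, c1.heapOrdered⟩, ?_, ?_⟩, ?_, rfl, ?_⟩
  · intro hmin
    have := minRoot_spec h.key (ofSlots sl.ret)
    simp only at hmin
    rw [hmin] at this
    simp only at this
    simp [items, this, FibForest.items]
  · intro z hz
    have := minRoot_spec h.key (ofSlots sl.ret)
    simp only at hz
    rw [hz] at this
    refine ⟨this.1, fun y hy => ?_⟩
    obtain ⟨w, hw, hwy⟩ := c1.heapOrdered.exists_root_le y hy
    exact (this.2 w hw).trans hwy
  · intro y
    simp only [items]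
    rw [hperm.mem_iff, List.Nodup.mem_erase_iff (l := h.roots.items) hv.nodup, and_comm]
  · have h1 : sl.ret.length ≤ 2 * Nat.log 2 m + 2 := c1.slots_length_le (by
      rw [hperm.length_eq]
      exact (List.length_erase_le).trans hm)
    have h2 : cs.1.length ≤ 2 * Nat.log 2 m + 1 :=
      le_log_of_fib_le (g1.fib_le.trans (hi.trans hm))
    have h3 := length_ofSlots_le sl.ret
    simp only [potential, length_append, marks_append] at *
    omega

theorem delete_spec {h : FibHeap α} (hv : h.Ordered) {x : α} (hx : x ∈ h.items)
    {m : ℕ} (hm : h.items.length ≤ m) :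
    (h.delete x).ret.Valid ∧
      (∀ y, y ∈ (h.delete x).ret.items ↔ y ∈ h.items ∧ y ≠ x) ∧
      (h.delete x).ret.key = h.key ∧
      (h.delete x).time + (h.delete x).ret.potential ≤ h.potential + opCost m := by
  obtain ⟨⟨hp, hroot, hrs, hg, ho⟩, htime⟩ := cut_spec (f := h.roots) hx
  obtain ⟨h1, h2, h3, h4⟩ := deleteRoot_spec (h := { h with roots := (h.roots.cut x).ret })
    ⟨hp.nodup_iff.2 hv.nodup, hg hv.graded, ho _ hv.ordered⟩ hroot (m := m)
    (by simpa [items, hp.length_eq] using hm)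
  refine ⟨h1, fun y => (h2 y).trans ?_, h3, ?_⟩
  · simp only [items, hp.mem_iff]
  · have ht : (h.delete x).time = (h.roots.cut x).time +
      (deleteRoot x { h with roots := (h.roots.cut x).ret }).time := rfl
    have hr : (h.delete x).ret = (deleteRoot x { h with roots := (h.roots.cut x).ret }).ret := rfl
    rw [ht, hr]
    simp only [potential, opCost] at *
    omega

theorem extractMin_spec {h : FibHeap α} (hv : h.Valid) {m : ℕ} (hm : h.items.length ≤ m) :
    (h.extractMin.ret = none ∧ h.extractMin.time = 1 ∧ h.items = []) ∨
      ∃ x h', h.extractMin.ret = some (x, h') ∧ h'.Valid ∧ x ∈ h.items ∧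
        (∀ y ∈ h.items, h.key x ≤ h.key y) ∧
        (∀ y, y ∈ h'.items ↔ y ∈ h.items ∧ y ≠ x) ∧ h'.key = h.key ∧
        h.extractMin.time + h'.potential ≤ h.potential + opCost m := by
  cases hmin : h.min with
  | none =>
    left
    have : h.extractMin = ⟨none, 1 + 0⟩ := by
      unfold extractMin
      rw [hmin]
      rfl
    exact ⟨by rw [this], by rw [this], hv.min_none hmin⟩
  | some x =>
    right
    obtain ⟨hx, hle⟩ := hv.min_some x hmin
    obtain ⟨h1, h2, h3, h4⟩ := deleteRoot_spec hv.toOrdered hx hm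
    have : h.extractMin = ⟨some (x, (h.deleteRoot x).ret), 1 + ((h.deleteRoot x).time + 0)⟩ := by
      unfold extractMin
      rw [hmin]
      rfl
    refine ⟨x, _, by rw [this], h1, rootItems_subset _ _ hx, hle, h2, h3, ?_⟩
    rw [this]
    simp only [opCost]
    omega

end FibHeap

/-! ### Induction over timed loops -/

namespace Timed

/-- The relation sees the unprocessed part of the list and the time spent so far, so that an
invariant can reserve time for the remaining elements. -/
theorem foldlM_induct {σ α : Type} (f : σ → α → Timed σ) (R : List α → σ → ℕ → Prop)
    (step : ∀ a l s t, R (a :: l) s t → R l (f s a).ret (t + (f s a).time)) :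
    ∀ l s t, R l s t → R [] (l.foldlM f s).ret (t + (l.foldlM f s).time) := by
  intro l
  induction l with
  | nil => exact fun s t h => h
  | cons a l ih =>
    intro s t h
    have := ih _ _ (step a l s t h)
    rw [add_assoc] at this
    exact this

end Timed

/-! ### Paths and costs -/

namespace MOG

variable {n W : ℕ} (G : MOG n W)

theorem mem_neighbors {v u : Fin n} : u ∈ G.neighbors v ↔ (v, u) ∈ G.edges := by
  simp [neighbors]

theorem nodup_neighbors (v : Fin n) : (G.neighbors v).Nodup :=
  (List.nodup_finRange n).filter _

theorem length_neighbors (v : Fin n) : (G.neighbors v).length = G.outDegree v := by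
  rw [outDegree, ← List.toFinset_card_of_nodup (G.nodup_neighbors v)]
  refine Finset.card_bij (fun u _ => (v, u)) ?_ ?_ ?_
  · intro u hu
    simp only [List.mem_toFinset, mem_neighbors] at hu
    simp [hu]
  · intro a _ b _ h
    exact (Prod.ext_iff.1 h).2
  · rintro ⟨a, b⟩ h
    simp only [Finset.mem_filter] at h
    obtain ⟨h, rfl⟩ := h
    exact ⟨b, by simpa [mem_neighbors] using h, rfl⟩

theorem cons_mem_paths {s u v : Fin n} {p : NodePath n} (hp : p ∈ G.paths s u)
    (h : (u, v) ∈ G.edges) : v :: p ∈ G.paths s v := by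
  match p, hp with
  | w :: p, hp =>
    obtain rfl : w = u := by simpa using hp.2
    exact ⟨⟨h, hp.1⟩, rfl⟩

theorem singleton_mem_paths (s : Fin n) : [s] ∈ G.paths s s := ⟨rfl, rfl⟩

theorem vec_cons {p : NodePath n} {u : Fin n} (hp : p.head? = some u) (v : Fin n) :
    G.vec (v :: p) = G.vec p + G.weight (u, v) := by
  match p, hp with
  | w :: p, hp =>
    obtain rfl : w = u := by simpa using hp
    rfl

theorem vec_nonneg {s : Fin n} : ∀ {p : NodePath n}, G.IsPathFrom s p → ∀ j, 0 ≤ G.vec p j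
  | [], h, _ => h.elim
  | [_], _, _ => le_rfl
  | _ :: _ :: _, h, j => add_nonneg (vec_nonneg h.2 j) (G.weight_nonneg _ h.1 j)

end MOG

namespace MOWSP

variable {n W K : ℕ} (I : MOWSP n W K)

/-- The cost of an edge with respect to the `i`th coefficient vector. -/
noncomputable def edgeCost (i : Fin K) (e : Fin n × Fin n) : ℝ := ∑ j, I.coeff i j * I.weight e j

theorem edgeCost_nonneg (i : Fin K) {e : Fin n × Fin n} (he : e ∈ I.edges) : 0 ≤ I.edgeCost i e :=
  Finset.sum_nonneg fun j _ => mul_nonneg (I.coeff_pos i j).le (I.weight_nonneg e he j)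

theorem cost_cons (i : Fin K) {p : NodePath n} {u : Fin n} (hp : p.head? = some u) (v : Fin n) :
    I.cost i (v :: p) = I.cost i p + I.edgeCost i (u, v) := by
  unfold cost edgeCost
  rw [I.vec_cons hp, ← Finset.sum_add_distrib]
  exact Finset.sum_congr rfl fun j _ => by rw [Pi.add_apply]; ring

theorem cost_le_cons (i : Fin K) {p : NodePath n} {u v : Fin n} (hp : p.head? = some u)
    (he : (u, v) ∈ I.edges) : I.cost i p ≤ I.cost i (v :: p) := by
  rw [I.cost_cons i hp]
  linarith [I.edgeCost_nonneg i he]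

theorem cost_singleton (i : Fin K) (v : Fin n) : I.cost i [v] = 0 := by
  simp [cost, MOG.vec]

theorem cost_lt_of_dominates (i : Fin K) {p q : NodePath n}
    (h : Dominates (I.vec p) (I.vec q)) : I.cost i p < I.cost i q := by
  obtain ⟨h1, j, hj⟩ := h
  exact Finset.sum_lt_sum (fun j _ => mul_le_mul_of_nonneg_left (h1 j) (I.coeff_pos i j).le)
    ⟨j, Finset.mem_univ j, mul_lt_mul_of_pos_left hj (I.coeff_pos i j)⟩

/-! ### The first cheapest path in a list -/

theorem firstMin_append (i : Fin K) (l : List (NodePath n)) (p : NodePath n) :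
    I.firstMin i (l ++ [p]) = match I.firstMin i l with
      | none => some p
      | some b => if I.cost i p < I.cost i b then some p else some b := by
  unfold firstMin
  rw [List.foldl_append]
  rfl

theorem firstMin_spec (i : Fin K) (l : List (NodePath n)) :
    match I.firstMin i l with
    | none => l = []
    | some e => e ∈ l ∧ ∀ q ∈ l, I.cost i e ≤ I.cost i q := by
  induction l using List.reverseRecOn with
  | nil => simp [firstMin]
  | append_singleton l p ih =>
    rw [firstMin_append]
    cases h : I.firstMin i l with
    | none =>
      rw [h] at ih
      simp only at ih
      simp [ih]
    | some b =>
      rw [h] at ih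
      simp only at ih ⊢
      by_cases hlt : I.cost i p < I.cost i b
      · simp only [hlt, if_true]
        refine ⟨by simp, fun q hq => ?_⟩
        rcases List.mem_append.1 hq with hq | hq
        · exact hlt.le.trans (ih.2 q hq)
        · rw [List.mem_singleton.1 hq]
      · simp only [hlt, if_false]
        refine ⟨by simp [ih.1], fun q hq => ?_⟩
        rcases List.mem_append.1 hq with hq | hq
        · exact ih.2 q hq
        · rw [List.mem_singleton.1 hq]
          exact not_lt.1 hlt

variable {I}

theorem eq_nil_of_firstMin {i : Fin K} {l : List (NodePath n)} (h : I.firstMin i l = none) :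
    l = [] := by
  have := I.firstMin_spec i l
  rwa [h] at this

theorem mem_of_firstMin {i : Fin K} {l : List (NodePath n)} {e : NodePath n}
    (h : I.firstMin i l = some e) : e ∈ l := by
  have := I.firstMin_spec i l
  rw [h] at this
  exact this.1

theorem cost_le_of_firstMin {i : Fin K} {l : List (NodePath n)} {e : NodePath n}
    (h : I.firstMin i l = some e) : ∀ q ∈ l, I.cost i e ≤ I.cost i q := by
  have := I.firstMin_spec i l
  rw [h] at this
  exact this.2

variable {β : Type} {g : β → NodePath n} {keep : β → Bool}

theorem firstMin_append_of_lt {i : Fin K} {l : List (NodePath n)} {p : NodePath n}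
    (h : ∀ q ∈ l, I.cost i p < I.cost i q) : I.firstMin i (l ++ [p]) = some p := by
  rw [firstMin_append]
  cases hl : I.firstMin i l with
  | none => rfl
  | some b => simp only [h b (mem_of_firstMin hl), if_true]

/-- Deleting entries other than the first minimum neither creates a cheaper entry nor an earlier
tie. -/
theorem firstMin_filter {i : Fin K} {l : List β} {e : NodePath n}
    (h : I.firstMin i (l.map g) = some e) (hk : ∀ b ∈ l, g b = e → keep b = true) :
    I.firstMin i ((l.filter keep).map g) = some e := by
  induction l using List.reverseRecOn generalizing e with
  | nil => cases h
  | append_singleton l p ih =>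
    have hsub : ∀ q ∈ (l.filter keep).map g, q ∈ l.map g := by
      intro q hq
      simp only [List.mem_map, List.mem_filter] at hq ⊢
      obtain ⟨b, hb, hq⟩ := hq
      exact ⟨b, hb.1, hq⟩
    rw [List.map_append, List.map_singleton, firstMin_append] at h
    rw [List.filter_append, List.map_append]
    cases hl : I.firstMin i (l.map g) with
    | none =>
      rw [hl] at h
      cases h
      have := List.map_eq_nil_iff.1 (eq_nil_of_firstMin hl)
      subst this
      simp [hk p (by simp) rfl, firstMin]
    | some b =>
      rw [hl] at h
      simp only at h
      split_ifs at h with hlt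
      · cases h
        rw [List.filter_singleton, hk p (by simp) rfl]
        exact firstMin_append_of_lt fun q hq =>
          hlt.trans_le (cost_le_of_firstMin hl q (hsub q hq))
      · obtain rfl := Option.some.inj h
        have h1 := ih hl fun c hc => hk c (by simp [hc])
        rw [List.filter_singleton]
        cases keep p with
        | true =>
          rw [cond_true, List.map_singleton, firstMin_append, h1]
          simp only [hlt, if_false]
        | false => simpa using h1

/-- Pruning before a push is invisible to the first minimum: either the old minimum is kept, or it
is dropped and the new path beats it strictly anyway. This one fact serves the queue, the arrays of
best paths and the invariant on settled nodes. -/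
theorem firstMin_filter_append {i : Fin K} {l : List β} {p : NodePath n}
    (h : ∀ b ∈ l, I.firstMin i (l.map g) = some (g b) → keep b = false →
      I.cost i p < I.cost i (g b)) :
    I.firstMin i ((l.filter keep).map g ++ [p]) = match I.firstMin i (l.map g) with
      | none => some p
      | some b => if I.cost i p < I.cost i b then some p else some b := by
  cases hl : I.firstMin i (l.map g) with
  | none =>
    have := List.map_eq_nil_iff.1 (eq_nil_of_firstMin hl)
    subst this
    rfl
  | some e =>
    simp only
    by_cases hlt : I.cost i p < I.cost i e
    · rw [if_pos hlt]
      refine firstMin_append_of_lt fun q hq => hlt.trans_le (cost_le_of_firstMin hl q ?_)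
      simp only [List.mem_map, List.mem_filter] at hq ⊢
      obtain ⟨b, hb, hq⟩ := hq
      exact ⟨b, hb.1, hq⟩
    · rw [if_neg hlt, firstMin_append, firstMin_filter hl fun b hb hbe => ?_]
      · simp only [hlt, if_false]
      · by_contra hk
        subst hbe
        exact hlt (h b hb hl (by simpa using hk))

/-- Putting back entries that are strictly more expensive cannot displace the minimum. It is applied
with the popped paths as the entries put back. -/
theorem firstMin_of_filter {i : Fin K} {l : List β} {e : NodePath n}
    (h : I.firstMin i ((l.filter keep).map g) = some e)
    (hk : ∀ b ∈ l, keep b = false → I.cost i e < I.cost i (g b)) :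
    I.firstMin i (l.map g) = some e := by
  induction l using List.reverseRecOn generalizing e with
  | nil => cases h
  | append_singleton l q ih =>
    rw [List.map_append, List.map_singleton]
    rw [List.filter_append, List.map_append, List.filter_singleton] at h
    have hk' : ∀ b ∈ l, keep b = false → I.cost i e < I.cost i (g b) :=
      fun b hb => hk b (by simp [hb])
    cases hq : keep q with
    | false =>
      rw [hq] at h
      simp only [cond_false, List.map_nil, List.append_nil] at h
      rw [firstMin_append, ih h hk']
      simp only [not_lt.2 (hk q (by simp) hq).le, if_false]
    | true =>
      rw [hq, cond_true, List.map_singleton, firstMin_append] at h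
      cases hl : I.firstMin i ((l.filter keep).map g) with
      | none =>
        rw [hl] at h
        cases h
        refine firstMin_append_of_lt fun r hr => ?_
        obtain ⟨b, hb, rfl⟩ := List.mem_map.1 hr
        refine hk' b hb ?_
        have := List.map_eq_nil_iff.1 (eq_nil_of_firstMin hl)
        by_contra hc
        have h2 : b ∈ l.filter keep := List.mem_filter.2 ⟨hb, by simpa using hc⟩
        simp [this] at h2
      | some b =>
        rw [hl] at h
        simp only at h
        split_ifs at h with hqb
        · cases h
          refine firstMin_append_of_lt fun r hr => ?_
          obtain ⟨b', hb', rfl⟩ := List.mem_map.1 hr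
          by_cases hc : keep b' = true
          · exact hqb.trans_le (cost_le_of_firstMin hl _
              (List.mem_map_of_mem (List.mem_filter.2 ⟨hb', hc⟩)))
          · exact hk' b' hb' (by simpa using hc)
        · obtain rfl := Option.some.inj h
          rw [firstMin_append, ih hl hk']
          simp only [hqb, if_false]

end MOWSP

/-! ### The Pareto sample -/

namespace MOWSP

variable {n W K : ℕ} (I : MOWSP n W K)

/-- The invariant of the Dijkstra algorithm while the edges from `u` to the nodes in `rest` have not
been relaxed yet; `level` separates the costs of the settled nodes from those in the heap. -/
structure DijkstraInv (d : DijkstraState n) (level : ℝ) (u : Fin n) (rest : List (Fin n)) :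
    Prop where
  valid : d.heap.Valid
  mem : ∀ v, v ∈ d.heap.items ↔ (∃ p, d.path v = some p) ∧ d.settled v = false
  key : ∀ v ∈ d.heap.items, ∀ p, d.path v = some p → d.heap.key v = I.cost I.first p
  path : ∀ v p, d.path v = some p → p ∈ I.paths I.source v
  settled : ∀ v, d.settled v = true → ∃ p, d.path v = some p ∧ I.cost I.first p ≤ level
  level_le : ∀ v ∈ d.heap.items, ∀ p, d.path v = some p → level ≤ I.cost I.first p
  relaxed : ∀ a b, (a, b) ∈ I.edges → d.settled a = true → ¬ (a = u ∧ b ∈ rest) →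
    ∃ p q, d.path a = some p ∧ d.path b = some q ∧
      I.cost I.first q ≤ I.cost I.first p + I.edgeCost I.first (a, b)
  source : ∃ p, d.path I.source = some p ∧ I.cost I.first p ≤ 0

variable {I}

theorem DijkstraInv.length_le {d : DijkstraState n} {level : ℝ} {u : Fin n} {rest : List (Fin n)}
    (h : I.DijkstraInv d level u rest) : d.heap.items.length ≤ n := by
  simpa using h.valid.nodup.length_le_card

/-- The common part of the two successful relaxations: the description of the new heap items fits
both an inserted node and one whose key is lowered. -/
theorem DijkstraInv.update {d : DijkstraState n} {u v : Fin n} {rest : List (Fin n)}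
    {p : NodePath n} (h : I.DijkstraInv d (I.cost I.first p) u (v :: rest))
    (hp : d.path u = some p) (hu : d.settled u = true) (he : (u, v) ∈ I.edges)
    (hv : d.settled v = false)
    (hlt : ∀ q, d.path v = some q → I.cost I.first (v :: p) ≤ I.cost I.first q)
    {h' : FibHeap (Fin n)} (hvalid : h'.Valid)
    (hitems : ∀ y, y ∈ h'.items ↔ y = v ∨ y ∈ d.heap.items)
    (hkey : h'.key = Function.update d.heap.key v (I.cost I.first (v :: p))) :
    I.DijkstraInv { d with heap := h', path := Function.update d.path v (some (v :: p)) }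
      (I.cost I.first p) u rest := by
  have hpu := h.path u p hp
  have hset : ∀ w, d.settled w = true → w ≠ v := by
    rintro w hw rfl
    rw [hv] at hw
    cases hw
  have hcons := I.cost_cons I.first hpu.2 v
  constructor
  · exact hvalid
  · intro w
    rw [hitems, h.mem]
    by_cases hw : w = v
    · subst hw; simp [hv]
    · simp [hw]
  · intro w hw q hq
    simp only at hq hw ⊢
    by_cases hwv : w = v
    · subst hwv
      rw [Function.update_self] at hq
      rw [hkey, Function.update_self, Option.some.inj hq]
    · rw [Function.update_of_ne hwv] at hq
      rw [hkey, Function.update_of_ne hwv]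
      exact h.key w (((hitems w).1 hw).resolve_left hwv) q hq
  · intro w q hq
    simp only at hq
    by_cases hwv : w = v
    · subst hwv
      rw [Function.update_self] at hq
      rw [← Option.some.inj hq]
      exact I.cons_mem_paths hpu he
    · rw [Function.update_of_ne hwv] at hq
      exact h.path w q hq
  · intro w hw
    simp only [Function.update_of_ne (hset w hw)]
    exact h.settled w hw
  · intro w hw q hq
    simp only at hq hw ⊢
    by_cases hwv : w = v
    · subst hwv
      rw [Function.update_self] at hq
      rw [← Option.some.inj hq]
      exact I.cost_le_cons I.first hpu.2 he
    · rw [Function.update_of_ne hwv] at hq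
      exact h.level_le w (((hitems w).1 hw).resolve_left hwv) q hq
  · intro a b hab ha hrest
    simp only [Function.update_of_ne (hset a ha)]
    by_cases hbv : b = v
    · subst hbv
      by_cases hau : a = u
      · subst hau
        exact ⟨p, b :: p, hp, Function.update_self _ _ _, hcons.le⟩
      · obtain ⟨p', q, hp', hq, hle⟩ := h.relaxed a b hab ha (by simp [hau])
        exact ⟨p', b :: p, hp', Function.update_self _ _ _, (hlt q hq).trans hle⟩
    · rw [Function.update_of_ne hbv]
      refine h.relaxed a b hab ha ?_
      simpa [hbv] using hrest
  · obtain ⟨q, hq, hq0⟩ := h.source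
    by_cases hsv : I.source = v
    · subst hsv
      exact ⟨_, Function.update_self _ _ _, (hlt q hq).trans hq0⟩
    · exact ⟨q, by simpa only [Function.update_of_ne hsv] using hq, hq0⟩

theorem relax_spec {d : DijkstraState n} {u v : Fin n} {rest : List (Fin n)}
    {p : NodePath n} (h : I.DijkstraInv d (I.cost I.first p) u (v :: rest))
    (hp : d.path u = some p) (hu : d.settled u = true) (he : (u, v) ∈ I.edges) :
    I.DijkstraInv (I.relax p d v).ret (I.cost I.first p) u rest ∧
      (I.relax p d v).ret.settled = d.settled ∧ (I.relax p d v).ret.path u = some p ∧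
      (I.relax p d v).time + (I.relax p d v).ret.heap.potential ≤ d.heap.potential + 13 := by
  have hpu := h.path u p hp
  cases hq : d.path v with
  | none =>
    have hv : d.settled v = false := by
      by_contra hv
      obtain ⟨q, hq', _⟩ := h.settled v (by simpa using hv)
      rw [hq] at hq'
      cases hq'
    have hnot : v ∉ d.heap.items := by
      rw [h.mem]
      rintro ⟨⟨q, hq'⟩, _⟩
      rw [hq] at hq'
      cases hq'
    obtain ⟨h1, h2, h3, h4⟩ := FibHeap.insert_spec h.valid hnot (I.cost I.first (v :: p))
    have hr : I.relax p d v = ⟨{ d with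
        heap := (d.heap.insert v (I.cost I.first (v :: p))).ret,
        path := Function.update d.path v (some (v :: p)) },
        1 + ((d.heap.insert v (I.cost I.first (v :: p))).time + 0)⟩ := by
      unfold relax
      rw [hq]
      rfl
    rw [hr]
    refine ⟨h.update hp hu he hv (by simp [hq]) h1 h2 h3, rfl, ?_, by simp only; omega⟩
    have : u ≠ v := by
      rintro rfl
      rw [hp] at hq
      cases hq
    simpa only [Function.update_of_ne this] using hp
  | some q =>
    by_cases hc : d.settled v = false ∧ I.cost I.first (v :: p) < I.cost I.first q
    · have hmem : v ∈ d.heap.items := (h.mem v).2 ⟨⟨q, hq⟩, hc.1⟩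
      obtain ⟨h1, h2, h3, h4⟩ := FibHeap.decreaseKey_spec h.valid hmem
        (k := I.cost I.first (v :: p)) (by rw [h.key v hmem q hq]; exact hc.2.le)
      have hr : I.relax p d v = ⟨{ d with
          heap := (d.heap.decreaseKey v (I.cost I.first (v :: p))).ret,
          path := Function.update d.path v (some (v :: p)) },
          1 + ((d.heap.decreaseKey v (I.cost I.first (v :: p))).time + 0)⟩ := by
        unfold relax
        rw [hq]
        simp only [hc]
        simp
        rfl
      rw [hr]
      refine ⟨h.update hp hu he hc.1 (fun q' hq' => ?_) h1 (fun y => ?_) h3, rfl, ?_,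
        by simp only; omega⟩
      · rw [hq] at hq'
        rw [← Option.some.inj hq']
        exact hc.2.le
      · rw [h2]
        constructor
        · exact Or.inr
        · rintro (rfl | hy)
          · exact hmem
          · exact hy
      · have : u ≠ v := by
          rintro rfl
          rw [hu] at hc
          exact Bool.noConfusion hc.1
        simpa only [Function.update_of_ne this] using hp
    · have hr : I.relax p d v = ⟨d, 1 + 0⟩ := by
        unfold relax
        rw [hq]
        simp only [hc, if_false]
        rfl
      rw [hr]
      refine ⟨{ h with relaxed := ?_ }, rfl, hp, by simp only; omega⟩
      intro a b hab ha hrest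
      by_cases hb : a = u ∧ b = v
      · obtain ⟨rfl, rfl⟩ := hb
        refine ⟨p, q, hp, hq, ?_⟩
        rw [← I.cost_cons I.first hpu.2]
        -- For an unsettled end node the failed comparison gives the inequality. For a settled one
        -- its cost is at most the current level, which is the cost of `p`, and a non-negative edge
        -- only adds to it.
        by_cases hs : d.settled b = false
        · exact not_lt.1 fun h => hc ⟨hs, h⟩
        · obtain ⟨q', hq', hle⟩ := h.settled b (by simpa using hs)
          rw [hq] at hq'
          rw [Option.some.inj hq']
          exact hle.trans (I.cost_le_cons I.first hpu.2 he)
      · refine h.relaxed a b hab ha fun hcon => ?_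
        rcases List.mem_cons.1 hcon.2 with hbv | hbr
        · exact hb ⟨hcon.1, hbv⟩
        · exact hrest ⟨hcon.1, hbr⟩

/-- One round of the Dijkstra algorithm settles one more node, unless the heap is empty. -/
theorem dijkstraStep_spec {d : DijkstraState n} {level : ℝ} {u : Fin n} {Δ k : ℕ}
    (h : I.DijkstraInv d level u []) (hΔ : ∀ v, I.outDegree v ≤ Δ)
    (hk : d.heap.items = [] ∨ k ≤ (Finset.univ.filter fun v => d.settled v = true).card) :
    (∃ level' u', I.DijkstraInv (I.dijkstraStep d).ret level' u' []) ∧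
      ((I.dijkstraStep d).ret.heap.items = [] ∨ k + 1 ≤
        (Finset.univ.filter fun v => (I.dijkstraStep d).ret.settled v = true).card) ∧
      (I.dijkstraStep d).time + (I.dijkstraStep d).ret.heap.potential ≤
        d.heap.potential + (FibHeap.opCost n + W + 13 * Δ) := by
  rcases FibHeap.extractMin_spec h.valid h.length_le with ⟨h1, h2, h3⟩ |
    ⟨w, h', h1, h2, h3, h4, h5, h6, h7⟩
  · have hr : I.dijkstraStep d = ⟨d, d.heap.extractMin.time + 0⟩ := by
      unfold dijkstraStep
      change Timed.mk _ _ = _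
      rw [h1]
      rfl
    rw [hr]
    refine ⟨⟨level, u, h⟩, Or.inl h3, ?_⟩
    simp only [h2, FibHeap.opCost]
    omega
  · obtain ⟨⟨p, hp⟩, hw⟩ := (h.mem w).1 h3
    set d1 : DijkstraState n :=
      { d with heap := h', settled := Function.update d.settled w true } with hd1
    have hr : I.dijkstraStep d = ⟨((I.neighbors w).foldlM (I.relax p) d1).ret,
        d.heap.extractMin.time + (W + ((I.neighbors w).foldlM (I.relax p) d1).time)⟩ := by
      unfold dijkstraStep
      change Timed.mk _ _ = _
      rw [h1]
      simp only
      rw [hp]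
      rfl
    have hkw := h.key w h3 p hp
    -- The extracted cost becomes the new level, and all edges leaving `w` are recorded as not yet
    -- relaxed.
    have hinv : I.DijkstraInv d1 (I.cost I.first p) w (I.neighbors w) := by
      constructor
      · exact h2
      · intro v
        rw [h5, h.mem]
        by_cases hv : v = w
        · subst hv; simp [hd1]
        · simp [hd1, hv]
      · intro v hv q hq
        change h'.key v = _
        rw [h6]
        exact h.key v ((h5 v).1 hv).1 q hq
      · exact h.path
      · intro v hv
        by_cases hvw : v = w
        · subst hvw
          exact ⟨p, hp, le_rfl⟩
        · simp only [hd1, Function.update_of_ne hvw] at hv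
          obtain ⟨q, hq, hle⟩ := h.settled v hv
          exact ⟨q, hq, hle.trans (h.level_le w h3 p hp)⟩
      · intro v hv q hq
        have hv' := ((h5 v).1 hv).1
        rw [← hkw, ← h.key v hv' q hq]
        exact h4 v hv'
      · intro a b hab ha hrest
        by_cases haw : a = w
        · subst haw
          exact absurd ⟨rfl, I.mem_neighbors.2 hab⟩ hrest
        · simp only [hd1, Function.update_of_ne haw] at ha
          exact h.relaxed a b hab ha (by simp)
      · exact h.source
    have hfold := Timed.foldlM_induct (I.relax p)
      (fun rest s t => I.DijkstraInv s (I.cost I.first p) w rest ∧ s.settled = d1.settled ∧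
        s.path w = some p ∧ (∀ v ∈ rest, (w, v) ∈ I.edges) ∧
        t + s.heap.potential + 13 * rest.length ≤
          d1.heap.potential + 13 * (I.neighbors w).length)
      (by
        rintro v rest s t ⟨g1, g2, g3, g4, g5⟩
        obtain ⟨k1, k2, k3, k4⟩ := relax_spec g1 g3 (by rw [g2]; simp [hd1]) (g4 v (by simp))
        refine ⟨k1, k2.trans g2, k3, fun v' hv' => g4 v' (by simp [hv']), ?_⟩
        simp only [List.length_cons] at g5
        omega) (I.neighbors w) d1 0
      ⟨hinv, rfl, hp, fun v hv => I.mem_neighbors.1 hv, by omega⟩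
    obtain ⟨g1, g2, g3, g4, g5⟩ := hfold
    rw [hr]
    refine ⟨⟨_, _, g1⟩, Or.inr ?_, ?_⟩
    · rw [g2]
      rcases hk with hk | hk
      · rw [hk] at h3
        simp at h3
      · refine lt_of_le_of_lt hk (Finset.card_lt_card ?_)
        rw [Finset.ssubset_iff_of_subset]
        · exact ⟨w, by simp [hd1], by simp [hw]⟩
        · intro v hv
          simp only [Finset.mem_filter, Finset.mem_univ, true_and] at hv ⊢
          by_cases hvw : v = w
          · simp [hd1, hvw]
          · simpa [hd1, hvw] using hv
    · have hlen := I.length_neighbors w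
      have hΔw := hΔ w
      have : d1.heap = h' := rfl
      rw [this] at g5
      simp only [List.length_nil] at g5
      simp only
      rw [hlen] at g5
      have : 13 * I.outDegree w ≤ 13 * Δ := by omega
      omega

/-- The paths in the Pareto sample are Pareto paths. -/
theorem paretoSample_spec {Δ : ℕ} (hΔ : ∀ v, I.outDegree v ≤ Δ) :
    (∀ v, I.paretoSample.ret v ∈ I.paretoPaths I.source v) ∧
      I.paretoSample.time ≤
        n + I.edges.card * W + 4 + n * (FibHeap.opCost n + W + 13 * Δ) := by
  obtain ⟨h1, h2, h3, h4⟩ := FibHeap.insert_spec (FibHeap.valid_empty (α := Fin n))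
    (x := I.source) (by simp) 0
  set h0 := (FibHeap.empty : FibHeap (Fin n)).insert I.source 0 with hh0
  set d0 : DijkstraState n :=
    { heap := h0.ret
      path := Function.update (fun _ => none) I.source (some [I.source])
      settled := fun _ => false } with hd0
  set r := (List.range n).foldlM (fun d _ => I.dijkstraStep d) d0 with hr
  have hret : I.paretoSample.ret = fun v => (r.ret.path v).getD [] := rfl
  have htime : I.paretoSample.time = n + I.edges.card * W + (h0.time + (r.time + 0)) := rfl
  have hpath : ∀ v p, d0.path v = some p → v = I.source ∧ p = [I.source] := by
    intro v p hp
    by_cases hv : v = I.source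
    · subst hv
      simp only [hd0, Function.update_self, Option.some.injEq] at hp
      exact ⟨rfl, hp.symm⟩
    · simp [hd0, Function.update_of_ne hv] at hp
  have hinv : I.DijkstraInv d0 0 I.source [] := by
    constructor
    · exact h1
    · intro v
      rw [h2]
      by_cases hv : v = I.source
      · subst hv; simp [hd0]
      · simp [hd0, hv]
    · intro v hv p hp
      obtain ⟨rfl, rfl⟩ := hpath v p hp
      change h0.ret.key _ = _
      rw [h3, Function.update_self, cost_singleton]
    · intro v p hp
      obtain ⟨rfl, rfl⟩ := hpath v p hp
      exact I.singleton_mem_paths _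
    · intro v hv
      simp [hd0] at hv
    · intro v hv p hp
      obtain ⟨rfl, rfl⟩ := hpath v p hp
      rw [cost_singleton]
    · intro a b _ ha
      simp [hd0] at ha
    · exact ⟨[I.source], by simp [hd0], (I.cost_singleton _ _).le⟩
  have hfold := Timed.foldlM_induct (fun d (_ : ℕ) => I.dijkstraStep d)
    (fun rest s t => rest.length ≤ n ∧ (∃ level u, I.DijkstraInv s level u []) ∧
      (s.heap.items = [] ∨
        n - rest.length ≤ (Finset.univ.filter fun v => s.settled v = true).card) ∧
      t + s.heap.potential + rest.length * (FibHeap.opCost n + W + 13 * Δ) ≤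
        h0.ret.potential + n * (FibHeap.opCost n + W + 13 * Δ))
    (by
      rintro v rest s t ⟨g0, ⟨level, u, g1⟩, g2, g3⟩
      obtain ⟨k1, k2, k3⟩ := dijkstraStep_spec g1 hΔ g2
      simp only [List.length_cons] at g0 k2 g3
      refine ⟨by omega, k1, ?_, ?_⟩
      · rwa [show n - (rest.length + 1) + 1 = n - rest.length by omega] at k2
      · rw [add_mul] at g3
        omega) (List.range n) d0 0
    ⟨by simp, ⟨0, I.source, hinv⟩, Or.inr (by simp), by simp [hd0]⟩
  obtain ⟨-, ⟨level, u, g1⟩, g2, g3⟩ := hfold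
  rw [← hr] at g1 g2 g3
  -- After `n` rounds either the heap has run empty or all `n` nodes are settled; in both cases no
  -- discovered node is left unsettled.
  have hsettled : ∀ v p, r.ret.path v = some p → r.ret.settled v = true := by
    intro v p hp
    rcases g2 with g2 | g2
    · by_contra hv
      have := (g1.mem v).2 ⟨⟨p, hp⟩, by simpa using hv⟩
      rw [g2] at this
      simp at this
    · simp only [List.length_nil, Nat.sub_zero] at g2
      have h5 := Finset.eq_univ_of_card (Finset.univ.filter fun v => r.ret.settled v = true)
        (le_antisymm (Finset.card_le_univ _) (by simpa using g2))
      have h6 : v ∈ Finset.univ.filter fun v => r.ret.settled v = true := by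
        rw [h5]; exact Finset.mem_univ v
      simpa using h6
  -- Optimality is not part of the invariant. It is read off at the end: all edges leaving
  -- discovered nodes are relaxed, so induction along an arbitrary path bounds the found cost by the
  -- cost of that path.
  have hopt : ∀ (q : NodePath n) (v : Fin n), I.IsPathFrom I.source q → q.head? = some v →
      ∃ p, r.ret.path v = some p ∧ I.cost I.first p ≤ I.cost I.first q := by
    intro q
    induction q with
    | nil => exact fun v h => h.elim
    | cons w q ih =>
      intro v hq hv
      obtain rfl : w = v := by simpa using hv
      match q, hq, ih with
      | [], hq, _ =>
        obtain rfl : w = I.source := hq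
        rw [cost_singleton]
        exact g1.source
      | x :: q, hq, ih =>
        obtain ⟨p, hp, hpc⟩ := ih x hq.2 rfl
        obtain ⟨p', q', hp', hq', hle⟩ := g1.relaxed x w hq.1 (hsettled x p hp) (by simp)
        rw [hp] at hp'
        obtain rfl := Option.some.inj hp'
        refine ⟨q', hq', hle.trans ?_⟩
        rw [I.cost_cons I.first (p := x :: q) rfl]
        linarith
  constructor
  · intro v
    obtain ⟨q0, hq0⟩ := I.reachable v
    obtain ⟨p, hp, -⟩ := hopt q0 v hq0.1 hq0.2
    have hv : I.paretoSample.ret v = p := by rw [hret]; simp [hp]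
    rw [hv]
    refine ⟨g1.path v p hp, fun q hq hdom => ?_⟩
    obtain ⟨p', hp', hle⟩ := hopt q v hq.1 hq.2
    rw [hp] at hp'
    obtain rfl := Option.some.inj hp'
    exact absurd (I.cost_lt_of_dominates I.first hdom) (not_lt.2 hle)
  · rw [htime]
    simp only [FibHeap.potential_empty, List.length_nil] at h4 g3
    omega

end MOWSP

/-! ### The adaptive queue -/

namespace MOWSP

variable {n W K : ℕ} (I : MOWSP n W K)

/-- The bound that is used for the amortized time of the operations on the priority heap, which has
at most one item for each node. -/
def heapCost (n : ℕ) : ℕ := FibHeap.opCost (n + 1)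

theorem countP_prio_le_one {Q : List (Entry n)} (hn : (Q.map Entry.path).Nodup) {x : NodePath n}
    (h : ∀ e ∈ Q, e.prio.isSome = true → e.path = x) :
    Q.countP (fun e => e.prio.isSome) ≤ 1 := by
  refine le_trans ?_ (List.nodup_iff_count_le_one.1 hn x)
  rw [List.count_eq_countP, List.countP_map]
  exact List.countP_mono_left fun e he hs => by simpa using h e he hs

theorem length_items_le_of_subset {α : Type} {h h' : FibHeap α} (hv : h'.items.Nodup)
    (hs : ∀ y ∈ h'.items, y ∈ h.items) : h'.items.length ≤ h.items.length :=
  (hv.subperm hs).length_le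

/-- The tail is processed before the head, so distinctness of the paths is what guarantees that the
head is still in the heap when it is deleted. The expensive deletions are counted separately, since
only entries with a priority cause them. -/
theorem prune_spec (keep : NodePath n → Bool) {m : ℕ} (Q : List (Entry n))
    (h : FibHeap (NodePath n)) (hv : h.Valid)
    (hQ : ∀ e ∈ Q, e.prio.isSome = true → e.path ∈ h.items)
    (hn : (Q.map Entry.path).Nodup) (hm : h.items.length ≤ m) :
    (prune keep Q h).ret.1 = Q.filter (fun e => keep e.path) ∧
      (prune keep Q h).ret.2.Valid ∧
      (∀ y, y ∈ (prune keep Q h).ret.2.items ↔ y ∈ h.items ∧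
        ¬ ∃ e ∈ Q, e.prio.isSome = true ∧ keep e.path = false ∧ e.path = y) ∧
      (prune keep Q h).ret.2.key = h.key ∧
      (prune keep Q h).time + (prune keep Q h).ret.2.potential ≤
        h.potential + Q.length + Q.countP (fun e => e.prio.isSome) * FibHeap.opCost m := by
  induction Q with
  | nil => exact ⟨rfl, hv, by simp [prune, pure], rfl, by simp [prune, pure]⟩
  | cons e l ih =>
    rw [List.map_cons, List.nodup_cons] at hn
    obtain ⟨h1, h2, h3, h4, h5⟩ := ih (fun e he => hQ e (by simp [he])) hn.2
    have hlen : (prune keep l h).ret.2.items.length ≤ m :=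
      (length_items_le_of_subset h2.nodup fun y hy => ((h3 y).1 hy).1).trans hm
    by_cases hk : keep e.path = true
    · have hr : prune keep (e :: l) h = ⟨(e :: (prune keep l h).ret.1, (prune keep l h).ret.2),
          1 + ((prune keep l h).time + 0)⟩ := by
        rw [prune]
        simp only [hk, if_true]
        rfl
      rw [hr]
      refine ⟨by simp [hk, h1], h2, ?_, h4, ?_⟩
      · intro y
        simp only [h3, List.mem_cons, exists_eq_or_imp, hk]
        simp
      · simp only [List.length_cons, List.countP_cons]
        rw [add_mul]
        omega
    · have hk' : keep e.path = false := by simpa using hk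
      by_cases hp : e.prio.isSome = true
      · have hmem : e.path ∈ (prune keep l h).ret.2.items := by
          refine (h3 _).2 ⟨hQ e (by simp) hp, ?_⟩
          rintro ⟨e', he', -, -, heq⟩
          exact hn.1 (heq ▸ List.mem_map_of_mem he')
        obtain ⟨k1, k2, k3, k4⟩ := FibHeap.delete_spec h2.toOrdered hmem hlen
        have hr : prune keep (e :: l) h = ⟨((prune keep l h).ret.1,
            ((prune keep l h).ret.2.delete e.path).ret),
            1 + ((prune keep l h).time + (((prune keep l h).ret.2.delete e.path).time + 0))⟩ := by
          rw [prune]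
          simp only [hk', hp, if_true]
          rfl
        rw [hr]
        refine ⟨by simp [hk', h1], k1, ?_, k3.trans h4, ?_⟩
        · intro y
          simp only [k2, h3, List.mem_cons, exists_eq_or_imp, hk', hp, true_and, not_or]
          constructor
          · rintro ⟨⟨a, b⟩, c⟩
            exact ⟨a, fun h => c h.symm, b⟩
          · rintro ⟨a, c, b⟩
            exact ⟨⟨a, b⟩, fun h => c h.symm⟩
        · simp only [List.length_cons, List.countP_cons, hp, if_true]
          rw [add_mul]
          omega
      · have hr : prune keep (e :: l) h = ⟨((prune keep l h).ret.1, (prune keep l h).ret.2),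
            1 + ((prune keep l h).time + 0)⟩ := by
          rw [prune]
          simp only [hk', hp]
          rfl
        rw [hr]
        refine ⟨by simp [hk', h1], h2, ?_, h4, ?_⟩
        · intro y
          simp only [h3, List.mem_cons, exists_eq_or_imp, hp]
          simp
        · simp only [List.length_cons, List.countP_cons]
          rw [add_mul]
          omega

theorem nullify_spec {m : ℕ} (Q : List (Entry n))
    (h : FibHeap (NodePath n)) (hv : h.Valid)
    (hQ : ∀ e ∈ Q, e.prio.isSome = true → e.path ∈ h.items)
    (hn : (Q.map Entry.path).Nodup) (hm : h.items.length ≤ m) :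
    (nullify Q h).ret.1 = Q.map (fun e => { e with prio := none }) ∧
      (nullify Q h).ret.2.Valid ∧
      (∀ y, y ∈ (nullify Q h).ret.2.items ↔ y ∈ h.items ∧
        ¬ ∃ e ∈ Q, e.prio.isSome = true ∧ e.path = y) ∧
      (nullify Q h).ret.2.key = h.key ∧
      (nullify Q h).time + (nullify Q h).ret.2.potential ≤
        h.potential + Q.length + Q.countP (fun e => e.prio.isSome) * FibHeap.opCost m := by
  induction Q with
  | nil => exact ⟨rfl, hv, by simp [nullify, pure], rfl, by simp [nullify, pure]⟩
  | cons e l ih =>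
    rw [List.map_cons, List.nodup_cons] at hn
    obtain ⟨h1, h2, h3, h4, h5⟩ := ih (fun e he => hQ e (by simp [he])) hn.2
    have hlen : (nullify l h).ret.2.items.length ≤ m :=
      (length_items_le_of_subset h2.nodup fun y hy => ((h3 y).1 hy).1).trans hm
    by_cases hp : e.prio.isSome = true
    · have hmem : e.path ∈ (nullify l h).ret.2.items := by
        refine (h3 _).2 ⟨hQ e (by simp) hp, ?_⟩
        rintro ⟨e', he', -, heq⟩
        exact hn.1 (heq ▸ List.mem_map_of_mem he')
      obtain ⟨k1, k2, k3, k4⟩ := FibHeap.delete_spec h2.toOrdered hmem hlen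
      have hr : nullify (e :: l) h = ⟨({ e with prio := none } :: (nullify l h).ret.1,
          ((nullify l h).ret.2.delete e.path).ret),
          1 + ((nullify l h).time + (((nullify l h).ret.2.delete e.path).time + 0))⟩ := by
        rw [nullify]
        simp only [hp, if_true]
        rfl
      rw [hr]
      refine ⟨by simp [h1], k1, ?_, k3.trans h4, ?_⟩
      · intro y
        simp only [k2, h3, List.mem_cons, exists_eq_or_imp, hp, true_and, not_or]
        constructor
        · rintro ⟨⟨a, b⟩, c⟩
          exact ⟨a, fun h => c h.symm, b⟩
        · rintro ⟨a, c, b⟩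
          exact ⟨⟨a, b⟩, fun h => c h.symm⟩
      · simp only [List.length_cons, List.countP_cons, hp, if_true]
        rw [add_mul]
        omega
    · have hr : nullify (e :: l) h = ⟨(e :: (nullify l h).ret.1, (nullify l h).ret.2),
          1 + ((nullify l h).time + 0)⟩ := by
        rw [nullify]
        simp only [hp]
        rfl
      rw [hr]
      refine ⟨?_, h2, ?_, h4, ?_⟩
      · have he : { e with prio := none } = e := by
          obtain ⟨a, b, c⟩ := e
          cases c with
          | none => rfl
          | some k => exact absurd rfl hp
        simp [h1, he]
      · intro y
        simp only [h3, List.mem_cons, exists_eq_or_imp, hp]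
        simp
      · simp only [List.length_cons, List.countP_cons]
        rw [add_mul]
        omega

/-! ### Views of the state, the queue invariant, and pushing -/

/-- The discovered paths to `v`. -/
def State.pathsAt (st : State n K) (v : Fin n) : List (NodePath n) := (st.found v).map Entry.path

/-- An entry without its priority. -/
def Entry.core (e : Entry n) : NodePath n × Bool := (e.path, e.popped)

/-- The entries for the node `v` without their priorities. -/
def State.core (st : State n K) (v : Fin n) : List (NodePath n × Bool) :=
  (st.found v).map Entry.core

theorem State.map_fst_core (st : State n K) (v : Fin n) :
    (st.core v).map Prod.fst = st.pathsAt v := by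
  rw [State.core, List.map_map]
  rfl

/-- The invariant of the adaptive queue. -/
structure QueueInv (st : State n K) : Prop where
  valid : st.heap.Valid
  items : ∀ x, x ∈ st.heap.items ↔
    ∃ v, ∃ e ∈ st.found v, e.path = x ∧ e.prio.isSome = true
  key : ∀ x ∈ st.heap.items, st.heap.key x = I.cost st.iteration x
  nodup : ∀ v, (st.pathsAt v).Nodup
  head : ∀ v, ∀ e ∈ st.found v, e.path.head? = some v
  prio : ∀ v, ∀ e ∈ st.found v, e.prio.isSome = true →
    e.popped = false ∧ I.firstMin st.iteration (st.pathsAt v) = some e.path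

variable {I}

namespace QueueInv

variable {st : State n K}

theorem mem_items_iff (h : I.QueueInv st) {x : NodePath n} {v : Fin n} (hx : x.head? = some v) :
    x ∈ st.heap.items ↔ ∃ e ∈ st.found v, e.path = x ∧ e.prio.isSome = true := by
  rw [h.items]
  constructor
  · rintro ⟨u, e, he, rfl, hp⟩
    have := h.head u e he
    rw [hx] at this
    obtain rfl := Option.some.inj this
    exact ⟨e, he, rfl, hp⟩
  · exact fun h => ⟨v, h⟩

/-- Two heap items with the same end node are both the first minimum for that node, hence equal. So
end nodes separate the items; the bound is the size of `Option (Fin n)`, the type of `List.head?`.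
-/
theorem length_items_le (h : I.QueueInv st) : st.heap.items.length ≤ n + 1 := by
  have h1 : (st.heap.items.map List.head?).Nodup := by
    refine List.Nodup.map_on ?_ h.valid.nodup
    intro x hx y hy hxy
    obtain ⟨v, e, he, rfl, hp⟩ := (h.items x).1 hx
    have hv := h.head v e he
    obtain ⟨e', he', rfl, hp'⟩ := (h.mem_items_iff (hxy.symm.trans hv)).1 hy
    have := (h.prio v e he hp).2
    rw [(h.prio v e' he' hp').2] at this
    exact (Option.some.inj this).symm
  simpa using h1.length_le_card

theorem countP_le_one (h : I.QueueInv st) (v : Fin n) :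
    (st.found v).countP (fun e => e.prio.isSome) ≤ 1 := by
  cases hf : I.firstMin st.iteration (st.pathsAt v) with
  | none =>
    have := eq_nil_of_firstMin hf
    rw [State.pathsAt, List.map_eq_nil_iff] at this
    simp [this]
  | some x =>
    refine countP_prio_le_one (h.nodup v) (x := x) fun e he hp => ?_
    have := (h.prio v e he hp).2
    rw [hf] at this
    exact (Option.some.inj this).symm

/-- Changing the list of entries for one node. -/
theorem update (h : I.QueueInv st) {v : Fin n} {Q : List (Entry n)} {st' : State n K}
    (hi : st'.iteration = st.iteration) (hf : st'.found = Function.update st.found v Q)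
    (hvalid : st'.heap.Valid)
    (hitems : ∀ x, x ∈ st'.heap.items ↔ (x ∈ st.heap.items ∧ x.head? ≠ some v) ∨
      ∃ e ∈ Q, e.path = x ∧ e.prio.isSome = true)
    (hkey : ∀ x ∈ st'.heap.items, st'.heap.key x = I.cost st.iteration x)
    (hnodup : (Q.map Entry.path).Nodup) (hhead : ∀ e ∈ Q, e.path.head? = some v)
    (hprio : ∀ e ∈ Q, e.prio.isSome = true →
      e.popped = false ∧ I.firstMin st.iteration (Q.map Entry.path) = some e.path) :
    I.QueueInv st' := by
  constructor
  · exact hvalid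
  · intro x
    rw [hitems, hf]
    constructor
    · rintro (⟨hx, hxv⟩ | hx)
      · obtain ⟨u, e, he, rfl, hp⟩ := (h.items x).1 hx
        have huv : u ≠ v := by
          rintro rfl
          exact hxv (h.head u e he)
        exact ⟨u, e, by rwa [Function.update_of_ne huv], rfl, hp⟩
      · exact ⟨v, by rwa [Function.update_self]⟩
    · rintro ⟨u, e, he, rfl, hp⟩
      by_cases huv : u = v
      · subst huv
        rw [Function.update_self] at he
        exact Or.inr ⟨e, he, rfl, hp⟩
      · rw [Function.update_of_ne huv] at he
        refine Or.inl ⟨(h.items _).2 ⟨u, e, he, rfl, hp⟩, ?_⟩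
        rw [h.head u e he]
        simpa using huv
  · rw [hi]
    exact hkey
  · intro u
    unfold State.pathsAt
    rw [hf]
    by_cases huv : u = v
    · subst huv
      rwa [Function.update_self]
    · rw [Function.update_of_ne huv]
      exact h.nodup u
  · intro u
    rw [hf]
    by_cases huv : u = v
    · subst huv
      rwa [Function.update_self]
    · rw [Function.update_of_ne huv]
      exact h.head u
  · intro u
    unfold State.pathsAt
    rw [hf, hi]
    by_cases huv : u = v
    · subst huv
      rwa [Function.update_self]
    · rw [Function.update_of_ne huv]
      exact h.prio u

/-- Pruning the list of entries for one node. -/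
theorem prune (h : I.QueueInv st) (v : Fin n) (keep : NodePath n → Bool) {st' : State n K}
    (hi : st'.iteration = st.iteration)
    (hf : st'.found = Function.update st.found v (prune keep (st.found v) st.heap).ret.1)
    (hh : st'.heap = (prune keep (st.found v) st.heap).ret.2) :
    I.QueueInv st' ∧ st'.core = Function.update st.core v ((st.core v).filter fun c => keep c.1) ∧
      (∀ x ∈ st'.heap.items, x ∈ st.heap.items) ∧
      (MOWSP.prune keep (st.found v) st.heap).time + st'.heap.potential ≤
        st.heap.potential + (st.found v).length + heapCost n := by
  have hQ : ∀ e ∈ st.found v, e.prio.isSome = true → e.path ∈ st.heap.items :=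
    fun e he hp => (h.items _).2 ⟨v, e, he, rfl, hp⟩
  obtain ⟨h1, h2, h3, h4, h5⟩ := prune_spec keep (st.found v) st.heap h.valid hQ (h.nodup v)
    h.length_items_le
  rw [← hh] at h2 h3 h4 h5
  rw [h1] at hf
  refine ⟨h.update hi hf h2 ?_ ?_ ?_ ?_ ?_, ?_, fun x hx => ((h3 x).1 hx).1, ?_⟩
  · intro x
    rw [h3]
    constructor
    · rintro ⟨hx, hne⟩
      by_cases hxv : x.head? = some v
      · obtain ⟨e, he, rfl, hp⟩ := (h.mem_items_iff hxv).1 hx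
        refine Or.inr ⟨e, List.mem_filter.2 ⟨he, ?_⟩, rfl, hp⟩
        by_contra hk
        exact hne ⟨e, he, hp, by simpa using hk, rfl⟩
      · exact Or.inl ⟨hx, hxv⟩
    · rintro (⟨hx, hxv⟩ | ⟨e, he, rfl, hp⟩)
      · refine ⟨hx, ?_⟩
        rintro ⟨e, he, -, -, rfl⟩
        exact hxv (h.head v e he)
      · obtain ⟨he, hk⟩ := List.mem_filter.1 he
        refine ⟨hQ e he hp, ?_⟩
        rintro ⟨e', he', -, hk', heq⟩
        rw [heq, hk] at hk'
        cases hk'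
  · intro x hx
    rw [h4]
    exact h.key x ((h3 x).1 hx).1
  · exact (h.nodup v).sublist (List.filter_sublist.map _)
  · exact fun e he => h.head v e (List.mem_filter.1 he).1
  · intro e he hp
    obtain ⟨he, hk⟩ := List.mem_filter.1 he
    obtain ⟨k1, k2⟩ := h.prio v e he hp
    exact ⟨k1, firstMin_filter k2 fun b _ hbe => by rw [hbe]; exact hk⟩
  · funext u
    unfold State.core
    rw [hf]
    by_cases huv : u = v
    · subst huv
      simp only [Function.update_self, List.filter_map]
      rfl
    · simp only [Function.update_of_ne huv]
  -- At most one entry for `v` has a priority, so pruning pays for at most one heap deletion.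
  · have h6 := Nat.mul_le_mul_right (FibHeap.opCost (n + 1)) (h.countP_le_one v)
    unfold heapCost
    omega

end QueueInv

open Classical in
/-- The effect of pushing a path. -/
theorem push_spec {st : State n K} (h : I.QueueInv st) {v : Fin n} {p : NodePath n}
    (hp : p.head? = some v) (hnew : p ∉ st.pathsAt v) :
    I.QueueInv (I.push v p st).ret ∧
      (I.push v p st).ret.core = Function.update st.core v (st.core v ++ [(p, false)]) ∧
      (I.push v p st).ret.iteration = st.iteration ∧ (I.push v p st).ret.best = st.best ∧
      (∀ x ∈ (I.push v p st).ret.heap.items, x = p ∨ x ∈ st.heap.items) ∧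
      (I.push v p st).time + (I.push v p st).ret.heap.potential ≤ st.heap.potential +
        (1 + W + (st.found v).length * (W + 2) + heapCost n + 4) := by
  have hlen : (st.found v).length * (W + 2) =
    (st.found v).length * (W + 1) + (st.found v).length := by ring
  have hpi : p ∉ st.heap.items := by
    intro hc
    obtain ⟨e, he, rfl, -⟩ := (h.mem_items_iff hp).1 hc
    exact hnew (List.mem_map_of_mem he)
  have hcore : ∀ (Q : List (Entry n)) (st' : State n K) (k : Option ℝ),
      st'.found = Function.update st.found v (Q ++ [⟨p, false, k⟩]) →
      Q.map Entry.core = st.core v →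
      st'.core = Function.update st.core v (st.core v ++ [(p, false)]) := by
    intro Q st' k hf hQ
    funext u
    unfold State.core
    rw [hf]
    by_cases huv : u = v
    · subst huv
      rw [Function.update_self, Function.update_self, List.map_append, hQ]
      rfl
    · rw [Function.update_of_ne huv, Function.update_of_ne huv]
  have hnodup : ∀ (Q : List (Entry n)) (k : Option ℝ), Q.map Entry.path = st.pathsAt v →
      ((Q ++ [(⟨p, false, k⟩ : Entry n)]).map Entry.path).Nodup := by
    intro Q k hQ
    rw [List.map_append, hQ, List.map_singleton, ← List.concat_eq_append]
    exact (h.nodup v).concat hnew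
  by_cases hc : ∃ e ∈ st.found v, I.cost st.iteration e.path ≤ I.cost st.iteration p
  · have hr : I.push v p st = ⟨{ st with
        found := Function.update st.found v (st.found v ++ [⟨p, false, none⟩]) },
        1 + W + (st.found v).length * (W + 1) + 0⟩ := by
      unfold push
      simp only [hc, if_true]
      rfl
    rw [hr]
    refine ⟨h.update (Q := st.found v ++ [⟨p, false, none⟩]) rfl rfl h.valid ?_ h.key
      (hnodup _ _ rfl) ?_ ?_, hcore (st.found v) _ _ rfl rfl, rfl,
      rfl, fun x hx => Or.inr hx, ?_⟩
    · intro x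
      by_cases hx : x.head? = some v
      · rw [h.mem_items_iff hx]
        simp [hx]
      · simp only [hx, ne_eq, not_false_eq_true, and_true]
        constructor
        · exact Or.inl
        · rintro (hx | ⟨e, he, rfl, hs⟩)
          · exact hx
          · rcases List.mem_append.1 he with he | he
            · exact absurd (h.head v e he) hx
            · rw [List.mem_singleton.1 he] at hs
              cases hs
    · intro e he
      rcases List.mem_append.1 he with he | he
      · exact h.head v e he
      · rw [List.mem_singleton.1 he]
        exact hp
    · intro e he hs
      rcases List.mem_append.1 he with he | he
      · obtain ⟨h1, h2⟩ := h.prio v e he hs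
        refine ⟨h1, ?_⟩
        unfold State.pathsAt at h2
        rw [List.map_append, List.map_singleton, firstMin_append, h2]
        -- Some known path is at most as expensive as `p`, and so is the first minimum. Since
        -- `firstMin` compares strictly, appending `p` leaves it unchanged.
        obtain ⟨e', he', hle⟩ := hc
        have := (cost_le_of_firstMin h2 _ (List.mem_map_of_mem he')).trans hle
        simp only [not_lt.2 this, if_false]
      · rw [List.mem_singleton.1 he] at hs
        cases hs
    · simp only
      omega
  · have hQ : ∀ e ∈ st.found v, e.prio.isSome = true → e.path ∈ st.heap.items :=
      fun e he hp => (h.items _).2 ⟨v, e, he, rfl, hp⟩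
    obtain ⟨h1, h2, h3, h4, h5⟩ := nullify_spec (st.found v) st.heap h.valid hQ (h.nodup v)
      h.length_items_le
    set nl := nullify (st.found v) st.heap with hnl
    have hpn : p ∉ nl.ret.2.items := fun hc => hpi ((h3 p).1 hc).1
    obtain ⟨k1, k2, k3, k4⟩ := FibHeap.insert_spec h2 hpn (I.cost st.iteration p)
    have hr : I.push v p st = ⟨{ st with
        found := Function.update st.found v
          (nl.ret.1 ++ [⟨p, false, some (I.cost st.iteration p)⟩])
        heap := (nl.ret.2.insert p (I.cost st.iteration p)).ret },
        1 + W + (st.found v).length * (W + 1) +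
          (nl.time + ((nl.ret.2.insert p (I.cost st.iteration p)).time + 0))⟩ := by
      unfold push
      simp only [hc, if_false]
      rfl
    rw [hr]
    have hpaths : nl.ret.1.map Entry.path = st.pathsAt v := by
      rw [h1, List.map_map]
      rfl
    have hnone : ∀ e ∈ nl.ret.1, e.prio = none := by
      intro e he
      rw [h1] at he
      obtain ⟨e', -, rfl⟩ := List.mem_map.1 he
      rfl
    refine ⟨h.update (Q := nl.ret.1 ++ [⟨p, false, some (I.cost st.iteration p)⟩]) rfl rfl k1
      ?_ ?_ (hnodup _ _ hpaths) ?_ ?_, hcore nl.ret.1 _ _ rfl ?_, rfl, rfl, ?_, ?_⟩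
    · intro x
      simp only [k2, h3]
      constructor
      · rintro (rfl | ⟨hx, hne⟩)
        · exact Or.inr ⟨⟨x, false, some (I.cost st.iteration x)⟩, by simp, rfl, rfl⟩
        · refine Or.inl ⟨hx, fun hxv => hne ?_⟩
          obtain ⟨e, he, hex, hs⟩ := (h.mem_items_iff hxv).1 hx
          exact ⟨e, he, hs, hex⟩
      · rintro (⟨hx, hxv⟩ | ⟨e, he, rfl, hs⟩)
        · refine Or.inr ⟨hx, ?_⟩
          rintro ⟨e, he, -, rfl⟩
          exact hxv (h.head v e he)
        · rcases List.mem_append.1 he with he | he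
          · rw [hnone e he] at hs
            cases hs
          · rw [List.mem_singleton.1 he]
            exact Or.inl rfl
    · intro x hx
      simp only at hx ⊢
      rw [k3]
      by_cases hxp : x = p
      · rw [hxp, Function.update_self]
      · rw [Function.update_of_ne hxp, h4]
        exact h.key x ((h3 x).1 (((k2 x).1 hx).resolve_left hxp)).1
    · intro e he
      rcases List.mem_append.1 he with he | he
      · rw [h1] at he
        obtain ⟨e', he', rfl⟩ := List.mem_map.1 he
        exact h.head v e' he'
      · rw [List.mem_singleton.1 he]
        exact hp
    · intro e he hs
      rcases List.mem_append.1 he with he | he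
      · rw [hnone e he] at hs
        cases hs
      · rw [List.mem_singleton.1 he]
        refine ⟨rfl, ?_⟩
        rw [List.map_append, hpaths]
        refine firstMin_append_of_lt fun q hq => ?_
        obtain ⟨e', he', rfl⟩ := List.mem_map.1 hq
        by_contra hle
        exact hc ⟨e', he', not_lt.1 hle⟩
    · rw [h1, List.map_map]
      rfl
    · intro x hx
      rcases (k2 x).1 hx with hx | hx
      · exact Or.inl hx
      · exact Or.inr ((h3 x).1 hx).1
    · have h6 := Nat.mul_le_mul_right (FibHeap.opCost (n + 1)) (h.countP_le_one v)
      simp only [heapCost]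
      omega

end MOWSP

/-! ### The relevance check and the adaptation of the queue -/

namespace Timed

theorem bind_eq {α β : Type} (x : Timed α) (f : α → Timed β) :
    (x >>= f) = ⟨(f x.ret).ret, x.time + (f x.ret).time⟩ := rfl

theorem pure_eq {α : Type} (a : α) : (pure a : Timed α) = ⟨a, 0⟩ := rfl

end Timed

namespace MOWSP

variable {n W K : ℕ} {I : MOWSP n W K}

theorem improve_eq (b : Fin K → Option (NodePath n)) (p : NodePath n) (j : Fin K) :
    I.improve b p j = match b j with
      | none => some p
      | some e => if I.cost j p < I.cost j e then some p else some e := by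
  unfold improve Improves
  cases b j with
  | none => simp
  | some e => simp

/-- Time that is set aside as long as the array of best paths has not been computed. -/
def pending (W : ℕ) (o : Option (Fin K → Option (NodePath n))) : ℕ :=
  if o.isNone then (K + 1) * (K * W + K) else 0

/-- A bound for the time of a relevance check in which `q` paths are known, apart from the work on
the array of best paths. -/
def relevanceCost (n W q : ℕ) : ℕ := 1 + 2 * (q * W) + 2 * q + heapCost n

/-- The effect of the relevance check on the state. -/
structure RelevanceSpec (I : MOWSP n W K) (v : Fin n) (p : NodePath n) (st : State n K)
    (r : Timed (Bool × State n K)) : Prop where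
  inv : I.QueueInv r.ret.2
  iteration : r.ret.2.iteration = st.iteration
  best_of_ne : ∀ u ≠ v, r.ret.2.best u = st.best u
  items : ∀ x ∈ r.ret.2.heap.items, x ∈ st.heap.items
  time : r.time + r.ret.2.heap.potential + pending W (r.ret.2.best v) ≤
    st.heap.potential + relevanceCost n W (st.found v).length + (K * W + 2 * K) +
      pending W (st.best v)
  time_of_lt : ((st.found v).length : ℝ) < (K : ℝ) / W → st.best v = none →
    r.ret.2.best v = none ∧ r.time + r.ret.2.heap.potential ≤
      st.heap.potential + relevanceCost n W (st.found v).length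
  dropped : r.ret.1 = false → r.ret.2.core = st.core ∧
    ∀ b, r.ret.2.best v = some b → ∀ j, b j = I.firstMin j (st.pathsAt v)
  relevant : r.ret.1 = true → ∃ keep : NodePath n → Bool,
    r.ret.2.core = Function.update st.core v ((st.core v).filter fun c => keep c.1) ∧
    (∀ j e, I.firstMin j (st.pathsAt v) = some e → keep e = false → I.cost j p < I.cost j e) ∧
    (∀ b, r.ret.2.best v = some b → ∀ j,
      b j = I.firstMin j (((st.core v).filter fun c => keep c.1).map Prod.fst ++ [p])) ∧
    ((st.core v).filter fun c => keep c.1).length ≤ K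

/-- Updating the array cell by cell agrees with recomputing it from the pruned and extended list,
because a minimum can only be pruned where `p` beats it. -/
theorem improve_eq_firstMin {st : State n K} {v : Fin n} {p : NodePath n}
    {b : Fin K → Option (NodePath n)} (hb : ∀ j, b j = I.firstMin j (st.pathsAt v))
    {keep : NodePath n → Bool}
    (hk : ∀ j e, I.firstMin j (st.pathsAt v) = some e → keep e = false →
      I.cost j p < I.cost j e) (j : Fin K) :
    I.improve b p j =
      I.firstMin j (((st.core v).filter fun c => keep c.1).map Prod.fst ++ [p]) := by
  rw [improve_eq, hb, ← st.map_fst_core v]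
  refine (firstMin_filter_append (g := Prod.fst) (keep := fun c => keep c.1) ?_).symm
  intro c _ hc hkc
  rw [st.map_fst_core v] at hc
  exact hk j c.1 hc hkc

/-- The pruned paths are dominated by `p`, hence strictly more expensive for every coefficient
vector, so no minimum is lost without being beaten. -/
theorem isRelevant_of_lt {st : State n K} (h : I.QueueInv st) {v : Fin n} {p : NodePath n}
    (hbest : ∀ b, st.best v = some b → ∀ j, b j = I.firstMin j (st.pathsAt v))
    (hlt : ((st.found v).length : ℝ) < (K : ℝ) / W) :
    RelevanceSpec I v p st (I.isRelevant v p st) := by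
  have hqK : (st.found v).length ≤ K := by
    have hW : (1 : ℝ) ≤ W := by exact_mod_cast I.W_pos
    have : ((st.found v).length : ℝ) ≤ K := hlt.le.trans (div_le_self (Nat.cast_nonneg K) hW)
    exact_mod_cast this
  by_cases hdom : ∃ e ∈ st.found v, Dominates (I.vec e.path) (I.vec p)
  · have hr : I.isRelevant v p st = ⟨(false, st), 1 + ((st.found v).length * W + 0)⟩ := by
      unfold isRelevant
      simp only [hlt, hdom, if_true]
      rfl
    rw [hr]
    refine ⟨h, rfl, fun _ _ => rfl, fun _ hx => hx, ?_, fun _ hb => ⟨hb, ?_⟩,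
      fun _ => ⟨rfl, hbest⟩, nofun⟩
    · simp only [relevanceCost]
      omega
    · simp only [relevanceCost]
      omega
  · classical
    set keep : NodePath n → Bool := fun q => decide (¬ Dominates (I.vec p) (I.vec q)) with hkeep
    have hk : ∀ j e, I.firstMin j (st.pathsAt v) = some e → keep e = false →
        I.cost j p < I.cost j e := by
      intro j e _ hke
      simp only [hkeep, decide_eq_false_iff_not, not_not] at hke
      exact I.cost_lt_of_dominates j hke
    have hlen : ((st.core v).filter fun c => keep c.1).length ≤ K :=
      (List.length_filter_le _ _).trans (by simpa [State.core] using hqK)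
    cases hb : st.best v with
    | none =>
      have hr : I.isRelevant v p st = ⟨(true, { st with
          found := Function.update st.found v (prune keep (st.found v) st.heap).ret.1
          heap := (prune keep (st.found v) st.heap).ret.2 }),
          1 + ((st.found v).length * W + ((st.found v).length * W +
            ((prune keep (st.found v) st.heap).time + 0)))⟩ := by
        unfold isRelevant
        simp only [hlt, hdom, if_true, if_false, hb]
        rfl
      rw [hr]
      obtain ⟨h1, h2, h3, h4⟩ := h.prune v keep (st' := { st with
          found := Function.update st.found v (prune keep (st.found v) st.heap).ret.1
          heap := (prune keep (st.found v) st.heap).ret.2 }) rfl rfl rfl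
      refine ⟨h1, rfl, fun _ _ => rfl, h3, ?_, fun _ _ => ⟨hb, ?_⟩, nofun,
        fun _ => ⟨keep, h2, hk, fun b hb' => ?_, hlen⟩⟩
      · simp only [relevanceCost, hb] at *
        omega
      · simp only [relevanceCost] at *
        omega
      · simp only [hb] at hb'
        cases hb'
    | some b =>
      have hr : I.isRelevant v p st = ⟨(true, { st with
          found := Function.update st.found v (prune keep (st.found v) st.heap).ret.1
          best := Function.update st.best v (some (I.improve b p))
          heap := (prune keep (st.found v) st.heap).ret.2 }),
          1 + ((st.found v).length * W + ((st.found v).length * W +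
            ((prune keep (st.found v) st.heap).time + ((K * W + K) + 0))))⟩ := by
        unfold isRelevant
        simp only [hlt, hdom, if_true, if_false, hb]
        rfl
      rw [hr]
      obtain ⟨h1, h2, h3, h4⟩ := h.prune v keep (st' := { st with
          found := Function.update st.found v (prune keep (st.found v) st.heap).ret.1
          best := Function.update st.best v (some (I.improve b p))
          heap := (prune keep (st.found v) st.heap).ret.2 }) rfl rfl rfl
      refine ⟨h1, rfl, fun u hu => Function.update_of_ne hu _ _, h3, ?_,
        fun _ hb' => by simp [hb] at hb', nofun,
        fun _ => ⟨keep, h2, hk, fun b' hb' j => ?_, hlen⟩⟩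
      · simp only [relevanceCost, hb, Function.update_self, pending] at *
        simp
        omega
      · simp only [Function.update_self] at hb'
        rw [← Option.some.inj hb']
        exact improve_eq_firstMin (hbest b hb) hk j

/-- A first-time construction of the array is paid by `pending`, which vanishes from then on. Each
surviving path occupies a cell of an array with `K` cells, which bounds their number. -/
theorem isRelevant_of_not_lt {st : State n K} (h : I.QueueInv st) {v : Fin n} {p : NodePath n}
    (hbest : ∀ b, st.best v = some b → ∀ j, b j = I.firstMin j (st.pathsAt v))
    (hlen : (st.found v).length ≤ K + 1)
    (hlt : ¬ ((st.found v).length : ℝ) < (K : ℝ) / W) :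
    RelevanceSpec I v p st (I.isRelevant v p st) := by
  classical
  -- The cases of a stored array and of a freshly computed one are merged here: `b` is the array in
  -- use and `tb` the time for obtaining it.
  obtain ⟨b, tb, hb, htb, himp, hnimp⟩ : ∃ (b : Fin K → Option (NodePath n)) (tb : ℕ),
      (∀ j, b j = I.firstMin j (st.pathsAt v)) ∧ tb ≤ pending W (st.best v) ∧
      ((∃ i, I.Improves b p i) → I.isRelevant v p st = ⟨(true, { st with
          found := Function.update st.found v
            (prune (fun q => decide (∃ i, I.improve b p i = some q)) (st.found v) st.heap).ret.1
          best := Function.update st.best v (some (I.improve b p))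
          heap :=
            (prune (fun q => decide (∃ i, I.improve b p i = some q)) (st.found v) st.heap).ret.2 }),
          1 + (tb + ((K * W + K) + (((st.found v).length + K) +
            ((prune (fun q => decide (∃ i, I.improve b p i = some q)) (st.found v)
              st.heap).time + 0))))⟩) ∧
      ((¬ ∃ i, I.Improves b p i) → I.isRelevant v p st =
        ⟨(false, { st with best := Function.update st.best v (some b) }),
          1 + (tb + ((K * W + K) + 0))⟩) := by
    cases hb : st.best v with
    | none =>
      refine ⟨fun i => I.firstMin i ((st.found v).map Entry.path),
        (st.found v).length * (K * W + K),
        fun _ => rfl, ?_, fun himp => ?_, fun himp => ?_⟩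
      · simp only [pending, Option.isNone_none, if_true]
        exact Nat.mul_le_mul_right _ hlen
      · unfold isRelevant
        simp only [hlt, if_false, hb]
        simp only [Timed.bind_eq, Timed.pure_eq, Timed.tick, zero_add, himp, if_true]
      · unfold isRelevant
        simp only [hlt, if_false, hb]
        simp only [Timed.bind_eq, Timed.pure_eq, Timed.tick, zero_add, himp, if_false]
    | some b =>
      refine ⟨b, 0, hbest b hb, Nat.zero_le _, fun himp => ?_, fun himp => ?_⟩
      · unfold isRelevant
        simp only [hlt, if_false, hb]
        simp only [Timed.bind_eq, Timed.pure_eq, Timed.tick, himp, if_true]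
      · unfold isRelevant
        simp only [hlt, if_false, hb]
        simp only [Timed.bind_eq, Timed.pure_eq, Timed.tick, himp, if_false]
  by_cases hi : ∃ i, I.Improves b p i
  · rw [himp hi]
    set keep : NodePath n → Bool := fun q => decide (∃ i, I.improve b p i = some q) with hkeep
    obtain ⟨h1, h2, h3, h4⟩ := h.prune v keep (st' := { st with
          found := Function.update st.found v (prune keep (st.found v) st.heap).ret.1
          best := Function.update st.best v (some (I.improve b p))
          heap := (prune keep (st.found v) st.heap).ret.2 }) rfl rfl rfl
    have hk : ∀ j e, I.firstMin j (st.pathsAt v) = some e → keep e = false →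
        I.cost j p < I.cost j e := by
      intro j e he hke
      simp only [hkeep, decide_eq_false_iff_not, not_exists] at hke
      by_contra hcon
      refine hke j ?_
      rw [improve_eq, hb, he]
      simp only [hcon, if_false]
    refine ⟨h1, rfl, fun u hu => Function.update_of_ne hu _ _, h3, ?_,
        fun hc => absurd hc hlt, nofun,
        fun _ => ⟨keep, h2, hk, fun b' hb' j => ?_, ?_⟩⟩
    · simp only [relevanceCost, Function.update_self]
      have : pending W (some (I.improve b p)) = 0 := rfl
      rw [this]
      simp only at h4
      omega
    · simp only [Function.update_self] at hb'
      rw [← Option.some.inj hb']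
      exact improve_eq_firstMin hb hk j
    · have hnd : (((st.core v).filter fun c => keep c.1).map Prod.fst).Nodup := by
        refine List.Nodup.sublist (List.filter_sublist.map _) ?_
        rw [st.map_fst_core]
        exact h.nodup v
      rw [← List.length_map (f := Prod.fst), ← List.toFinset_card_of_nodup hnd,
        ← Finset.card_image_of_injective _ (Option.some_injective _)]
      calc _ ≤ (Finset.univ.image (I.improve b p)).card := by
            refine Finset.card_le_card fun x hx => ?_
            simp only [Finset.mem_image, List.mem_toFinset, List.mem_map, List.mem_filter] at hx
            obtain ⟨y, ⟨c, ⟨-, hc⟩, rfl⟩, rfl⟩ := hx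
            obtain ⟨i, hi⟩ := of_decide_eq_true hc
            exact Finset.mem_image.2 ⟨i, Finset.mem_univ i, hi⟩
        _ ≤ K := Finset.card_image_le.trans (by simp)
  · rw [hnimp hi]
    refine ⟨⟨h.valid, h.items, h.key, h.nodup, h.head, h.prio⟩, rfl,
      fun u hu => Function.update_of_ne hu _ _, fun _ hx => hx, ?_,
      fun hc => absurd hc hlt, fun _ => ⟨rfl, fun b' hb' => ?_⟩, nofun⟩
    · simp only [relevanceCost, Function.update_self]
      have : pending W (some b) = 0 := rfl
      rw [this]
      omega
    · simp only [Function.update_self] at hb'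
      rw [← Option.some.inj hb']
      exact hb

theorem isRelevant_spec {st : State n K} (h : I.QueueInv st) {v : Fin n} (p : NodePath n)
    (hbest : ∀ b, st.best v = some b → ∀ j, b j = I.firstMin j (st.pathsAt v))
    (hlen : (st.found v).length ≤ K + 1) : RelevanceSpec I v p st (I.isRelevant v p st) := by
  by_cases hlt : ((st.found v).length : ℝ) < (K : ℝ) / W
  · exact isRelevant_of_lt h hbest hlt
  · exact isRelevant_of_not_lt h hbest hlen hlt

/-! ### Adapting the queue -/

theorem firstMin_of_candidate {i : Fin K} {Q : List (Entry n)} {p : NodePath n}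
    (h : I.candidate i Q = some p) : I.firstMin i (Q.map Entry.path) = some p ∧
      ∃ e ∈ Q, e.popped = false ∧ e.path = p := by
  unfold candidate at h
  split at h
  · cases h
  · rename_i q hq
    split_ifs at h with hc
    obtain rfl := Option.some.inj h
    -- The filter discards exactly the popped paths, and the test has shown them to be strictly more
    -- expensive.
    refine ⟨firstMin_of_filter hq fun e he hk => hc e he (by simpa using hk), ?_⟩
    obtain ⟨e, he, rfl⟩ := List.mem_map.1 (mem_of_firstMin hq)
    obtain ⟨h1, h2⟩ := List.mem_filter.1 he
    exact ⟨e, h1, by simpa using h2, rfl⟩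

theorem adaptNode_spec {st : State n K} (h : I.QueueInv st) {v : Fin n}
    (hnone : ∀ e ∈ st.found v, e.prio = none) :
    I.QueueInv (I.adaptNode st.iteration st v).ret ∧
      (I.adaptNode st.iteration st v).ret.core = st.core ∧
      (I.adaptNode st.iteration st v).ret.iteration = st.iteration ∧
      (I.adaptNode st.iteration st v).ret.best = st.best ∧
      (∀ u ≠ v, (I.adaptNode st.iteration st v).ret.found u = st.found u) ∧
      (I.adaptNode st.iteration st v).time +
        (I.adaptNode st.iteration st v).ret.heap.potential ≤
        st.heap.potential + (5 + (st.core v).length * (W + 1)) := by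
  have hcl : (st.core v).length = (st.found v).length := by simp [State.core]
  have hcore : ∀ (f : Entry n → Option ℝ) (st' : State n K),
      st'.found = Function.update st.found v
        ((st.found v).map fun e => { e with prio := f e }) → st'.core = st.core := by
    intro f st' hf
    funext u
    unfold State.core
    rw [hf]
    by_cases huv : u = v
    · subst huv
      rw [Function.update_self, List.map_map]
      rfl
    · rw [Function.update_of_ne huv]
  have hpath : ∀ f : Entry n → Option ℝ,
      ((st.found v).map fun e => { e with prio := f e }).map Entry.path = st.pathsAt v := by
    intro f
    rw [List.map_map]
    rfl
  have hmem : ∀ x ∈ st.heap.items, x.head? ≠ some v := by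
    intro x hx hxv
    obtain ⟨e, he, -, hs⟩ := (h.mem_items_iff hxv).1 hx
    rw [hnone e he] at hs
    cases hs
  cases hc : I.candidate st.iteration (st.found v) with
  | none =>
    have hr : I.adaptNode st.iteration st v = ⟨{ st with
        found := Function.update st.found v ((st.found v).map fun e => { e with prio := none }) },
        1 + (st.found v).length * (W + 1) + 0⟩ := by
      unfold adaptNode
      simp only [hc]
      rfl
    rw [hr]
    refine ⟨h.update (Q := (st.found v).map fun e => { e with prio := none }) rfl rfl h.valid ?_
      h.key ?_ ?_ ?_, hcore _ _ rfl, rfl, rfl, fun u hu => Function.update_of_ne hu _ _, ?_⟩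
    · intro x
      constructor
      · exact fun hx => Or.inl ⟨hx, hmem x hx⟩
      · rintro (hx | ⟨e, he, -, hs⟩)
        · exact hx.1
        · obtain ⟨e', -, rfl⟩ := List.mem_map.1 he
          cases hs
    · rw [hpath]
      exact h.nodup v
    · intro e he
      obtain ⟨e', he', rfl⟩ := List.mem_map.1 he
      exact h.head v e' he'
    · intro e he hs
      obtain ⟨e', -, rfl⟩ := List.mem_map.1 he
      cases hs
    · simp only [hcl]
      omega
  | some p =>
    obtain ⟨hmin, e0, he0, hpop, rfl⟩ := firstMin_of_candidate hc
    have hhead := h.head v e0 he0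
    have hnot : e0.path ∉ st.heap.items := fun hx => hmem _ hx hhead
    obtain ⟨k1, k2, k3, k4⟩ := FibHeap.insert_spec h.valid hnot (I.cost st.iteration e0.path)
    set f : Entry n → Option ℝ :=
      fun e => if e.path = e0.path then some (I.cost st.iteration e0.path) else none with hf
    have hr : I.adaptNode st.iteration st v = ⟨{ st with
        found := Function.update st.found v ((st.found v).map fun e => { e with prio := f e })
        heap := (st.heap.insert e0.path (I.cost st.iteration e0.path)).ret },
        1 + (st.found v).length * (W + 1) +
          ((st.heap.insert e0.path (I.cost st.iteration e0.path)).time + 0)⟩ := by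
      unfold adaptNode
      simp only [hc]
      rfl
    have hinj : ∀ e ∈ st.found v, e.path = e0.path → e = e0 := fun e he heq =>
      List.inj_on_of_nodup_map (h.nodup v) he he0 heq
    rw [hr]
    refine ⟨h.update (Q := (st.found v).map fun e => { e with prio := f e }) rfl rfl k1 ?_
      ?_ ?_ ?_ ?_, hcore _ _ rfl, rfl, rfl, fun u hu => Function.update_of_ne hu _ _, ?_⟩
    · intro x
      simp only [k2]
      constructor
      · rintro (rfl | hx)
        · exact Or.inr ⟨_, List.mem_map_of_mem he0, rfl, by simp [hf]⟩
        · exact Or.inl ⟨hx, hmem x hx⟩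
      · rintro (hx | ⟨e, he, rfl, hs⟩)
        · exact Or.inr hx.1
        · obtain ⟨e', he', rfl⟩ := List.mem_map.1 he
          simp only [hf] at hs
          split_ifs at hs with heq
          · exact Or.inl heq
          · cases hs
    · intro x hx
      simp only at hx ⊢
      rw [k3]
      by_cases hxp : x = e0.path
      · rw [hxp, Function.update_self]
      · rw [Function.update_of_ne hxp]
        exact h.key x (((k2 x).1 hx).resolve_left hxp)
    · rw [hpath]
      exact h.nodup v
    · intro e he
      obtain ⟨e', he', rfl⟩ := List.mem_map.1 he
      exact h.head v e' he'
    · intro e he hs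
      obtain ⟨e', he', rfl⟩ := List.mem_map.1 he
      simp only [hf] at hs
      split_ifs at hs with heq
      · rw [hpath]
        obtain rfl := hinj e' he' heq
        exact ⟨hpop, hmin⟩
      · cases hs
    · simp only [hcl]
      omega

/-- With an empty heap all stored priorities are null, so the queue invariant holds for the new
coefficient vector before any node is adapted. The fresh heap has potential zero, hence no potential
enters the bound. -/
theorem adapt_spec {st : State n K} (h : I.QueueInv st) (hempty : st.heap.items = [])
    (i : Fin K) :
    I.QueueInv (I.adapt i st).ret ∧ (I.adapt i st).ret.core = st.core ∧
      (I.adapt i st).ret.iteration = i ∧ (I.adapt i st).ret.best = st.best ∧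
      (I.adapt i st).time + (I.adapt i st).ret.heap.potential ≤
        1 + ∑ v, (5 + (st.core v).length * (W + 1)) := by
  have hnone : ∀ v, ∀ e ∈ st.found v, e.prio = none := by
    intro v e he
    by_contra hp
    have := (h.items e.path).2 ⟨v, e, he, rfl, Option.isSome_iff_ne_none.2 hp⟩
    rw [hempty] at this
    simp at this
  set st0 : State n K := { st with iteration := i, heap := FibHeap.empty } with hst0
  have h0 : I.QueueInv st0 := by
    refine ⟨FibHeap.valid_empty, fun x => ?_, fun x hx => ?_, h.nodup, h.head, ?_⟩
    · simp only [hst0, FibHeap.items_empty, List.not_mem_nil, false_iff]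
      rintro ⟨v, e, he, -, hs⟩
      rw [hnone v e he] at hs
      cases hs
    · simp [hst0] at hx
    · intro v e he hs
      rw [hnone v e he] at hs
      cases hs
  have hfold := Timed.foldlM_induct (I.adaptNode i)
    (fun rest s t => I.QueueInv s ∧ s.core = st.core ∧ s.iteration = i ∧ s.best = st.best ∧
      (∀ v ∈ rest, ∀ e ∈ s.found v, e.prio = none) ∧ rest.Nodup ∧
      t + s.heap.potential + (rest.map fun v => 5 + (st.core v).length * (W + 1)).sum ≤
        ∑ v, (5 + (st.core v).length * (W + 1)))
    (by
      rintro v rest s t ⟨g1, g2, g3, g4, g5, g6, g7⟩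
      obtain ⟨k1, k2, k3, k4, k5, k6⟩ := adaptNode_spec g1 (g5 v (by simp))
      rw [g3] at k1 k2 k3 k4 k5 k6
      rw [List.nodup_cons] at g6
      refine ⟨k1, k2.trans g2, k3, k4.trans g4, fun u hu e he => ?_, g6.2, ?_⟩
      · rw [k5 u fun huv => g6.1 (huv ▸ hu)] at he
        exact g5 u (by simp [hu]) e he
      · rw [List.map_cons, List.sum_cons] at g7
        rw [g2] at k6
        omega) (List.finRange n) st0 0
    ⟨h0, rfl, rfl, rfl, fun v _ => hnone v, List.nodup_finRange n, by
      simp only [hst0, FibHeap.potential_empty, zero_add]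
      rw [Fin.sum_univ_def]⟩
  obtain ⟨g1, g2, g3, g4, -, -, g7⟩ := hfold
  refine ⟨g1, g2, g3, g4, ?_⟩
  have ht : (I.adapt i st).time = 1 + ((List.finRange n).foldlM (I.adaptNode i) st0).time := rfl
  have hr : (I.adapt i st).ret = ((List.finRange n).foldlM (I.adaptNode i) st0).ret := rfl
  rw [ht, hr]
  simp only [List.map_nil, List.sum_nil] at g7
  omega

end MOWSP

/-! ### The run of the algorithm -/

namespace MOWSP

variable {n W K : ℕ} (I : MOWSP n W K)

/-- At most `N` paths to any node in `L` are not dominated by the sample path to this node. -/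
structure Sparse (sample : Fin n → NodePath n) (L : Finset (Fin n)) (N : ℕ) : Prop where
  card_le : ∀ v ∈ L, ∀ T : Finset (NodePath n),
    (∀ q ∈ T, q ∈ I.paths I.source v ∧ ¬ Dominates (I.vec (sample v)) (I.vec q)) → T.card ≤ N
  le : (N : ℝ) ≤ (K : ℝ) / W

/-- The members of a set of paths that end in `v`. -/
def pathsTo (v : Fin n) (D : Finset (NodePath n)) : Finset (NodePath n) :=
  D.filter fun q => q.head? = some v

/-- The invariant of the main loop.  `D` is the set of the paths that were popped, `S` the set of
the scanned paths that are not dominated by the Pareto sample, and `Z` the set of the end nodes of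
the paths that were popped in the current iteration, whose costs are at most `level`. -/
structure RunInv (sample : Fin n → NodePath n) (L : Finset (Fin n)) (st : State n K)
    (D S : Finset (NodePath n)) (Z : Finset (Fin n)) (level : ℝ) : Prop where
  queue : I.QueueInv st
  level_le : ∀ x ∈ st.heap.items, level ≤ I.cost st.iteration x
  mem : ∀ v, ∀ c ∈ st.core v, c.1 ∈ S ∧ (c.2 = true ↔ c.1 ∈ D)
  best : ∀ v b, st.best v = some b → v ∉ L ∧ ∀ j, b j = I.firstMin j (st.pathsAt v)
  length : ∀ v ∉ L, (st.core v).length ≤ K + 1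
  settled : ∀ v ∈ Z, ∃ q, I.firstMin st.iteration (st.pathsAt v) = some q ∧ q ∈ D ∧
    I.cost st.iteration q ≤ level
  card : ∀ v, (pathsTo v D).card ≤ st.iteration.val + if v ∈ Z then 1 else 0
  sub : D ⊆ S
  path : ∀ q ∈ S, I.IsPathFrom I.source q
  undominated : ∀ q ∈ S, ∀ v, q.head? = some v → ¬ Dominates (I.vec (sample v)) (I.vec q)
  parent : ∀ v r, v :: r ∈ S → r = [] ∨ r ∈ D

/-- A bound for the number of paths to `v` that are known at any time. -/
def knownBound (K N : ℕ) (L : Finset (Fin n)) (v : Fin n) : ℕ := if v ∈ L then N else K + 1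

/-- A bound for the time of pushing a path if `q` paths are known. -/
def pushCost (n W q : ℕ) : ℕ := 1 + W + q * (W + 2) + heapCost n + 4

/-- A bound for the amortized time spent on a path to `v` after it was compared to the sample. -/
def nodeCost (W K N : ℕ) (L : Finset (Fin n)) (v : Fin n) : ℕ :=
  relevanceCost n W (knownBound K N L v) + pushCost n W (knownBound K N L v) +
    if v ∈ L then 0 else K * W + 2 * K

/-- The sum of a function of the end node over a set of paths. -/
def endSum (f : Fin n → ℕ) (S : Finset (NodePath n)) : ℕ :=
  ∑ q ∈ S, ∑ v, if q.head? = some v then f v else 0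

/-- The time that is set aside for computing the arrays of best paths. -/
def pendingSum (W : ℕ) (L : Finset (Fin n)) (st : State n K) : ℕ :=
  ∑ v ∈ Lᶜ, pending W (st.best v)

theorem endSum_insert (f : Fin n → ℕ) {S : Finset (NodePath n)} {q : NodePath n} {v : Fin n}
    (hq : q.head? = some v) (hS : q ∉ S) : endSum f (insert q S) = endSum f S + f v := by
  unfold endSum
  rw [Finset.sum_insert hS, add_comm, hq]
  congr 1
  simp

theorem endSum_eq (f : Fin n → ℕ) (S : Finset (NodePath n)) :
    endSum f S = ∑ v, (pathsTo v S).card * f v := by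
  unfold endSum pathsTo
  rw [Finset.sum_comm]
  refine Finset.sum_congr rfl fun v _ => ?_
  rw [← Finset.sum_filter, Finset.sum_const, smul_eq_mul]

theorem relevanceCost_mono {q q' : ℕ} (h : q ≤ q') :
    relevanceCost n W q ≤ relevanceCost n W q' := by
  have := Nat.mul_le_mul_right W h
  unfold relevanceCost
  omega

theorem pushCost_mono {q q' : ℕ} (h : q ≤ q') : pushCost n W q ≤ pushCost n W q' := by
  have := Nat.mul_le_mul_right (W + 2) h
  unfold pushCost
  omega

theorem pathsAt_eq_of_core_eq {st st' : State n K} (h : st'.core = st.core) (v : Fin n) :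
    st'.pathsAt v = st.pathsAt v := by
  rw [← st'.map_fst_core, h, st.map_fst_core]

variable {I} {sample : Fin n → NodePath n} {L : Finset (Fin n)} {N : ℕ}

theorem length_core (st : State n K) (v : Fin n) : (st.core v).length = (st.found v).length := by
  simp [State.core]

namespace RunInv

variable {st : State n K} {D S : Finset (NodePath n)} {Z : Finset (Fin n)} {level : ℝ}

theorem mem_of_pathsAt (h : I.RunInv sample L st D S Z level) {v : Fin n} {q : NodePath n}
    (hq : q ∈ st.pathsAt v) : q ∈ pathsTo v S := by
  obtain ⟨e, he, rfl⟩ := List.mem_map.1 hq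
  exact Finset.mem_filter.2
    ⟨(h.mem v e.core (List.mem_map_of_mem he)).1, h.queue.head v e he⟩

/-- `S` contains every undominated path scanned so far, including those pruned since, so this bounds
the total work at a node of `L` and not just its current list. -/
theorem card_paths_le (h : I.RunInv sample L st D S Z level) (hN : I.Sparse sample L N)
    {v : Fin n} (hv : v ∈ L) : (pathsTo v S).card ≤ N := by
  refine hN.card_le v hv _ fun q hq => ?_
  obtain ⟨h1, h2⟩ := Finset.mem_filter.1 hq
  exact ⟨⟨h.path q h1, h2⟩, h.undominated q h1 v h2⟩

theorem length_eq_card (h : I.RunInv sample L st D S Z level) (v : Fin n) :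
    (st.found v).length = (st.pathsAt v).toFinset.card := by
  rw [List.toFinset_card_of_nodup (h.queue.nodup v)]
  simp [State.pathsAt]

theorem length_le (h : I.RunInv sample L st D S Z level) (hN : I.Sparse sample L N) (v : Fin n) :
    (st.found v).length ≤ knownBound K N L v := by
  unfold knownBound
  split_ifs with hv
  · rw [h.length_eq_card]
    refine (Finset.card_le_card fun q hq => ?_).trans (h.card_paths_le hN hv)
    exact h.mem_of_pathsAt (List.mem_toFinset.1 hq)
  · rw [← length_core]
    exact h.length v hv

/-- The new path may be entered into `S` before the state changes, so that the count for `S` already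
includes it when the relevance check is analysed. -/
theorem insert_path (h : I.RunInv sample L st D S Z level) {u v : Fin n} {p : NodePath n}
    (hp : p ∈ D) (hpv : p.head? = some v) (he : (v, u) ∈ I.edges)
    (hdom : ¬ Dominates (I.vec (sample u)) (I.vec (u :: p))) :
    I.RunInv sample L st D (insert (u :: p) S) Z level where
  queue := h.queue
  level_le := h.level_le
  mem := fun w c hc => ⟨Finset.mem_insert_of_mem (h.mem w c hc).1, (h.mem w c hc).2⟩
  best := h.best
  length := h.length
  settled := h.settled
  card := h.card
  sub := h.sub.trans (Finset.subset_insert _ _)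
  path := fun q hq => by
    rcases Finset.mem_insert.1 hq with rfl | hq
    · exact (I.cons_mem_paths ⟨h.path p (h.sub hp), hpv⟩ he).1
    · exact h.path q hq
  undominated := fun q hq w hw => by
    rcases Finset.mem_insert.1 hq with rfl | hq
    · obtain rfl : u = w := by simpa using hw
      exact hdom
    · exact h.undominated q hq w hw
  parent := fun w r hr => by
    rcases Finset.mem_insert.1 hr with hr | hr
    · obtain ⟨rfl, rfl⟩ := List.cons.inj hr
      exact Or.inr hp
    · exact h.parent w r hr

end RunInv

theorem pendingSum_eq_of_mem {st st' : State n K} {u : Fin n} (hu : u ∈ L)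
    (h : ∀ v ≠ u, st'.best v = st.best v) : pendingSum W L st' = pendingSum W L st := by
  refine Finset.sum_congr rfl fun v hv => ?_
  rw [h v]
  rintro rfl
  exact Finset.mem_compl.1 hv hu

/-- The additive form avoids truncated subtraction when the reserve of a single node is released. -/
theorem pendingSum_add_of_notMem {st st' : State n K} {u : Fin n} (hu : u ∉ L)
    (h : ∀ v ≠ u, st'.best v = st.best v) :
    pendingSum W L st' + pending W (st.best u) = pendingSum W L st + pending W (st'.best u) := by
  unfold pendingSum
  have hu' : u ∈ Lᶜ := Finset.mem_compl.2 hu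
  rw [← Finset.add_sum_erase _ _ hu', ← Finset.add_sum_erase _ (fun v => pending W (st.best v)) hu',
    Finset.sum_congr rfl fun v hv => by rw [h v (Finset.ne_of_mem_erase hv)]]
  omega

/-- The effect of scanning a path that is not dominated by the Pareto sample. -/
theorem scan_undominated {st : State n K} {D S : Finset (NodePath n)} {Z : Finset (Fin n)}
    {level : ℝ} (h : I.RunInv sample L st D S Z level) (hN : I.Sparse sample L N)
    {u v : Fin n} {p : NodePath n} (hp : p ∈ D) (hpv : p.head? = some v) (he : (v, u) ∈ I.edges)
    (hlev : level ≤ I.cost st.iteration p) (hnew : u :: p ∉ S)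
    (hdom : ¬ Dominates (I.vec (sample u)) (I.vec (u :: p))) {r : Timed (State n K)}
    (hr : r = do
      let r ← I.isRelevant u (u :: p) st
      if r.1 then I.push u (u :: p) r.2 else pure r.2) :
    I.RunInv sample L r.ret D (insert (u :: p) S) Z level ∧ r.ret.iteration = st.iteration ∧
      r.time + r.ret.heap.potential + pendingSum W L r.ret ≤
        st.heap.potential + pendingSum W L st + nodeCost W K N L u := by
  have hpaths : u :: p ∉ st.pathsAt u := fun hc =>
    hnew (Finset.mem_filter.1 (h.mem_of_pathsAt hc)).1
  have hS := h.insert_path hp hpv he hdom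
  have hlen := h.length_le hN u
  have hbest := fun b hb => (h.best u b hb).2
  have hq : (st.found u).length ≤ K + 1 := by
    by_cases hu : u ∈ L
    · have h1 : (N : ℝ) ≤ K := hN.le.trans
        (div_le_self (Nat.cast_nonneg K) (by exact_mod_cast I.W_pos))
      have h2 : N ≤ K := by exact_mod_cast h1
      simp only [knownBound, hu, if_true] at hlen
      omega
    · simpa only [knownBound, hu, if_false] using hlen
  have hspec := isRelevant_spec h.queue (u :: p) hbest hq
  have hbestL : u ∈ L → (I.isRelevant u (u :: p) st).ret.2.best u = none ∧
      (I.isRelevant u (u :: p) st).time + (I.isRelevant u (u :: p) st).ret.2.heap.potential ≤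
        st.heap.potential + relevanceCost n W (st.found u).length := by
    intro hu
    refine hspec.time_of_lt ?_ ?_
    -- The path being scanned is itself one of the at most `N` undominated ones. This extra one
    -- gives the strict inequality that selects the first branch of the relevance check.
    · have h1 : (st.found u).length + 1 ≤ N := by
        rw [h.length_eq_card, ← Finset.card_insert_of_notMem (a := u :: p)
          (fun hc => hpaths (List.mem_toFinset.1 hc))]
        refine (Finset.card_le_card fun q hq => ?_).trans (hS.card_paths_le hN hu)
        rcases Finset.mem_insert.1 hq with rfl | hq
        · exact Finset.mem_filter.2 ⟨Finset.mem_insert_self _ _, rfl⟩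
        · exact hS.mem_of_pathsAt (List.mem_toFinset.1 hq)
      have h2 : ((st.found u).length : ℝ) + 1 ≤ N := by exact_mod_cast h1
      have := hN.le
      linarith
    · by_contra hb
      obtain ⟨b, hb⟩ := Option.ne_none_iff_exists'.1 hb
      exact (h.best u b hb).1 hu
  have htime : (I.isRelevant u (u :: p) st).time +
      (I.isRelevant u (u :: p) st).ret.2.heap.potential +
      pendingSum W L (I.isRelevant u (u :: p) st).ret.2 ≤
        st.heap.potential + pendingSum W L st + (relevanceCost n W (knownBound K N L u) +
          if u ∈ L then 0 else K * W + 2 * K) := by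
    have h1 := relevanceCost_mono (n := n) (W := W) hlen
    by_cases hu : u ∈ L
    · have h2 := (hbestL hu).2
      rw [pendingSum_eq_of_mem hu hspec.best_of_ne]
      simp only [hu, if_true]
      omega
    · have h2 := hspec.time
      have h3 := pendingSum_add_of_notMem (W := W) hu hspec.best_of_ne
      simp only [hu, if_false]
      omega
  set rel := I.isRelevant u (u :: p) st
  have hitems : ∀ x ∈ rel.ret.2.heap.items, level ≤ I.cost rel.ret.2.iteration x := by
    intro x hx
    rw [hspec.iteration]
    exact h.level_le x (hspec.items x hx)
  cases hb : rel.ret.1 with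
  | false =>
    have hr' : r = ⟨rel.ret.2, rel.time + 0⟩ := by
      rw [hr, Timed.bind_eq]
      simp only [hb]
      rfl
    obtain ⟨hcore, hbest'⟩ := hspec.dropped hb
    have hpa := pathsAt_eq_of_core_eq hcore
    rw [hr']
    refine ⟨⟨hspec.inv, hitems, ?_, ?_, ?_, ?_, ?_, hS.sub, hS.path, hS.undominated, hS.parent⟩,
      hspec.iteration, ?_⟩
    · rw [hcore]
      exact hS.mem
    · intro w b hwb
      by_cases hwu : w = u
      · subst hwu
        refine ⟨fun hw => ?_, fun j => ?_⟩
        · rw [(hbestL hw).1] at hwb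
          cases hwb
        · rw [hpa]
          exact hbest' b hwb j
      · simp only [hspec.best_of_ne w hwu] at hwb
        rw [hpa]
        exact h.best w b hwb
    · rw [hcore]
      exact h.length
    · simp only [hspec.iteration, hpa]
      exact h.settled
    · simp only [hspec.iteration]
      exact h.card
    · unfold nodeCost
      simp only
      omega
  | true =>
    have hr' : r = ⟨(I.push u (u :: p) rel.ret.2).ret,
        rel.time + (I.push u (u :: p) rel.ret.2).time⟩ := by
      rw [hr, Timed.bind_eq]
      simp only [hb, if_true]
    obtain ⟨keep, hcore, hkeep, hbest', hlen'⟩ := hspec.relevant hb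
    have hcu : rel.ret.2.core u = (st.core u).filter fun c => keep c.1 := by
      rw [hcore, Function.update_self]
    have hnew' : u :: p ∉ rel.ret.2.pathsAt u := by
      rw [← State.map_fst_core, hcu]
      intro hc
      obtain ⟨c, hc, hcp⟩ := List.mem_map.1 hc
      refine hpaths ?_
      rw [← State.map_fst_core, ← hcp]
      exact List.mem_map_of_mem (List.mem_filter.1 hc).1
    obtain ⟨g1, g2, g3, g4, g5, g6⟩ := push_spec hspec.inv (p := u :: p) (v := u) rfl hnew'
    rw [hcu] at g2
    set pu := I.push u (u :: p) rel.ret.2 with hpu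
    have hit : pu.ret.iteration = st.iteration := g3.trans hspec.iteration
    have hcore_ne : ∀ w ≠ u, pu.ret.core w = st.core w := by
      intro w hw
      rw [g2, Function.update_of_ne hw, hcore, Function.update_of_ne hw]
    have hpa_ne : ∀ w ≠ u, pu.ret.pathsAt w = st.pathsAt w := by
      intro w hw
      rw [← State.map_fst_core, hcore_ne w hw, State.map_fst_core]
    have hcore_u : pu.ret.core u =
        ((st.core u).filter fun c => keep c.1) ++ [(u :: p, false)] := by
      rw [g2, Function.update_self]
    have hpa_u : pu.ret.pathsAt u =
        ((st.core u).filter fun c => keep c.1).map Prod.fst ++ [u :: p] := by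
      rw [← State.map_fst_core, hcore_u, List.map_append]
      rfl
    have hnewD : u :: p ∉ D := fun hc => hnew (h.sub hc)
    rw [hr']
    refine ⟨⟨g1, ?_, ?_, ?_, ?_, ?_, ?_, hS.sub, hS.path, hS.undominated, hS.parent⟩, hit, ?_⟩
    · intro x hx
      rcases g5 x hx with rfl | hx
      · simp only [hit]
        exact hlev.trans (I.cost_le_cons _ hpv he)
      · have := hitems x hx
        rw [hspec.iteration] at this
        simpa only [hit] using this
    · intro w c hc
      by_cases hwu : w = u
      · subst hwu
        simp only [hcore_u] at hc
        rcases List.mem_append.1 hc with hc | hc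
        · exact hS.mem w c (List.mem_filter.1 hc).1
        · rw [List.mem_singleton.1 hc]
          exact ⟨Finset.mem_insert_self _ _, by simp [hnewD]⟩
      · simp only [hcore_ne w hwu] at hc
        exact hS.mem w c hc
    · intro w b hwb
      simp only [g4] at hwb
      by_cases hwu : w = u
      · subst hwu
        refine ⟨fun hw => ?_, fun j => ?_⟩
        · rw [(hbestL hw).1] at hwb
          cases hwb
        · simp only [hpa_u]
          exact hbest' b hwb j
      · simp only [hspec.best_of_ne w hwu] at hwb
        simp only [hpa_ne w hwu]
        exact h.best w b hwb
    · intro w hw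
      by_cases hwu : w = u
      · subst hwu
        simp only [hcore_u, List.length_append, List.length_singleton]
        omega
      · simp only [hcore_ne w hwu]
        exact h.length w hw
    · intro w hw
      obtain ⟨q, hq1, hq2, hq3⟩ := h.settled w hw
      refine ⟨q, ?_, hq2, by simpa only [hit] using hq3⟩
      by_cases hwu : w = u
      · subst hwu
        simp only [hit, hpa_u]
        rw [← State.map_fst_core] at hq1
        rw [firstMin_filter_append (g := Prod.fst) (keep := fun c => keep c.1), hq1]
        -- The settled path costs at most `level`, and the new path extends one of cost at least
        -- `level`, so it cannot be strictly cheaper. This is what forbids a second pop at `w` in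
        -- the same iteration.
        · have : I.cost st.iteration q ≤ I.cost st.iteration (w :: p) :=
            hq3.trans (hlev.trans (I.cost_le_cons _ hpv he))
          simp only [not_lt.2 this, if_false]
        · intro c _ hc hkc
          rw [State.map_fst_core] at hc
          exact hkeep _ c.1 hc hkc
      · simpa only [hit, hpa_ne w hwu] using hq1
    · simp only [hit]
      exact h.card
    · have h1 : (rel.ret.2.found u).length ≤ knownBound K N L u := by
        rw [← length_core, hcu]
        refine (List.length_filter_le _ _).trans ?_
        rwa [length_core]
      have h2 := pushCost_mono (n := n) (W := W) h1
      have h3 : pendingSum W L pu.ret = pendingSum W L rel.ret.2 := by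
        unfold pendingSum
        rw [g4]
      simp only [h3]
      unfold nodeCost
      unfold pushCost at h2 ⊢
      omega

/-- The growth of `endSum` acts as a credit: costs beyond the comparison with the sample are charged
to the path that newly enters `S`, and a dominated extension leaves `S` as it is. -/
theorem scan_spec {st : State n K} {D S : Finset (NodePath n)} {Z : Finset (Fin n)}
    {level : ℝ} (h : I.RunInv sample L st D S Z level) (hN : I.Sparse sample L N)
    {u v : Fin n} {p : NodePath n} (hp : p ∈ D) (hpv : p.head? = some v) (he : (v, u) ∈ I.edges)
    (hlev : level ≤ I.cost st.iteration p) (hnew : u :: p ∉ S) :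
    ∃ S', I.RunInv sample L (I.scan sample p st u).ret D S' Z level ∧
      (I.scan sample p st u).ret.iteration = st.iteration ∧ S' ⊆ insert (u :: p) S ∧
      (I.scan sample p st u).time + (I.scan sample p st u).ret.heap.potential +
        pendingSum W L (I.scan sample p st u).ret + endSum (nodeCost W K N L) S ≤
        st.heap.potential + pendingSum W L st + endSum (nodeCost W K N L) S' + (1 + 2 * W) := by
  by_cases hdom : Dominates (I.vec (sample u)) (I.vec (u :: p))
  · have hr : I.scan sample p st u = ⟨st, 1 + 2 * W + 0⟩ := by
      unfold scan
      simp only [hdom, if_true]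
      rfl
    rw [hr]
    exact ⟨S, h, rfl, Finset.subset_insert _ _, by simp only; omega⟩
  · obtain ⟨h1, h2, h3⟩ := scan_undominated h hN hp hpv he hlev hnew hdom rfl
    set r : Timed (State n K) := (do
      let r ← I.isRelevant u (u :: p) st
      if r.1 then I.push u (u :: p) r.2 else pure r.2) with hrdef
    have hr : I.scan sample p st u = ⟨r.ret, 1 + 2 * W + r.time⟩ := by
      unfold scan
      simp only [hdom, if_false]
      rfl
    rw [hr]
    refine ⟨_, h1, h2, subset_rfl, ?_⟩
    rw [endSum_insert (nodeCost W K N L) (v := u) rfl hnew]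
    simp only
    omega

end MOWSP

/-! ### The main loop -/

namespace MOWSP

variable {n W K : ℕ} {I : MOWSP n W K} {sample : Fin n → NodePath n} {L : Finset (Fin n)} {N : ℕ}

/-- A bound for the amortized time of popping and developing a path, without scanning those
extensions that are not dominated by the sample. -/
def popCost (n W Δ : ℕ) : ℕ := 2 + heapCost n + Δ * (1 + 2 * W)

/-- A bound for the time of adapting the queue. -/
def adaptCost (W K N : ℕ) (L : Finset (Fin n)) : ℕ :=
  3 + ∑ v, (5 + knownBound K N L v * (W + 1))

/-- A bound for the time of building the sets of optimal paths. -/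
def buildCost (W K N : ℕ) (L : Finset (Fin n)) : ℕ :=
  2 + K * (1 + ∑ v, (1 + knownBound K N L v * (W + 1)))

/-- Popping a path. -/
theorem RunInv.pop {st : State n K} {D S : Finset (NodePath n)} {Z : Finset (Fin n)}
    {level : ℝ} (h : I.RunInv sample L st D S Z level) {x : NodePath n} {v : Fin n}
    {hp : FibHeap (NodePath n)} (hx : x ∈ st.heap.items) (hxv : x.head? = some v)
    (hmin : ∀ y ∈ st.heap.items, st.heap.key x ≤ st.heap.key y) (hvalid : hp.Valid)
    (hitems : ∀ y, y ∈ hp.items ↔ y ∈ st.heap.items ∧ y ≠ x) (hkey : hp.key = st.heap.key) :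
    I.RunInv sample L (markPopped v x { st with heap := hp }) (insert x D) S (insert v Z)
      (I.cost st.iteration x) ∧ x ∉ D := by
  obtain ⟨e, he, rfl, hs⟩ := (h.queue.mem_items_iff hxv).1 hx
  obtain ⟨hpop, hfirst⟩ := h.queue.prio v e he hs
  have hec := h.mem v e.core (List.mem_map_of_mem he)
  -- A path with a priority is not flagged as popped, and the flags of stored paths record
  -- membership in `D`.
  have hxD : e.path ∉ D := fun hc => by
    have := hec.2.2 hc
    rw [Entry.core, hpop] at this
    cases this
  have hlx : level ≤ I.cost st.iteration e.path := h.level_le _ hx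
  set st' := markPopped v e.path { st with heap := hp } with hst'
  set Q : List (Entry n) := (st.found v).map fun e' =>
    if e'.path = e.path then { e' with popped := true, prio := none } else e' with hQ
  have hf : st'.found = Function.update st.found v Q := rfl
  have hQpath : Q.map Entry.path = st.pathsAt v := by
    rw [hQ, List.map_map]
    refine List.map_congr_left fun e' _ => ?_
    simp only [Function.comp]
    split_ifs <;> rfl
  have hQprio : ∀ e' ∈ Q, e'.prio.isSome = true → e' ∈ st.found v ∧ e'.path ≠ e.path := by
    intro e' he' hs'
    obtain ⟨e'', he'', rfl⟩ := List.mem_map.1 he'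
    by_cases heq : e''.path = e.path
    · simp [heq] at hs'
    · simp only [heq, if_false]
      exact ⟨he'', heq⟩
  have hkeep : ∀ e' ∈ st.found v, e'.path ≠ e.path → e' ∈ Q := by
    intro e' he' hne
    refine List.mem_map.2 ⟨e', he', ?_⟩
    simp only [hne, if_false]
  have hqueue : I.QueueInv st' := by
    refine h.queue.update (Q := Q) rfl hf hvalid ?_ ?_ ?_ ?_ ?_
    · intro y
      change y ∈ hp.items ↔ _
      rw [hitems]
      constructor
      · rintro ⟨hy, hne⟩
        by_cases hyv : y.head? = some v
        · obtain ⟨e', he', rfl, hs'⟩ := (h.queue.mem_items_iff hyv).1 hy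
          exact Or.inr ⟨e', hkeep e' he' hne, rfl, hs'⟩
        · exact Or.inl ⟨hy, hyv⟩
      · rintro (⟨hy, hyv⟩ | ⟨e', he', rfl, hs'⟩)
        · exact ⟨hy, fun hc => hyv (hc ▸ hxv)⟩
        · obtain ⟨h1, h2⟩ := hQprio e' he' hs'
          exact ⟨(h.queue.items _).2 ⟨v, e', h1, rfl, hs'⟩, h2⟩
    · intro y hy
      change hp.key y = _
      rw [hkey]
      exact h.queue.key y ((hitems y).1 hy).1
    · rw [hQpath]
      exact h.queue.nodup v
    · intro e' he'
      have : e'.path ∈ Q.map Entry.path := List.mem_map_of_mem he'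
      rw [hQpath] at this
      exact (Finset.mem_filter.1 (h.mem_of_pathsAt this)).2
    · intro e' he' hs'
      obtain ⟨h1, h2⟩ := hQprio e' he' hs'
      rw [hQpath]
      exact h.queue.prio v e' h1 hs'
  have hpa : ∀ w, st'.pathsAt w = st.pathsAt w := by
    intro w
    by_cases hwv : w = v
    · subst hwv
      unfold State.pathsAt at hQpath ⊢
      rw [hf, Function.update_self, hQpath]
    · unfold State.pathsAt
      rw [hf, Function.update_of_ne hwv]
  have hclen : ∀ w, (st'.core w).length = (st.core w).length := by
    intro w
    rw [← List.length_map (f := Prod.fst), ← List.length_map (as := st.core w) (f := Prod.fst),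
      State.map_fst_core, State.map_fst_core, hpa]
  refine ⟨⟨hqueue, ?_, ?_, ?_, ?_, ?_, ?_, ?_, h.path, h.undominated, ?_⟩, hxD⟩
  · intro y hy
    have hy' := ((hitems y).1 hy).1
    have h1 := hmin y hy'
    rw [h.queue.key _ hx, h.queue.key _ hy'] at h1
    exact h1
  · intro w c hc
    by_cases hwv : w = v
    · subst hwv
      rw [State.core, hf, Function.update_self] at hc
      obtain ⟨e', he', rfl⟩ := List.mem_map.1 hc
      obtain ⟨e'', he'', rfl⟩ := List.mem_map.1 he'
      have h1 := h.mem w e''.core (List.mem_map_of_mem he'')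
      by_cases heq : e''.path = e.path
      · simp only [heq, if_true, Entry.core]
        exact ⟨hec.1, by simp⟩
      · simp only [heq, if_false]
        refine ⟨h1.1, ?_⟩
        rw [h1.2, Finset.mem_insert]
        constructor
        · exact Or.inr
        · rintro (hc | hc)
          · exact absurd hc heq
          · exact hc
    · rw [State.core, hf, Function.update_of_ne hwv] at hc
      have h1 := h.mem w c hc
      refine ⟨h1.1, ?_⟩
      rw [h1.2, Finset.mem_insert]
      constructor
      · exact Or.inr
      · rintro (heq | hc')
        · obtain ⟨e', he', rfl⟩ := List.mem_map.1 hc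
          have h2 := h.queue.head w e' he'
          change e'.path = e.path at heq
          rw [heq, hxv] at h2
          exact absurd (Option.some.inj h2).symm hwv
        · exact hc'
  · intro w b hb
    rw [hpa]
    exact h.best w b hb
  · intro w hw
    rw [hclen]
    exact h.length w hw
  · intro w hw
    rw [hpa]
    change ∃ q, I.firstMin st.iteration (st.pathsAt w) = some q ∧ _ ∧
      I.cost st.iteration q ≤ _
    rcases Finset.mem_insert.1 hw with rfl | hw
    · exact ⟨e.path, hfirst, Finset.mem_insert_self _ _, le_rfl⟩
    · obtain ⟨q, h1, h2, h3⟩ := h.settled w hw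
      exact ⟨q, h1, Finset.mem_insert_of_mem h2, h3.trans hlx⟩
  · intro w
    change _ ≤ st.iteration.val + _
    have h1 := h.card w
    unfold pathsTo at *
    rw [Finset.filter_insert]
    by_cases hwv : w = v
    · subst hwv
      -- If `w` had been settled in this iteration, its first minimum would lie in `D`; but that
      -- minimum is the path just extracted, which does not.
      have hwZ : w ∉ Z := by
        intro hc
        obtain ⟨q, h1, h2, -⟩ := h.settled w hc
        rw [hfirst] at h1
        exact hxD (Option.some.inj h1 ▸ h2)
      simp only [hwZ, if_false, add_zero] at h1
      simp only [hxv, if_true, Finset.mem_insert_self]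
      exact (Finset.card_insert_le _ _).trans (Nat.add_le_add_right h1 1)
    · have : ¬ e.path.head? = some w := by
        rw [hxv]
        simpa using Ne.symm hwv
      simp only [this, if_false]
      refine h1.trans ?_
      simp [Finset.mem_insert, hwv]
  · exact Finset.insert_subset hec.1 h.sub
  · intro w r hr
    exact (h.parent w r hr).imp_right fun hr => Finset.mem_insert_of_mem hr

/-- Developing a path that has just been popped. -/
theorem develop_spec {st : State n K} {D S : Finset (NodePath n)} {Z : Finset (Fin n)}
    {v : Fin n} {p : NodePath n}
    (h : I.RunInv sample L st D S Z (I.cost st.iteration (v :: p))) (hN : I.Sparse sample L N)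
    (hp : v :: p ∈ D) (hnew : ∀ u, u :: v :: p ∉ S) :
    ∃ S', I.RunInv sample L ((I.neighbors v).foldlM (I.scan sample (v :: p)) st).ret D S' Z
        (I.cost st.iteration (v :: p)) ∧
      ((I.neighbors v).foldlM (I.scan sample (v :: p)) st).ret.iteration = st.iteration ∧
      ((I.neighbors v).foldlM (I.scan sample (v :: p)) st).time +
        ((I.neighbors v).foldlM (I.scan sample (v :: p)) st).ret.heap.potential +
        pendingSum W L ((I.neighbors v).foldlM (I.scan sample (v :: p)) st).ret +
        endSum (nodeCost W K N L) S ≤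
        st.heap.potential + pendingSum W L st + endSum (nodeCost W K N L) S' +
          I.outDegree v * (1 + 2 * W) := by
  have hfold := Timed.foldlM_induct (I.scan sample (v :: p))
    (fun rest s t => ∃ S', I.RunInv sample L s D S' Z (I.cost st.iteration (v :: p)) ∧
      s.iteration = st.iteration ∧ (∀ u ∈ rest, u :: v :: p ∉ S') ∧ rest.Nodup ∧
      (∀ u ∈ rest, (v, u) ∈ I.edges) ∧
      t + s.heap.potential + pendingSum W L s + endSum (nodeCost W K N L) S +
        rest.length * (1 + 2 * W) ≤
        st.heap.potential + pendingSum W L st + endSum (nodeCost W K N L) S' +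
          (I.neighbors v).length * (1 + 2 * W))
    (by
      rintro u rest s t ⟨S', g1, g2, g3, g4, g5, g6⟩
      obtain ⟨S'', k1, k2, k3, k4⟩ := scan_spec g1 hN hp rfl (g5 u (by simp)) (by rw [g2])
        (g3 u (by simp))
      rw [List.nodup_cons] at g4
      refine ⟨S'', k1, k2.trans g2, fun w hw hc => ?_, g4.2, fun w hw => g5 w (by simp [hw]), ?_⟩
      · rcases Finset.mem_insert.1 (k3 hc) with heq | hc
        · obtain rfl := (List.cons.inj heq).1
          exact g4.1 hw
        · exact g3 w (by simp [hw]) hc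
      · rw [List.length_cons, add_mul] at g6
        omega) (I.neighbors v) st 0
    ⟨S, h, rfl, fun u _ => hnew u, I.nodup_neighbors v, fun u hu => I.mem_neighbors.1 hu,
      by omega⟩
  obtain ⟨S', g1, g2, -, -, -, g6⟩ := hfold
  refine ⟨S', g1, g2, ?_⟩
  rw [I.length_neighbors] at g6
  simp only [List.length_nil] at g6
  omega

/-- Emptying `Z` costs nothing in the count of popped paths, as the extra one per settled node is
covered by the larger iteration index. The level can restart at zero because costs are non-negative.
-/
theorem adapt_runInv {st : State n K} {D S : Finset (NodePath n)} {Z : Finset (Fin n)}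
    {level : ℝ} (h : I.RunInv sample L st D S Z level) (hN : I.Sparse sample L N)
    (hempty : st.heap.items = []) {i : Fin K} (hi : i.val = st.iteration.val + 1) :
    I.RunInv sample L (I.adapt i st).ret D S ∅ 0 ∧ (I.adapt i st).ret.iteration = i ∧
      2 + (I.adapt i st).time + (I.adapt i st).ret.heap.potential +
        pendingSum W L (I.adapt i st).ret ≤ pendingSum W L st + adaptCost W K N L := by
  obtain ⟨h1, h2, h3, h4, h5⟩ := adapt_spec h.queue hempty i
  have hpa := pathsAt_eq_of_core_eq h2
  refine ⟨⟨h1, ?_, ?_, ?_, ?_, by simp, ?_, h.sub, h.path, h.undominated, h.parent⟩, h3, ?_⟩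
  · intro x hx
    obtain ⟨v, e, he, rfl, -⟩ := (h1.items x).1 hx
    have h6 : e.path ∈ st.pathsAt v := by
      rw [← hpa]
      exact List.mem_map_of_mem he
    have h7 := h.path _ (Finset.mem_filter.1 (h.mem_of_pathsAt h6)).1
    exact Finset.sum_nonneg fun j _ =>
      mul_nonneg (I.coeff_pos _ j).le (I.vec_nonneg h7 j)
  · rw [h2]
    exact h.mem
  · intro v b hb
    rw [h4] at hb
    rw [hpa]
    exact h.best v b hb
  · rw [h2]
    exact h.length
  · intro v
    rw [h3, hi]
    have := h.card v
    split_ifs at this <;> simp <;> omega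
  · have h6 : pendingSum W L (I.adapt i st).ret = pendingSum W L st := by
      unfold pendingSum
      rw [h4]
    have h7 : ∑ v, (5 + (st.core v).length * (W + 1)) ≤
        ∑ v, (5 + knownBound K N L v * (W + 1)) := by
      refine Finset.sum_le_sum fun v _ => Nat.add_le_add_left (Nat.mul_le_mul_right _ ?_) 5
      rw [length_core]
      exact h.length_le hN v
    unfold adaptCost
    omega

theorem buildSets_time {st : State n K} {D S : Finset (NodePath n)} {Z : Finset (Fin n)}
    {level : ℝ} (h : I.RunInv sample L st D S Z level) (hN : I.Sparse sample L N) :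
    2 + (I.buildSets st).time ≤ buildCost W K N L := by
  have ht : (I.buildSets st).time =
    (∑ _i : Fin K, (1 + ∑ v : Fin n, (1 + (st.found v).length * (W + 1)))) + 0 := rfl
  rw [ht, Finset.sum_const, Finset.card_univ, Fintype.card_fin, smul_eq_mul, add_zero, buildCost]
  refine Nat.add_le_add_left (Nat.mul_le_mul_left _ (Nat.add_le_add_left ?_ 1)) 2
  exact Finset.sum_le_sum fun v _ =>
    Nat.add_le_add_left (Nat.mul_le_mul_right _ (h.length_le hN v)) 1

/-- One pass of the main loop pops a path, or starts the next iteration, or ends. -/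
theorem step_spec {st : State n K} {D S : Finset (NodePath n)} {Z : Finset (Fin n)}
    {level : ℝ} (h : I.RunInv sample L st D S Z level) (hN : I.Sparse sample L N) {Δ : ℕ}
    (hΔ : ∀ v, I.outDegree v ≤ Δ) :
    (∃ st' D' S' Z' level', (I.step sample st).ret = Sum.inl st' ∧
      I.RunInv sample L st' D' S' Z' level' ∧ D'.card = D.card + 1 ∧
      st'.iteration = st.iteration ∧
      (I.step sample st).time + st'.heap.potential + pendingSum W L st' +
        endSum (nodeCost W K N L) S ≤
        st.heap.potential + pendingSum W L st + endSum (nodeCost W K N L) S' + popCost n W Δ) ∨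
    (∃ st', (I.step sample st).ret = Sum.inl st' ∧ I.RunInv sample L st' D S ∅ 0 ∧
      st'.iteration.val = st.iteration.val + 1 ∧
      (I.step sample st).time + st'.heap.potential + pendingSum W L st' ≤
        pendingSum W L st + adaptCost W K N L) ∨
    ∃ out, (I.step sample st).ret = Sum.inr out ∧
      (I.step sample st).time ≤ buildCost W K N L := by
  rcases FibHeap.extractMin_spec h.queue.valid h.queue.length_items_le with ⟨h1, h2, h3⟩ |
    ⟨x, hp, h1, h2, h3, h4, h5, h6, h7⟩
  · right
    by_cases hi : st.iteration.val + 1 < K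
    · left
      have hr : I.step sample st = ⟨Sum.inl (I.adapt ⟨st.iteration.val + 1, hi⟩ st).ret,
          1 + (st.heap.extractMin.time + ((I.adapt ⟨st.iteration.val + 1, hi⟩ st).time + 0))⟩ := by
        unfold step
        rw [Timed.bind_eq, Timed.bind_eq, h1]
        simp only [hi, dif_pos]
        rfl
      obtain ⟨k1, k2, k3⟩ := adapt_runInv h hN h3 (i := ⟨st.iteration.val + 1, hi⟩) rfl
      rw [hr]
      refine ⟨_, rfl, k1, by rw [k2], ?_⟩
      simp only [h2]
      omega
    · right
      have hr : I.step sample st = ⟨Sum.inr (I.buildSets st).ret,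
          1 + (st.heap.extractMin.time + ((I.buildSets st).time + 0))⟩ := by
        unfold step
        rw [Timed.bind_eq, Timed.bind_eq, h1]
        simp only [hi, dif_neg, not_false_eq_true]
        rfl
      have := buildSets_time h hN
      rw [hr]
      refine ⟨_, rfl, ?_⟩
      simp only [h2]
      omega
  · left
    obtain ⟨v, e, he, rfl, hs⟩ := (h.queue.items x).1 h3
    have hhead := h.queue.head v e he
    obtain ⟨w, p, hxp⟩ : ∃ w p, e.path = w :: p := by
      cases hc : e.path with
      | nil => rw [hc] at hhead; cases hhead
      | cons w p => exact ⟨w, p, rfl⟩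
    rw [hxp] at hhead h1 h3 h4 h5
    obtain rfl : w = v := by simpa using hhead
    obtain ⟨k1, k2⟩ := h.pop h3 hhead h4 h2 h5 h6
    -- A nontrivial scanned path has its parent among the popped paths, and `w :: p` was not popped
    -- before. Hence no extension is ever scanned twice.
    have hnew : ∀ u, u :: w :: p ∉ S := by
      intro u hc
      rcases h.parent u _ hc with hc | hc
      · cases hc
      · exact k2 hc
    obtain ⟨S', g1, g2, g3⟩ := develop_spec k1 hN (Finset.mem_insert_self _ _) hnew
    have hr : I.step sample st = ⟨Sum.inl ((I.neighbors w).foldlM (I.scan sample (w :: p))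
        (markPopped w (w :: p) { st with heap := hp })).ret,
        1 + (st.heap.extractMin.time + (1 + (((I.neighbors w).foldlM (I.scan sample (w :: p))
        (markPopped w (w :: p) { st with heap := hp })).time + 0)))⟩ := by
      unfold step
      rw [Timed.bind_eq, Timed.bind_eq, h1]
      rfl
    rw [hr]
    refine ⟨_, _, _, _, _, rfl, g1, Finset.card_insert_of_notMem k2, g2, ?_⟩
    have e1 : (markPopped w (w :: p) { st with heap := hp }).heap.potential = hp.potential := rfl
    have e2 : pendingSum W L (markPopped w (w :: p) { st with heap := hp }) =
      pendingSum W L st := rfl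
    have e3 := Nat.mul_le_mul_right (1 + 2 * W) (hΔ w)
    rw [e1, e2] at g3
    simp only
    unfold popCost heapCost
    omega

/-! ### Counting popped and scanned paths, and the total over the run -/

theorem card_le_sum_pathsTo {D : Finset (NodePath n)} (h : ∀ q ∈ D, ∃ v, q.head? = some v) :
    D.card ≤ ∑ v, (pathsTo v D).card := by
  have h1 : D ⊆ Finset.univ.biUnion fun v => pathsTo v D := by
    intro q hq
    obtain ⟨v, hv⟩ := h q hq
    exact Finset.mem_biUnion.2 ⟨v, Finset.mem_univ v, Finset.mem_filter.2 ⟨hq, hv⟩⟩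
  exact (Finset.card_le_card h1).trans Finset.card_biUnion_le

namespace RunInv

variable {st : State n K} {D S : Finset (NodePath n)} {Z : Finset (Fin n)} {level : ℝ}

theorem card_popped_le (h : I.RunInv sample L st D S Z level) (v : Fin n) :
    (pathsTo v D).card ≤ K := by
  have h1 := h.card v
  have h2 := st.iteration.isLt
  split_ifs at h1 <;> omega

theorem card_popped_le_sum (h : I.RunInv sample L st D S Z level) :
    D.card ≤ ∑ v, (pathsTo v D).card := by
  refine card_le_sum_pathsTo fun q hq => ?_
  have := h.path q (h.sub hq)
  match q, this with
  | v :: r, _ => exact ⟨v, rfl⟩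

theorem card_popped_le_mul (h : I.RunInv sample L st D S Z level) : D.card ≤ n * K := by
  refine h.card_popped_le_sum.trans ((Finset.sum_le_sum fun v _ => h.card_popped_le v).trans ?_)
  simp

/-- A scanned path to `v` is either the trivial one or one edge appended to a popped path, and each
of the at most `Δ` in-neighbours has at most `K` popped paths. -/
theorem card_scanned_le (h : I.RunInv sample L st D S Z level) {Δ : ℕ}
    (hΔ : ∀ v, I.inDegree v ≤ Δ) (v : Fin n) : (pathsTo v S).card ≤ 1 + Δ * K := by
  have hsub : pathsTo v S ⊆ insert [v] ((I.edges.filter fun e => e.2 = v).biUnion fun e =>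
      (pathsTo e.1 D).image (List.cons v)) := by
    intro q hq
    obtain ⟨h1, h2⟩ := Finset.mem_filter.1 hq
    match q, h1, h2 with
    | w :: r, h1, h2 =>
      obtain rfl : w = v := by simpa using h2
      rcases h.parent w r h1 with rfl | hr
      · exact Finset.mem_insert_self _ _
      · refine Finset.mem_insert_of_mem (Finset.mem_biUnion.2 ?_)
        have h3 := h.path _ h1
        match r, hr, h3 with
        | [], hr, _ => exact (h.path _ (h.sub hr)).elim
        | u :: r, hr, h3 =>
          exact ⟨(u, w), Finset.mem_filter.2 ⟨h3.1, rfl⟩,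
            Finset.mem_image_of_mem _ (Finset.mem_filter.2 ⟨hr, rfl⟩)⟩
  refine (Finset.card_le_card hsub).trans ((Finset.card_insert_le _ _).trans ?_)
  rw [add_comm]
  refine Nat.add_le_add_left (Finset.card_biUnion_le.trans ?_) 1
  refine (Finset.sum_le_card_nsmul _ _ K fun e _ =>
    Finset.card_image_le.trans (h.card_popped_le _)).trans ?_
  exact Nat.mul_le_mul_right K (hΔ v)

end RunInv

/-- Every pass but the last increases `D.card` or the iteration index, which are at most `n * K` and
less than `K`; the hypothesis on `fuel` is therefore preserved and impossible for zero fuel. The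
credits of the single passes telescope. -/
theorem loop_spec (hN : I.Sparse sample L N) {Δ : ℕ} (hΔ : ∀ v, I.outDegree v ≤ Δ) (fuel : ℕ) :
    ∀ {st : State n K} {D S : Finset (NodePath n)} {Z : Finset (Fin n)} {level : ℝ},
      I.RunInv sample L st D S Z level →
      n * K + K < fuel + D.card + st.iteration.val →
      ∃ out t st' D' S' Z' level', I.loop sample fuel st = ⟨some out, t⟩ ∧
        I.RunInv sample L (K := K) st' D' S' Z' level' ∧
        t + D.card * popCost n W Δ + endSum (nodeCost W K N L) S +
            st.iteration.val * adaptCost W K N L ≤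
          st.heap.potential + pendingSum W L st + D'.card * popCost n W Δ +
            endSum (nodeCost W K N L) S' + st'.iteration.val * adaptCost W K N L +
            buildCost W K N L := by
  induction fuel with
  | zero =>
    intro st D S Z level h hf
    have h1 := h.card_popped_le_mul
    have h2 := st.iteration.isLt
    omega
  | succ fuel ih =>
    intro st D S Z level h hf
    rcases step_spec h hN hΔ with ⟨st', D', S', Z', level', h1, h2, h3, h4, h5⟩ |
      ⟨st', h1, h2, h3, h4⟩ | ⟨out, h1, h2⟩
    · obtain ⟨out, t, st'', D'', S'', Z'', level'', k1, k2, k3⟩ := ih h2 (by rw [h3, h4]; omega)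
      refine ⟨out, (I.step sample st).time + t, st'', D'', S'', Z'', level'', ?_, k2, ?_⟩
      · rw [loop, Timed.bind_eq, h1]
        simp only [k1]
      · rw [h3, h4, add_mul] at k3
        omega
    · obtain ⟨out, t, st'', D'', S'', Z'', level'', k1, k2, k3⟩ := ih h2 (by rw [h3]; omega)
      refine ⟨out, (I.step sample st).time + t, st'', D'', S'', Z'', level'', ?_, k2, ?_⟩
      · rw [loop, Timed.bind_eq, h1]
        simp only [k1]
      · rw [h3, add_mul] at k3
        omega
    · refine ⟨out, (I.step sample st).time + 0, st, D, S, Z, level, ?_, h, ?_⟩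
      · rw [loop, Timed.bind_eq, h1]
        rfl
      · omega

/-- The state before the path that consists of the source is pushed. -/
def initialState (I : MOWSP n W K) : State n K where
  iteration := I.first
  found := fun _ => []
  best := fun _ => none
  heap := FibHeap.empty

/-- The state in which the main loop starts. -/
theorem push_source_spec (hsample : ∀ v, sample v ∈ I.paths I.source v) :
    I.RunInv sample L (I.push I.source [I.source] I.initialState).ret ∅ {[I.source]} ∅ 0 ∧
      (I.push I.source [I.source] I.initialState).time +
        (I.push I.source [I.source] I.initialState).ret.heap.potential ≤ pushCost n W 0 ∧
      pendingSum W L (I.push I.source [I.source] I.initialState).ret = Lᶜ.card * ((K + 1) * (K * W + K)) := by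
  set st0 : State n K := I.initialState
  have h0 : I.QueueInv st0 := by
    refine ⟨FibHeap.valid_empty, ?_, ?_, ?_, ?_, ?_⟩
    · simp [initialState, st0]
    · simp [initialState, st0]
    · simp [initialState, st0, State.pathsAt]
    · simp [initialState, st0]
    · simp [initialState, st0]
  obtain ⟨h1, h2, h3, h4, h5, h6⟩ := push_spec h0 (v := I.source) (p := [I.source]) rfl
    (by simp [initialState, st0, State.pathsAt])
  set r := I.push I.source [I.source] st0 with hr
  have hc0 : st0.core = fun _ => [] := rfl
  have hcore : ∀ v, r.ret.core v = if v = I.source then [([I.source], false)] else [] := by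
    intro v
    rw [h2, hc0]
    by_cases hv : v = I.source
    · subst hv; simp
    · simp [hv]
  refine ⟨⟨h1, ?_, ?_, ?_, ?_, by simp, by simp [pathsTo], by simp, ?_, ?_, ?_⟩, ?_, ?_⟩
  · intro x hx
    rcases h5 x hx with rfl | hx
    · rw [cost_singleton]
    · simp [initialState, st0] at hx
  · intro v c hc
    rw [hcore] at hc
    split_ifs at hc
    · rw [List.mem_singleton.1 hc]
      simp
    · simp at hc
  · intro v b hb
    rw [h4] at hb
    cases hb
  · intro v _
    rw [hcore]
    split_ifs <;> simp
  · intro q hq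
    rw [Finset.mem_singleton.1 hq]
    rfl
  · intro q hq v hv hdom
    obtain ⟨-, j, hj⟩ := hdom
    rw [Finset.mem_singleton.1 hq] at hj
    exact absurd hj (not_lt.2 (I.vec_nonneg (hsample v).1 j))
  · intro v p hp
    exact Or.inl (List.cons.inj (Finset.mem_singleton.1 hp)).2
  · simpa [initialState, st0, pushCost] using h6
  · unfold pendingSum
    rw [h4]
    simp [initialState, st0, pending]

theorem sum_ite_mem_le (L : Finset (Fin n)) (a b : ℕ) :
    (∑ v, if v ∈ L then a else b) ≤ n * a + Lᶜ.card * b := by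
  rw [← Finset.sum_add_sum_compl L]
  refine Nat.add_le_add ?_ ?_
  · refine (Finset.sum_le_card_nsmul L _ a fun v hv => by simp [hv]).trans ?_
    exact Nat.mul_le_mul_right a (by simpa using L.card_le_univ)
  · exact Finset.sum_le_card_nsmul Lᶜ _ b fun v hv => by simp [Finset.mem_compl.1 hv]

/-- The time of IDAQ, in terms of the number of nodes that are not in `L`. -/
theorem idaq_time {Δ m : ℕ} (hout : ∀ v, I.outDegree v ≤ Δ) (hin : ∀ v, I.inDegree v ≤ Δ)
    (hN : I.Sparse I.paretoSample.ret L N) (hm : Lᶜ.card = m) :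
    ∃ t, I.IDAQRunsIn t ∧ t ≤
      n + I.edges.card * W + 4 + n * (FibHeap.opCost n + W + 13 * Δ) + n + pushCost n W 0 +
      m * ((K + 1) * (K * W + K)) + (n * N + m * K) * popCost n W Δ +
      (n * (N * (relevanceCost n W N + pushCost n W N)) +
        m * ((1 + Δ * K) * (relevanceCost n W (K + 1) + pushCost n W (K + 1) +
          (K * W + 2 * K)))) +
      K * (3 + (n * (5 + N * (W + 1)) + m * (5 + (K + 1) * (W + 1)))) +
      (2 + K * (1 + (n * (5 + N * (W + 1)) + m * (5 + (K + 1) * (W + 1))))) := by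
  obtain ⟨hpareto, hst⟩ := paretoSample_spec hout
  obtain ⟨h1, h2, h3⟩ := push_source_spec (L := L) (sample := I.paretoSample.ret)
    fun v => (hpareto v).1
  obtain ⟨out, t, st', D, S, Z, level, k1, k2, k3⟩ := loop_spec hN hout (n * K + K + 1) h1
    (by omega)
  set pu := I.push I.source [I.source] I.initialState
  refine ⟨I.paretoSample.time + (n + (pu.time + t)), ⟨n * K + K + 1, out, ?_⟩, ?_⟩
  · have hr : I.idaq (n * K + K + 1) =
        ⟨(I.loop I.paretoSample.ret (n * K + K + 1) pu.ret).ret, I.paretoSample.time +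
          (n + (pu.time + (I.loop I.paretoSample.ret (n * K + K + 1) pu.ret).time))⟩ := rfl
    rw [hr, k1]
  · have b1 : D.card ≤ n * N + m * K := by
      refine k2.card_popped_le_sum.trans (le_trans (Finset.sum_le_sum fun v _ => ?_)
        (hm ▸ sum_ite_mem_le L N K))
      split_ifs with hv
      · refine (Finset.card_le_card fun q hq => ?_).trans (k2.card_paths_le hN hv)
        exact Finset.filter_subset_filter _ k2.sub hq
      · exact k2.card_popped_le v
    -- Inside `L` the sample limits the scanned paths to `N`; outside, their number is limited
    -- through the popped paths of the in-neighbours.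
    have b2 : endSum (nodeCost W K N L) S ≤
        n * (N * (relevanceCost n W N + pushCost n W N)) +
        m * ((1 + Δ * K) * (relevanceCost n W (K + 1) + pushCost n W (K + 1) +
          (K * W + 2 * K))) := by
      rw [endSum_eq]
      refine le_trans (Finset.sum_le_sum fun v _ => ?_) (hm ▸ sum_ite_mem_le L _ _)
      unfold nodeCost knownBound
      split_ifs with hv
      · exact Nat.mul_le_mul (k2.card_paths_le hN hv) le_rfl
      · exact Nat.mul_le_mul (k2.card_scanned_le hin v) le_rfl
    have b3 : ∑ v, (5 + knownBound K N L v * (W + 1)) ≤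
        n * (5 + N * (W + 1)) + m * (5 + (K + 1) * (W + 1)) := by
      refine le_trans (Finset.sum_le_sum fun v _ => ?_) (hm ▸ sum_ite_mem_le L _ _)
      unfold knownBound
      split_ifs <;> exact le_rfl
    have b4 : ∑ v, (1 + knownBound K N L v * (W + 1)) ≤
        ∑ v, (5 + knownBound K N L v * (W + 1)) :=
      Finset.sum_le_sum fun v _ => by omega
    have b5 : st'.iteration.val * adaptCost W K N L ≤
        K * (3 + (n * (5 + N * (W + 1)) + m * (5 + (K + 1) * (W + 1)))) :=
      Nat.mul_le_mul st'.iteration.isLt.le (Nat.add_le_add_left b3 3)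
    have b6 : buildCost W K N L ≤
        2 + K * (1 + (n * (5 + N * (W + 1)) + m * (5 + (K + 1) * (W + 1)))) :=
      Nat.add_le_add_left (Nat.mul_le_mul_left K (Nat.add_le_add_left (b4.trans b3) 1)) 2
    have b7 := Nat.mul_le_mul_right (popCost n W Δ) b1
    rw [hm] at h3
    rw [Finset.card_empty] at k3
    omega

end MOWSP

/-! ### The asymptotic bound -/

namespace MOWSP

/-- Here `x` stands for `log n`, `y` for `√n`, `m` for the number of bad nodes, and `H` and `O` for
heap costs. Each summand is compared with `E * L ^ 2`, `n * L * x` or `K * n * L`; terms with few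
factors are padded using that all of these quantities are at least of order one. The numerical
constants are generous. -/
theorem total_le {a x y n L K N W Δ m H O E : ℝ} (ha : 1 ≤ a) (hx : 1 ≤ x) (hxy : x ^ 3 ≤ y)
    (hy : y ^ 2 = n) (hL : 1 ≤ L) (hK : 1 ≤ K) (hKy : K ≤ a * y) (hN : N ≤ a * L) (hN0 : 0 ≤ N)
    (hW : W ≤ a) (hW0 : 0 ≤ W) (hΔ : Δ ≤ a * x) (hΔ0 : 0 ≤ Δ) (hm : m ≤ x)
    (hH : H ≤ 120 * x) (hH0 : 0 ≤ H) (hO : O ≤ 120 * x) (hE : n ≤ 2 * E) :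
    n + E * W + 4 + n * (O + W + 13 * Δ) + n + (1 + W + 0 * (W + 2) + H + 4) +
      m * ((K + 1) * (K * W + K)) + (n * N + m * K) * (2 + H + Δ * (1 + 2 * W)) +
      (n * (N * ((1 + 2 * (N * W) + 2 * N + H) + (1 + W + N * (W + 2) + H + 4))) +
        m * ((1 + Δ * K) * ((1 + 2 * ((K + 1) * W) + 2 * (K + 1) + H) +
          (1 + W + (K + 1) * (W + 2) + H + 4) + (K * W + 2 * K)))) +
      K * (3 + (n * (5 + N * (W + 1)) + m * (5 + (K + 1) * (W + 1)))) +
      (2 + K * (1 + (n * (5 + N * (W + 1)) + m * (5 + (K + 1) * (W + 1))))) ≤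
      20000 * a ^ 4 * (E * L ^ 2 + n * L * x + K * n * L) := by
  have hx0 : (0 : ℝ) ≤ x := by linarith
  have ha0 : (0 : ℝ) ≤ a := by linarith
  have hL0 : (0 : ℝ) ≤ L := by linarith
  have hK0 : (0 : ℝ) ≤ K := by linarith
  have hx3 : x ≤ x ^ 3 := le_self_pow₀ hx (by norm_num)
  have hy1 : 1 ≤ y := by linarith
  have hy0 : 0 ≤ y := by linarith
  have hyn : y ≤ n := by rw [← hy]; exact le_self_pow₀ hy1 (by norm_num)
  have hn1 : 1 ≤ n := by linarith
  have hn0 : 0 ≤ n := by linarith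
  have hE0 : 0 ≤ E := by linarith
  have hyy : y * y = n := by rw [← hy]; ring
  have hxn : x ≤ n := by linarith
  have hLL : L ≤ L ^ 2 := le_self_pow₀ hL (by norm_num)
  have hL2 : 1 ≤ L ^ 2 := by linarith
  have hpow : ∀ k l : ℕ, k ≤ l → a ^ k ≤ a ^ l := fun k l h => pow_le_pow_right₀ ha h
  have ha1 : a ≤ a ^ 2 := le_self_pow₀ ha (by norm_num)
  set A := a ^ 4 with hA
  have hA1 : 1 ≤ A := by simpa using hpow 0 4 (by norm_num)
  have hA2 : a ≤ A := by simpa using hpow 1 4 (by norm_num)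
  have hA3 : a ^ 2 ≤ A := hpow 2 4 (by norm_num)
  have hA4 : a ^ 3 ≤ A := hpow 3 4 (by norm_num)
  set q1 := n * L * x with hq1
  set q2 := K * n * L with hq2
  set q3 := E * L ^ 2 with hq3
  have hnx : n * x ≤ q1 := by
    have := mul_le_mul_of_nonneg_left hL (mul_nonneg hn0 hx0)
    rw [hq1]; linarith
  have hq1n : n ≤ q1 := by
    have := mul_le_mul_of_nonneg_left hx hn0
    linarith
  have hKn : K * n ≤ q2 := by
    have := mul_le_mul_of_nonneg_left hL (mul_nonneg hK0 hn0)
    rw [hq2]; linarith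
  have hEq : E ≤ q3 := by
    have := mul_le_mul_of_nonneg_left hL2 hE0
    rw [hq3]; linarith
  have hnL : n * L ^ 2 ≤ 2 * q3 := by
    have := mul_le_mul_of_nonneg_right hE (by positivity : 0 ≤ L ^ 2)
    rw [hq3]; linarith
  have hq10 : 0 ≤ q1 := by linarith
  have hq20 : 0 ≤ q2 := (mul_nonneg hK0 hn0).trans hKn
  have hq30 : 0 ≤ q3 := by linarith
  -- The decisive estimate for the bad nodes: three logarithmic factors and one factor `K` fit into
  -- `n`.
  have hxK : x ^ 3 * K ≤ a * n := by
    calc x ^ 3 * K ≤ y * (a * y) := by gcongr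
      _ = a * n := by rw [← hyy]; ring
  have hx2K : x ^ 2 * K ≤ a * n := (mul_le_mul_of_nonneg_right
    (pow_le_pow_right₀ hx (by norm_num : 2 ≤ 3)) hK0).trans hxK
  have hx1K : x * K ≤ a * n := (mul_le_mul_of_nonneg_right hx3 hK0).trans hxK
  have hone : (1 : ℝ) ≤ x * K := one_le_mul_of_one_le_of_one_le hx hK
  have hKx : K ≤ x * K := le_mul_of_one_le_left hK0 hx
  have hxKx : x ≤ x * K := le_mul_of_one_le_right hx0 hK
  have t1 : E * W ≤ A * q3 := by
    calc E * W ≤ q3 * A := by gcongr; linarith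
      _ = A * q3 := mul_comm _ _
  have t2 : n * (O + W + 13 * Δ) ≤ 134 * A * q1 := by
    calc n * (O + W + 13 * Δ) ≤ n * (134 * A * x) := by
          gcongr
          have h1 : x ≤ A * x := le_mul_of_one_le_left hx0 hA1
          have h2 : a * x ≤ A * x := by gcongr
          have h3 : a ≤ a * x := le_mul_of_one_le_right ha0 hx
          linarith
      _ = 134 * A * (n * x) := by ring
      _ ≤ 134 * A * q1 := by gcongr
  have t3 : 1 + W + 0 * (W + 2) + H + 4 ≤ 126 * A * q1 := by
    have h1 : x ≤ A * q1 := by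
      calc x ≤ n * x := le_mul_of_one_le_left hx0 hn1
        _ ≤ q1 := hnx
        _ ≤ A * q1 := le_mul_of_one_le_left hq10 hA1
    have h2 : a ≤ A * q1 := by
      calc a ≤ A := hA2
        _ ≤ A * q1 := le_mul_of_one_le_right (by linarith) (by linarith)
    linarith
  have t4 : m * ((K + 1) * (K * W + K)) ≤ 4 * A * q2 := by
    calc m * ((K + 1) * (K * W + K)) ≤ x * ((2 * K) * (2 * a * K)) := by
          gcongr
          · linarith
          · have h1 : K * W ≤ K * a := by gcongr
            have h2 : K ≤ K * a := le_mul_of_one_le_right hK0 ha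
            linarith
      _ = 4 * a * K * (x * K) := by ring
      _ ≤ 4 * a * K * (a * n) := by gcongr
      _ = 4 * a ^ 2 * (K * n) := by ring
      _ ≤ 4 * A * q2 := by gcongr
  have hW12 : 1 + 2 * W ≤ 3 * a := by linarith
  have hP : 2 + H + Δ * (1 + 2 * W) ≤ 125 * a ^ 2 * x := by
    have h1 : Δ * (1 + 2 * W) ≤ (a * x) * (3 * a) := by gcongr
    have h2 : x ≤ a ^ 2 * x := le_mul_of_one_le_left hx0 (by linarith)
    have h3 : (a * x) * (3 * a) = 3 * (a ^ 2 * x) := by ring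
    linarith
  have t5 : (n * N + m * K) * (2 + H + Δ * (1 + 2 * W)) ≤ 125 * A * q1 + 125 * A * q2 := by
    calc (n * N + m * K) * (2 + H + Δ * (1 + 2 * W))
        ≤ (n * (a * L) + x * K) * (125 * a ^ 2 * x) := by gcongr
      _ = 125 * a ^ 3 * q1 + 125 * a ^ 2 * (x ^ 2 * K) := by rw [hq1]; ring
      _ ≤ 125 * A * q1 + 125 * a ^ 2 * (a * n) := by
          gcongr
      _ = 125 * A * q1 + 125 * a ^ 3 * (1 * n) := by ring
      _ ≤ 125 * A * q1 + 125 * A * (K * n) := by gcongr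
      _ ≤ 125 * A * q1 + 125 * A * q2 := by gcongr
  -- A relevance check together with a push when `q` paths are known; it is used for `q = N` and for
  -- `q = K + 1`.
  have hR : ∀ q : ℝ, 0 ≤ q → (1 + 2 * (q * W) + 2 * q + H) + (1 + W + q * (W + 2) + H + 4) ≤
      7 * a * q + 247 * a * x := by
    intro q hq
    have h1 : q * W ≤ a * q := by rw [mul_comm a]; gcongr
    have h2 : q ≤ a * q := le_mul_of_one_le_left hq ha
    have h3 : x ≤ a * x := le_mul_of_one_le_left hx0 ha
    have h4 : a ≤ a * x := le_mul_of_one_le_right ha0 hx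
    linarith
  have hRN : (1 + 2 * (N * W) + 2 * N + H) + (1 + W + N * (W + 2) + H + 4) ≤
      7 * a * (a * L) + 247 * a * x := by
    refine (hR N hN0).trans ?_
    gcongr
  have t6 : n * (N * ((1 + 2 * (N * W) + 2 * N + H) + (1 + W + N * (W + 2) + H + 4))) ≤
      14 * A * q3 + 247 * A * q1 := by
    calc n * (N * ((1 + 2 * (N * W) + 2 * N + H) + (1 + W + N * (W + 2) + H + 4)))
        ≤ n * ((a * L) * (7 * a * (a * L) + 247 * a * x)) := by
          gcongr
      _ = 7 * a ^ 3 * (n * L ^ 2) + 247 * a ^ 2 * q1 := by rw [hq1]; ring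
      _ ≤ 7 * A * (2 * q3) + 247 * A * q1 := by gcongr
      _ = 14 * A * q3 + 247 * A * q1 := by ring
  have t7 : m * ((1 + Δ * K) * ((1 + 2 * ((K + 1) * W) + 2 * (K + 1) + H) +
      (1 + W + (K + 1) * (W + 2) + H + 4) + (K * W + 2 * K))) ≤ 600 * A * q2 := by
    calc m * ((1 + Δ * K) * ((1 + 2 * ((K + 1) * W) + 2 * (K + 1) + H) +
          (1 + W + (K + 1) * (W + 2) + H + 4) + (K * W + 2 * K)))
        -- One factor `x` counts the bad nodes, one comes from the in-degree, and one absorbs the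
        -- heap cost.
        ≤ x * ((2 * a * (x * K)) * (300 * a * (x * K))) := by
          gcongr
          · have h1 : Δ * K ≤ a * x * K := by gcongr
            have h2 : x * K ≤ a * (x * K) := le_mul_of_one_le_left (by positivity) ha
            linarith
          · have h1 := hR (K + 1) (by linarith)
            have h2 : K * W ≤ a * K := by rw [mul_comm a]; gcongr
            have h3 : K ≤ a * K := le_mul_of_one_le_left hK0 ha
            have h4 : a * K ≤ a * (x * K) := by gcongr
            have h5 : a * x ≤ a * (x * K) := by gcongr
            have h6 : a ≤ a * (x * K) := le_mul_of_one_le_right ha0 hone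
            linarith
      _ = 600 * a ^ 2 * K * (x ^ 3 * K) := by ring
      _ ≤ 600 * a ^ 2 * K * (a * n) := by gcongr
      _ = 600 * a ^ 3 * (K * n) := by ring
      _ ≤ 600 * A * q2 := by gcongr
  have t8 : K * (n * (5 + N * (W + 1)) + m * (5 + (K + 1) * (W + 1))) ≤ 17 * A * q2 := by
    have h1 : K * (n * (5 + N * (W + 1))) ≤ 7 * A * q2 := by
      calc K * (n * (5 + N * (W + 1))) ≤ K * (n * (7 * a ^ 2 * L)) := by
            gcongr
            have h1 : N * (W + 1) ≤ (a * L) * (2 * a) := by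
              gcongr
              linarith
            have h2 : 1 ≤ a ^ 2 * L := one_le_mul_of_one_le_of_one_le (by linarith) hL
            have h3 : (a * L) * (2 * a) = 2 * (a ^ 2 * L) := by ring
            linarith
        _ = 7 * a ^ 2 * q2 := by rw [hq2]; ring
        _ ≤ 7 * A * q2 := by gcongr
    have h2 : K * (m * (5 + (K + 1) * (W + 1))) ≤ 9 * A * q2 := by
      calc K * (m * (5 + (K + 1) * (W + 1))) ≤ K * (x * (9 * a * K)) := by
            gcongr
            have h1 : (K + 1) * (W + 1) ≤ (2 * K) * (2 * a) := by
              gcongr <;> linarith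
            have h2 : 1 ≤ a * K := one_le_mul_of_one_le_of_one_le ha hK
            linarith
        _ = 9 * a * K * (x * K) := by ring
        _ ≤ 9 * a * K * (a * n) := by gcongr
        _ = 9 * a ^ 2 * (K * n) := by ring
        _ ≤ 9 * A * q2 := by gcongr
    have h3 : 0 ≤ A * q2 := by positivity
    linarith
  have hAq1 : q1 ≤ A * q1 := le_mul_of_one_le_left hq10 hA1
  have hAq2 : q2 ≤ A * q2 := le_mul_of_one_le_left hq20 hA1
  have hAq3 : q3 ≤ A * q3 := le_mul_of_one_le_left hq30 hA1
  have hKq : K ≤ q2 := (le_mul_of_one_le_right hK0 hn1).trans hKn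
  have hfin : 20000 * A * (q3 + q1 + q2) = 20000 * (A * q3) + 20000 * (A * q1) +
    20000 * (A * q2) := by ring
  rw [hfin]
  linarith

/-! ### Instance data needed for the estimate -/

theorem card_le_edges {n W K : ℕ} (I : MOWSP n W K) : n ≤ I.edges.card + 1 := by
  -- The last edge of a path from the source enters any given node other than the source.
  have h : Finset.univ.erase I.source ⊆ I.edges.image Prod.snd := by
    intro v hv
    obtain ⟨p, hp⟩ := I.reachable v
    match p, hp with
    | [w], hp =>
      obtain rfl : w = v := by simpa using hp.2
      exact absurd hp.1 (Finset.ne_of_mem_erase hv)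
    | w :: u :: p, hp =>
      obtain rfl : w = v := by simpa using hp.2
      exact Finset.mem_image.2 ⟨(u, w), hp.1.1, rfl⟩
  have h1 := (Finset.card_le_card h).trans Finset.card_image_le
  rw [Finset.card_erase_of_mem (Finset.mem_univ _), Finset.card_univ, Fintype.card_fin] at h1
  omega

open Classical in
/-- The set of the `l`-nodes. -/
noncomputable def lNodes {n W K : ℕ} (I : MOWSP n W K) (l : ℕ) : Finset (Fin n) :=
  Finset.univ.filter fun v => I.IsLNode I.source l v

theorem mem_lNodes {n W K : ℕ} {I : MOWSP n W K} {l : ℕ} {v : Fin n} :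
    v ∈ I.lNodes l ↔ I.IsLNode I.source l v := by
  simp [lNodes]

/-- The maximum defining `maxNonDominated` runs over all Pareto paths, so it covers whichever one
the sample happens to contain. -/
theorem sparse_lNodes {n W K : ℕ} {I : MOWSP n W K} {l N : ℕ} {sample : Fin n → NodePath n}
    (hs : ∀ v, sample v ∈ I.paretoPaths I.source v)
    (hN : I.maxNonDominated I.source l = (N : ℕ∞)) (hK : (N : ℝ) ≤ (K : ℝ) / W) :
    I.Sparse sample (I.lNodes l) N where
  card_le := fun v hv T hT => by
    have h1 : ({q | q ∈ I.paths I.source v ∧ ¬ Dominates (I.vec (sample v)) (I.vec q)} :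
        Set (NodePath n)).encard ≤ I.maxNonDominated I.source l := by
      unfold MOG.maxNonDominated
      exact le_iSup_of_le v (le_iSup_of_le (mem_lNodes.1 hv)
        (le_iSup₂_of_le (sample v) (hs v) le_rfl))
    have h2 : (T : Set (NodePath n)).encard ≤ N :=
      (Set.encard_le_encard fun q hq => hT q hq).trans (h1.trans hN.le)
    rw [Set.encard_coe_eq_coe_finsetCard] at h2
    exact_mod_cast h2
  le := hK

theorem card_compl_lNodes_le {n W K : ℕ} {I : MOWSP n W K} {l : ℕ} (hn : 0 < n)
    (h : 1 - Real.log n / n ≤ I.alpha I.source l) :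
    ((I.lNodes l)ᶜ.card : ℝ) ≤ Real.log n := by
  have h1 : ({v | I.IsLNode I.source l v} : Set (Fin n)).ncard = (I.lNodes l).card := by
    rw [← Set.ncard_coe_finset]
    congr 1
    ext v
    simp [mem_lNodes]
  have hn' : (0 : ℝ) < n := by exact_mod_cast hn
  rw [MOG.alpha, h1, le_div_iff₀ hn', sub_mul, div_mul_cancel₀ _ hn'.ne'] at h
  have h2 : (I.lNodes l).card + (I.lNodes l)ᶜ.card = n := by
    rw [Finset.card_add_card_compl, Fintype.card_fin]
  have h3 : ((I.lNodes l).card : ℝ) + ((I.lNodes l)ᶜ.card : ℝ) = n := by exact_mod_cast h2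
  linarith

/-- Every node has a Pareto path, so there are no 0-nodes, and `l = 0` would force `n ≤ log n`. The
bound is needed to absorb the terms that carry no factor `L`. -/
theorem one_le_of_alpha {n W K : ℕ} {I : MOWSP n W K} {l : ℕ} (hn : 0 < n)
    (h : 1 - Real.log n / n ≤ I.alpha I.source l)
    (hs : ∀ v, (I.paretoPaths I.source v).Nonempty) : 1 ≤ l := by
  by_contra hl
  obtain rfl : l = 0 := by omega
  have h1 := card_compl_lNodes_le hn h
  have h2 : I.lNodes 0 = ∅ := by
    refine Finset.eq_empty_of_forall_notMem fun v hv => ?_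
    have h3 := mem_lNodes.1 hv
    unfold MOG.IsLNode at h3
    rw [Nat.cast_zero, nonpos_iff_eq_zero, Set.encard_eq_zero] at h3
    exact (hs v).ne_empty h3
  rw [h2, Finset.compl_empty, Finset.card_univ, Fintype.card_fin] at h1
  have hn' : (0 : ℝ) < n := by exact_mod_cast hn
  linarith [Real.log_le_sub_one_of_pos hn']

/-! ### Logarithmic estimates -/

theorem heapCost_le {n : ℕ} (hn : 3 ≤ n) : (heapCost n : ℝ) ≤ 120 * Real.log n := by
  have hn' : (3 : ℝ) ≤ n := by exact_mod_cast hn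
  have h1 : (Nat.log 2 (n + 1) : ℝ) * Real.log 2 ≤ Real.log (n + 1) := by
    rw [← Real.log_pow]
    refine Real.log_le_log (by positivity) ?_
    exact_mod_cast Nat.pow_log_le_self 2 (by omega)
  have h2 : Real.log ((n : ℝ) + 1) ≤ 2 * Real.log n := by
    have h : Real.log ((n : ℝ) ^ 2) = 2 * Real.log n := by rw [Real.log_pow]; norm_num
    rw [← h]
    exact Real.log_le_log (by positivity) (by nlinarith)
  have h3 : 1 ≤ Real.log n := by
    rw [Real.le_log_iff_exp_le (by linarith)]
    linarith [Real.exp_one_lt_d9]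
  have h4 := Real.log_two_gt_d9
  -- Since `log 2` exceeds one half, the binary logarithm is at most `4 * log n`; the additive 40 is
  -- absorbed because `log n ≥ 1`.
  have h5 : (Nat.log 2 (n + 1) : ℝ) * 0.5 ≤ Nat.log 2 (n + 1) * Real.log 2 := by
    gcongr
    linarith
  unfold heapCost FibHeap.opCost
  push_cast
  linarith

theorem opCost_le_heapCost (n : ℕ) : FibHeap.opCost n ≤ heapCost n := by
  have := Nat.log_mono_right (b := 2) (Nat.le_succ n)
  unfold heapCost FibHeap.opCost
  simp only [Nat.succ_eq_add_one] at this
  omega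

theorem eventually_log_pow_le : ∀ᶠ n : ℕ in atTop, Real.log n ^ 3 ≤ √(n : ℝ) := by
  have h : (fun x : ℝ => Real.log x ^ (3 : ℝ)) =o[atTop] fun x => x ^ (1 / 2 : ℝ) :=
    isLittleO_log_rpow_rpow_atTop 3 (by norm_num)
  have h2 := tendsto_natCast_atTop_atTop (R := ℝ) |>.eventually (h.bound one_pos)
  filter_upwards [h2, eventually_ge_atTop 1] with n hn hn1
  have h3 : 0 ≤ Real.log (n : ℝ) := Real.log_nonneg (by exact_mod_cast hn1)
  rw [one_mul, Real.norm_of_nonneg (by positivity), Real.norm_of_nonneg (by positivity),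
    ← Real.sqrt_eq_rpow] at hn
  exact_mod_cast hn

/-- The time of IDAQ, for all large numbers of nodes. -/
theorem exists_time_le (c : ℝ) : ∀ᶠ n : ℕ in atTop, ∀ (W K : ℕ) (I : MOWSP n W K) (L N : ℕ),
    (W : ℝ) ≤ c →
    (∀ v, (I.outDegree v : ℝ) ≤ c * Real.log n) →
    (∀ v, (I.inDegree v : ℝ) ≤ c * Real.log n) →
    (K : ℝ) ≤ c * √n →
    1 - Real.log n / n ≤ I.alpha I.source L →
    I.maxNonDominated I.source L = (N : ℕ∞) →
    (N : ℝ) ≤ c * L →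
    (N : ℝ) ≤ (K : ℝ) / W →
    1 ≤ L ∧ ∃ t : ℕ, I.IDAQRunsIn t ∧ (t : ℝ) ≤
      20000 * c ^ 4 * ((I.edges.card : ℝ) * (L : ℝ) ^ 2 + n * L * Real.log n + K * n * L) := by
  filter_upwards [eventually_log_pow_le, eventually_ge_atTop 3] with n hlog hn
  intro W K I L N hW hout hin hK hL hN hNL hNK
  have hn' : (3 : ℝ) ≤ n := by exact_mod_cast hn
  have hx : 1 ≤ Real.log n := by
    rw [Real.le_log_iff_exp_le (by linarith)]
    linarith [Real.exp_one_lt_d9]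
  have hc : 1 ≤ c := (show (1 : ℝ) ≤ W by exact_mod_cast I.W_pos).trans hW
  set Δ := ⌊c * Real.log n⌋₊ with hΔ
  have hΔ1 : (Δ : ℝ) ≤ c * Real.log n := Nat.floor_le (by positivity)
  have hout' : ∀ v, I.outDegree v ≤ Δ := fun v => Nat.le_floor (hout v)
  have hin' : ∀ v, I.inDegree v ≤ Δ := fun v => Nat.le_floor (hin v)
  have hs := (paretoSample_spec (I := I) hout').1
  have hL1 : 1 ≤ L := one_le_of_alpha (by omega) hL fun v => ⟨_, hs v⟩
  obtain ⟨t, ht, hle⟩ := idaq_time hout' hin' (sparse_lNodes hs hN hNK) rfl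
  have hle' : (t : ℝ) ≤ _ := Nat.cast_le.2 hle
  refine ⟨hL1, t, ht, hle'.trans ?_⟩
  have hE : (n : ℝ) ≤ 2 * I.edges.card := by
    have := I.card_le_edges
    have h : n ≤ 2 * I.edges.card := by omega
    exact_mod_cast h
  have hO : (FibHeap.opCost n : ℝ) ≤ 120 * Real.log n :=
    le_trans (by exact_mod_cast opCost_le_heapCost n) (heapCost_le hn)
  have := total_le (a := c) (x := Real.log n) (y := √n) (n := n) (L := L) (K := K) (N := N)
    (W := W) (Δ := Δ) (m := ((I.lNodes L)ᶜ.card : ℕ)) (H := heapCost n) (O := FibHeap.opCost n)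
    (E := I.edges.card) hc hx hlog (Real.sq_sqrt (Nat.cast_nonneg n)) (by exact_mod_cast hL1)
    (by exact_mod_cast I.K_pos) hK hNL (Nat.cast_nonneg N) hW (Nat.cast_nonneg W) hΔ1
    (Nat.cast_nonneg Δ) (card_compl_lNodes_le (by omega) hL)
    (heapCost_le hn) (Nat.cast_nonneg _) hO hE
  unfold popCost pushCost relevanceCost
  push_cast at this ⊢
  exact this

end MOWSP

theorem mainTheorem4 (F : ℕ → ℝ)
    (hF : F =o[atTop] fun n : ℕ => Real.log n) (c : ℝ) (hc : 0 < c) :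
    ∃ C : ℝ, ∀ᶠ n : ℕ in atTop, ∀ (W K : ℕ) (I : MOWSP n W K) (L N : ℕ),
      (W : ℝ) ≤ c →
      (∀ v, (I.outDegree v : ℝ) ≤ c * Real.log n) →
      (∀ v, (I.inDegree v : ℝ) ≤ c * Real.log n) →
      (K : ℝ) ≤ c * √n →
      IsLeast {l : ℕ | 1 - Real.log n / n ≤ I.alpha I.source l} L →
      I.maxNonDominated I.source L = (N : ℕ∞) →
      (N : ℝ) ≤ c * L →
      (N : ℝ) ≤ (K : ℝ) / W →
      (L : ℝ) ≤ c * F n →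
      ∃ t : ℕ, I.IDAQRunsIn t ∧
        (t : ℝ) ≤ C * ((I.edges.card : ℝ) * F n ^ 2 + √n * n * F n) ∧
        (Real.log n ≤ c * K →
          (t : ℝ) ≤ C * ((I.edges.card : ℝ) * (L : ℝ) ^ 2 + (K : ℝ) * n * L)) := by
  -- The last factor dominates all powers of `c` that arise from replacing `L` by `c * F n`, `K` by
  -- `c * √n`, or `log n` by `c * K`.
  refine ⟨20000 * c ^ 4 * (2 * c ^ 2 + c + 1), ?_⟩
  filter_upwards [MOWSP.exists_time_le c, MOWSP.eventually_log_pow_le, eventually_ge_atTop 3]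
    with n h hlog hn
  intro W K I L N hW hout hin hK hL hN hNL hNK hLF
  obtain ⟨hL1, t, ht, hle⟩ := h W K I L N hW hout hin hK hL.1 hN hNL hNK
  have hc1 : 1 ≤ c := (show (1 : ℝ) ≤ W by exact_mod_cast I.W_pos).trans hW
  have hL1' : (1 : ℝ) ≤ L := by exact_mod_cast hL1
  -- `c * F n` is at least `L`, hence at least one.
  have hF0 : 0 < F n := pos_of_mul_pos_right (by linarith) hc.le
  have hn' : (3 : ℝ) ≤ n := by exact_mod_cast hn
  have hx : 1 ≤ Real.log n := by
    rw [Real.le_log_iff_exp_le (by linarith)]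
    linarith [Real.exp_one_lt_d9]
  have hE : (0 : ℝ) ≤ I.edges.card := Nat.cast_nonneg _
  refine ⟨t, ht, hle.trans ?_, fun hxK => hle.trans ?_⟩
  · rw [mul_assoc (20000 * c ^ 4) (2 * c ^ 2 + c + 1)]
    refine mul_le_mul_of_nonneg_left ?_ (by positivity)
    have h1 : (I.edges.card : ℝ) * (L : ℝ) ^ 2 ≤ I.edges.card * (c * F n) ^ 2 := by gcongr
    have h2 : (n : ℝ) * L * Real.log n ≤ n * (c * F n) * √n := by
      gcongr
      exact (le_self_pow₀ hx (by norm_num)).trans hlog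
    have h3 : (K : ℝ) * n * L ≤ (c * √n) * n * (c * F n) := by gcongr
    have h4 : 0 ≤ (I.edges.card : ℝ) * F n ^ 2 := by positivity
    have h5 : 0 ≤ √n * n * F n := by positivity
    have e1 : (I.edges.card : ℝ) * (c * F n) ^ 2 = c ^ 2 * (I.edges.card * F n ^ 2) := by ring
    have e2 : (n : ℝ) * (c * F n) * √n = c * (√n * n * F n) := by ring
    have e3 : (c * √n) * n * (c * F n) = c ^ 2 * (√n * n * F n) := by ring
    have h6 : 0 ≤ (c ^ 2 + c + 1) * ((I.edges.card : ℝ) * F n ^ 2) := by positivity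
    have h7 : 0 ≤ (c ^ 2 + 1) * (√n * n * F n) := by positivity
    linarith
  · rw [mul_assoc (20000 * c ^ 4) (2 * c ^ 2 + c + 1)]
    refine mul_le_mul_of_nonneg_left ?_ (by positivity)
    have h1 : (n : ℝ) * L * Real.log n ≤ n * L * (c * K) := by gcongr
    have h2 : 0 ≤ (2 * c ^ 2 + c) * ((I.edges.card : ℝ) * (L : ℝ) ^ 2) := by positivity
    have h3 : 0 ≤ (2 * c ^ 2) * ((K : ℝ) * n * L) := by positivity
    linarith
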